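/- \textbf{Learnability of the target class.} Let $d,k\in\mathbb N$ with $d\ge 1$, $k\ge 3$, and let $0<\kappa\le\mathcal K$ and $M\ge 0$. \emph{Source.} $\nu$ is a probability measure on $[0,1]^d$ with density $f_\nu(x)=\prod_{i=1}^d f_{\nu_i}(x_i)$, where $f_{\nu_i}\in C^k([0,1])$ is the density of the $i$-th marginal $\nu_i$ of $\nu$; $f_\nu$ is $L_\nu$-Lipschitz on $[0,1]^d$ for the Euclidean norm. \emph{Target class.} $\mathcal T$ is a class of probability measures $\mu$ on $[0,1]^d$ with densities $f_\mu\in C^k([0,1]^d)$. All densities satisfy $\kappa\le f_\nu,f_\mu\le\mathcal K$ on $[0,1]^d$ and $\|f_\nu\|_{C^k([0,1]^d)}\le M$, $\|f_\mu\|_{C^k([0,1]^d)}\le M$. Here $\|f\|_{C^k}=\max_{|\beta|\le k}\sup\|D^\beta f\|_2$. \emph{Target field.} Let $T$ be the Knothe--Rosenblatt transport from $\nu$ to $\mu$, that is $T_i(x)=F_{\mu,i}^{-1}\big(F_{\nu,i}(x_i\mid x_1,\dots,x_{i-1})\mid T_1(x),\dots,T_{i-1}(x)\big)$ with $F_{\bullet,i}(\cdot\mid\cdot)$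 the conditional distribution function of the $i$-th coordinate given the preceding ones. Let $I_t(x)=tT(x)+(1-t)x$, $G(y,t)=I_t^{-1}(y)$ and $u^\mu_t(y)=T(G(y,t))-G(y,t)$ for $(y,t)\in[0,1]^d\times[0,1]$. \emph{Networks.} For $L,W\in\mathbb N$ let $\Theta^{L,W}=[-1,1]^q$ be the set of parameters (weights and biases) of the fully connected networks $v^\theta:\mathbb R^{d+1}\to\mathbb R^d$, $(x,t)\mapsto v^\theta_t(x)$, with $L$ hidden layers, each of width $W$, and activation $r\mapsto\max(r,0)^2$. Let $\eta_d(x)=(x_i(1-x_i))_{i\le d}$, let $\otimes$ be the componentwise product, and let $\Phi^\theta$ be the time-one flow map on $[0,1]^d$ of $\dot y=v^\theta_t(y)\otimes\eta_d(y)$. Then there are constants $c\ge 2$ and $\tilde c>0$ depending only on $d,k,\kappa,\mathcal K,M$, and a constant $C>0$ depending only on $d,k,\kappa,\mathcal K,M,L_\nu$, such that for all such $\nu$, all $\mu\in\mathcal T$, all $K\in\mathbb N$ with $K>2(k+1)$, all \[ L\ \ge\ 6+2\big((k-1)-2\big)+\lceil\log_2(d+1)\rceil+2\big(\lceil\log_2((2k-1)(d+1))\rceil+\log_2\log_2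 c+1\big) \] and $W=\lceil 12(d+1)(3K)^{d+1}\rceil$: \begin{enumerate} \item some $\theta\in\Theta^{L,W}$ satisfies $\|v^\theta\otimes\eta_d-u^\mu\|_{C^1([0,1]^{d+1};\mathbb R^d)}\le \tilde c\,K^{-(k-1)}$; in particular $\inf_{\theta\in\Theta^{L,W}}\|v^\theta\otimes\eta_d-u^\mu\|_{C^1}\le \tilde c\,K^{-(k-1)}$; \item if $\inf_{\theta\in\Theta^{L,W}}\|v^\theta\otimes\eta_d-u^\mu\|_{C^1}\le 1$, then $\inf_{\theta\in\Theta^{L,W}}\mathrm{KL}(\mu\,\|\,\Phi^\theta_*\nu)\le C\,K^{-(k-1)}$. \end{enumerate} -/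

import Mathlib

open MeasureTheory Set
open scoped ENNReal NNReal Matrix

noncomputable section

namespace LtI

/-! ### The unit cube and `C^k` norms -/

/-- The closed unit cube `[0,1]^n`. -/
def cube (n : ℕ) : Set (Fin n → ℝ) := Icc 0 1

open Classical in
/-- The norm of `C^k([0,1]^n; F)`: the maximum over the multi-indices `β` with `|β| ≤ k` of
`sup ‖D^β f‖` over the closed cube, and `∞` if `f` is not `C^k` on the closed cube.
The multi-indices of order `j` are listed as sequences `i` of `j` coordinate directions. -/
def ckNorm {n : ℕ} {F : Type*} [NormedAddCommGroup F] [NormedSpace ℝ F]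
    (k : ℕ) (f : (Fin n → ℝ) → F) : ℝ≥0∞ :=
  if ContDiffOn ℝ k f (cube n) then
    ⨆ (j : ℕ) (_ : j ≤ k) (i : Fin j → Fin n) (x ∈ cube n),
      ‖iteratedFDerivWithin ℝ j f (cube n) x (fun l => Pi.single (i l) (1 : ℝ))‖ₑ
  else ⊤

/-- The `C^k([0,1]^{d+1}; ℝ^d)` norm of a time-dependent vector field `(x, t) ↦ w x t` on `[0,1]^d`
(time is the last of the `d + 1` variables, the values carry the Euclidean norm). -/
def fieldCkNorm {d : ℕ} (k : ℕ) (w : (Fin d → ℝ) → ℝ → (Fin d → ℝ)) : ℝ≥0∞ :=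
  ckNorm k (fun z : Fin (d + 1) → ℝ =>
    (WithLp.toLp 2 (w (fun i => z i.castSucc) (z (Fin.last d))) : EuclideanSpace ℝ (Fin d)))

/-! ### Source and target distributions -/

/-- `μ` is a probability measure on `[0,1]^d` with a density `f ∈ C^k([0,1]^d)` such that
`κ ≤ f ≤ 𝒦` on the cube and `‖f‖_{C^k} ≤ M`. -/
structure HasCkDensity {d : ℕ} (k : ℕ) (κ 𝒦 : ℝ) (M : ℝ≥0) (μ : Measure (Fin d → ℝ))
    (f : (Fin d → ℝ) → ℝ) : Prop where
  prob : IsProbabilityMeasure μ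
  density : μ = (volume.restrict (cube d)).withDensity (fun x => ENNReal.ofReal (f x))
  norm_le : ckNorm k f ≤ M
  lower : ∀ x ∈ cube d, κ ≤ f x
  upper : ∀ x ∈ cube d, f x ≤ 𝒦

/-- The density `f` of `ν` is the product of `C^k` densities of the one-dimensional marginals. -/
def HasProductDensity {d : ℕ} (k : ℕ) (ν : Measure (Fin d → ℝ)) (f : (Fin d → ℝ) → ℝ) : Prop :=
  ∃ g : Fin d → ℝ → ℝ,
    (∀ i, ContDiffOn ℝ k (g i) (Icc 0 1)) ∧
    (∀ i, ν.map (fun x => x i) =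
      (volume.restrict (Icc (0 : ℝ) 1)).withDensity (fun s => ENNReal.ofReal (g i s))) ∧
    ∀ x ∈ cube d, f x = ∏ i, g i (x i)

/-- `f` is `Lip`-Lipschitz on the cube for the Euclidean distance. -/
def IsLipschitzOnCube {d : ℕ} (Lip : ℝ≥0) (f : (Fin d → ℝ) → ℝ) : Prop :=
  ∀ x ∈ cube d, ∀ y ∈ cube d,
    |f x - f y| ≤ Lip * ‖(WithLp.toLp 2 (x - y) : EuclideanSpace ℝ (Fin d))‖

/-! ### Knothe–Rosenblatt transport and the displacement vector field -/

/-- Marginal density of the first `m` coordinates (it depends only on `x i` with `i < m`). -/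
def marginal {d : ℕ} (f : (Fin d → ℝ) → ℝ) (m : ℕ) (x : Fin d → ℝ) : ℝ :=
  ∫ z in Icc (0 : {i : Fin d // m ≤ i.val} → ℝ) 1,
    f (fun i => if h : m ≤ i.val then z ⟨i, h⟩ else x i)

/-- Conditional density, at `x i`, of the `i`-th coordinate given `x j`, `j < i`. -/
def condDensity {d : ℕ} (f : (Fin d → ℝ) → ℝ) (i : Fin d) (x : Fin d → ℝ) : ℝ :=
  marginal f (i.val + 1) x / marginal f i.val x

/-- Conditional distribution function `s ↦ F_i(s | x j, j < i)`. -/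
def condCDF {d : ℕ} (f : (Fin d → ℝ) → ℝ) (i : Fin d) (x : Fin d → ℝ) (s : ℝ) : ℝ :=
  ∫ z in (0 : ℝ)..s, condDensity f i (Function.update x i z)

/-- The `i`-th component of the Knothe–Rosenblatt transport from the density `fν` to the
density `fμ`: `T_i(x) = F_{μ,i}⁻¹(F_{ν,i}(x i | x j, j < i) | T_j(x), j < i)`, where the inverse is
that of a map of `[0,1]`. (The conditional distribution function ignores the entries `j ≥ i` of
its conditioning argument; they are set to `0`.) -/
def krComponent {d : ℕ} (fν fμ : (Fin d → ℝ) → ℝ) (x : Fin d → ℝ) (i : Fin d) : ℝ :=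
  Function.invFunOn
    (condCDF fμ i (fun j => if _h : j.val < i.val then krComponent fν fμ x j else 0))
    (Icc 0 1) (condCDF fν i x (x i))
termination_by i.val

/-- The Knothe–Rosenblatt transport `T`. -/
def krMap {d : ℕ} (fν fμ : (Fin d → ℝ) → ℝ) (x : Fin d → ℝ) : Fin d → ℝ :=
  fun i => krComponent fν fμ x i

/-- Displacement interpolation `I_t(x) = t T(x) + (1 - t) x`. -/
def displacement {d : ℕ} (fν fμ : (Fin d → ℝ) → ℝ) (t : ℝ) (x : Fin d → ℝ) : Fin d → ℝ :=
  t • krMap fν fμ x + (1 - t) • x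

/-- `G(y, t) = I_t⁻¹(y)`, the inverse being that of a map of the cube. -/
def displacementInv {d : ℕ} (fν fμ : (Fin d → ℝ) → ℝ) (y : Fin d → ℝ) (t : ℝ) : Fin d → ℝ :=
  Function.invFunOn (displacement fν fμ t) (cube d) y

/-- The target vector field `u_t(y) = T(G(y,t)) - G(y,t)`. -/
def targetField {d : ℕ} (fν fμ : (Fin d → ℝ) → ℝ) (y : Fin d → ℝ) (t : ℝ) : Fin d → ℝ :=
  krMap fν fμ (displacementInv fν fμ y t) - displacementInv fν fμ y t

/-! ### Fully connected networks -/

/-- Parameters of a fully connected network with outputs in `ℝ^m` and inputs in `ℝ^n` (the index):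
either a final affine map, or an affine map into a hidden layer of width `h` followed by a
network on that layer. -/
inductive Net (m : ℕ) : ℕ → Type
  | output {n : ℕ} (A : Matrix (Fin m) (Fin n) ℝ) (b : Fin m → ℝ) : Net m n
  | hidden {n h : ℕ} (A : Matrix (Fin h) (Fin n) ℝ) (b : Fin h → ℝ) (rest : Net m h) : Net m n

/-- The function computed with the activation `ReLU^s(r) = max(r, 0)^s` on the hidden layers. -/
def Net.eval {m : ℕ} (s : ℕ) : {n : ℕ} → Net m n → (Fin n → ℝ) → (Fin m → ℝ)
  | _, .output A b, x => A *ᵥ x + b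
  | _, .hidden A b rest, x => rest.eval s (fun i => (max ((A *ᵥ x + b) i) 0) ^ s)

/-- The widths of the hidden layers, from input to output. -/
def Net.hiddenWidths {m : ℕ} : {n : ℕ} → Net m n → List ℕ
  | _, .output _ _ => []
  | _, .hidden (h := h) _ _ rest => h :: rest.hiddenWidths

/-- All weights and biases lie in `[-1,1]`. -/
def Net.UnitParams {m : ℕ} : {n : ℕ} → Net m n → Prop
  | _, .output A b => (∀ i j, A i j ∈ Icc (-1 : ℝ) 1) ∧ ∀ i, b i ∈ Icc (-1 : ℝ) 1
  | _, .hidden A b rest =>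
      ((∀ i j, A i j ∈ Icc (-1 : ℝ) 1) ∧ ∀ i, b i ∈ Icc (-1 : ℝ) 1) ∧ rest.UnitParams

/-- The parameter set `Θ^{L,W}`: networks from `ℝ^{d+1}` to `ℝ^d` with `L` hidden layers, all of
width `W`, and all parameters in `[-1,1]`. -/
def paramSet (d L W : ℕ) : Set (Net d (d + 1)) :=
  {θ | θ.hiddenWidths = List.replicate L W ∧ θ.UnitParams}

/-- The masked `ReQU` field `v^θ_t(x) ⊗ η_d(x)`, where `η_d(x)_i = x_i (1 - x_i)`. -/
def maskedField {d : ℕ} (θ : Net d (d + 1)) (x : Fin d → ℝ) (t : ℝ) : Fin d → ℝ :=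
  fun i => θ.eval 2 (Fin.snoc x t) i * (x i * (1 - x i))

/-! ### Flows and errors -/

open Classical in
/-- The endpoint at time `1` of the flow on `[0,1]^d` of the time-dependent field `w`:
`y(1)`, where `y' = w(y, t)` on `[0,1]`, `y(0) = x`. (Set to `x` if there is no solution in the
cube, in particular for `x` outside the cube.) -/
def flowEndpoint {d : ℕ} (w : (Fin d → ℝ) → ℝ → (Fin d → ℝ)) (x : Fin d → ℝ) : Fin d → ℝ :=
  if h : ∃ y : ℝ → Fin d → ℝ, y 0 = x ∧ ∀ t ∈ Icc (0 : ℝ) 1,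
      y t ∈ cube d ∧ HasDerivWithinAt y (w (y t) t) (Icc 0 1) t
  then h.choose 1 else x

/-- The model distribution `μ_θ = Φ^θ_* ν`. -/
def modelMeasure {d : ℕ} (ν : Measure (Fin d → ℝ)) (θ : Net d (d + 1)) : Measure (Fin d → ℝ) :=
  ν.map (flowEndpoint (maskedField θ))

/-- The error `‖v^θ ⊗ η_d - u‖_{C^1([0,1]^{d+1})}` against the target vector field. -/
def c1Error {d : ℕ} (fν fμ : (Fin d → ℝ) → ℝ) (θ : Net d (d + 1)) : ℝ≥0∞ :=
  fieldCkNorm 1 (fun x t => maskedField θ x t - targetField fν fμ x t)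

/-- The lower bound on the number of hidden layers. -/
def depthBound (d k : ℕ) (c : ℝ) : ℝ :=
  6 + 2 * (((k : ℝ) - 1) - 2) + ⌈Real.logb 2 ((d : ℝ) + 1)⌉
    + 2 * (⌈Real.logb 2 ((2 * (k : ℝ) - 1) * ((d : ℝ) + 1))⌉
      + Real.logb 2 (Real.logb 2 c) + 1)

/-- The width of the hidden layers (`12 (d+1) (3K)^{d+1}`, an integer). -/
def netWidth (d K : ℕ) : ℕ := 12 * (d + 1) * (3 * K) ^ (d + 1)

/-- `inf_θ ‖v^θ ⊗ η_d - u‖_{C^1}` over `θ ∈ Θ^{L,W}`. -/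
def infC1Error {d : ℕ} (L W : ℕ) (fν fμ : (Fin d → ℝ) → ℝ) : ℝ≥0∞ :=
  ⨅ θ ∈ paramSet d L W, c1Error fν fμ θ

/-- The model error `inf_θ KL(μ ‖ Φ^θ_* ν)` over `θ ∈ Θ^{L,W}`. -/
def modelError {d : ℕ} (L W : ℕ) (ν μ : Measure (Fin d → ℝ)) : ℝ≥0∞ :=
  ⨅ θ ∈ paramSet d L W, InformationTheory.klDiv μ (modelMeasure ν θ)

end LtI

end

open LtI MeasureTheory
open scoped ENNReal NNReal

open MeasureTheory Set
open scoped ENNReal NNReal Matrix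

noncomputable section

namespace LtI

/-! ### Uniformly `C^k` families on the cube -/

/-! Regularity. Every object built from the two densities (marginals, conditional distribution
functions, the transport `T`, the inverse of `I_t`, the field `u`) arises by sums, products,
quotients, compositions, parameter integrals and the solution of scalar monotone equations.
`UniformCk` is stable under all of these (`UniformCk.comp`, `UniformCk.integral_mix`,
`UniformCk.solve`), and it treats whole families at once. With the set of all admissible pairs of
densities as index set, `u` is bounded in `C^k` by a constant that depends on `d, k, κ, 𝒦, M` only.
The bounds `κ ≤ f ≤ 𝒦` supply the slope bound that makes the scalar equations uniformly solvable.
Moreover `T` and `I_t` map each face of the cube to itself, so the component `u_e` vanishes where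
`y_e` is `0` or `1` (`targetST_eq_zero`).

Approximation. Because of this vanishing, Taylor polynomials of `u_e` can be corrected so that they
are divisible by `1 - y_e` or by `-y_e`, without loss of order in `C¹` (`mul_sum_maskCoef`,
`exists_grad_mask`). Localizing with a quadratic spline partition of unity on a grid of mesh `1/N`,
and weighting the two faces by `y_e` and `1 - y_e`, gives `y_e (1 - y_e) V` within `N^{-(k-1)}` of
`u_e` in `C¹` (`exists_masked_approx`).

Networks. `V` is a sum of products of boundedly many affine functions and splines. All of these are
exact combinations of squares `max(r, 0)²`, since `xy` is a difference of two squares. The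
coefficients grow like a power of `N`; with parameters in `[-1, 1]` such a factor is produced by
summing `N` copies of a neuron in each of boundedly many layers (`Readout.amplify_pow`). The depth
is thus a constant `L₀` and the width is of order `N^{d+1}`, so `N` may be a fixed fraction of `K`.
The constant `c = 2^(2^L₀)` turns the depth hypothesis into `L₀ ≤ L`.

Divergence. The curves `t ↦ I_t(x)` are the flow lines of `u`, so its time-one flow is `T`, and `T`
pushes `ν` to `μ` (`setLIntegral_krMap`). If `w` is `ε`-close to `u` in `C¹`, two Grönwall estimates
make its flow `Φ` close to `T` in the Lipschitz norm (`flowEndpoint_close_krMap`). Then `T⁻¹ ∘ Φ` is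
within `O(ε)` of the identity and has Lipschitz constant `1 + O(ε)`, hence `μ(A) ≤ e^{O(ε)}
(Φ_*ν)(A)` for every Borel set `A`. The likelihood ratio is therefore at most `e^{O(ε)}` and the
divergence is `O(ε)` (`klDiv_map_flowEndpoint_le`). Only Lipschitz bounds on `Φ` enter, never its
derivative. -/

lemma convex_cube (n : ℕ) : Convex ℝ (cube n) := convex_Icc 0 1

lemma isCompact_cube (n : ℕ) : IsCompact (cube n) := isCompact_Icc

lemma measurableSet_cube (n : ℕ) : MeasurableSet (cube n) := measurableSet_Icc

lemma mem_cube {n : ℕ} {x : Fin n → ℝ} : x ∈ cube n ↔ ∀ j, x j ∈ Icc (0 : ℝ) 1 := by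
  simp only [cube, mem_Icc, Pi.le_def, Pi.zero_apply, Pi.one_apply]
  exact forall_and.symm

lemma zero_mem_cube (n : ℕ) : (0 : Fin n → ℝ) ∈ cube n := left_mem_Icc.2 (zero_le_one)

lemma interior_cube_nonempty (n : ℕ) : (interior (cube n)).Nonempty := by
  refine ⟨fun _ => 1 / 2, ?_⟩
  have h : Set.pi univ (fun _ : Fin n => Ioo (0 : ℝ) 1) ⊆ cube n := fun x hx =>
    mem_cube.2 fun j => Ioo_subset_Icc_self (hx j (mem_univ j))
  refine interior_maximal h (isOpen_set_pi finite_univ fun _ _ => isOpen_Ioo) ?_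
  intro j _
  norm_num

lemma uniqueDiffOn_cube (n : ℕ) : UniqueDiffOn ℝ (cube n) :=
  uniqueDiffOn_convex (convex_cube n) (interior_cube_nonempty n)

lemma update_mem_cube {n : ℕ} {x : Fin n → ℝ} (hx : x ∈ cube n) (i : Fin n) {s : ℝ}
    (hs : s ∈ Icc (0 : ℝ) 1) : Function.update x i s ∈ cube n := by
  rw [mem_cube] at hx ⊢
  intro j
  rcases eq_or_ne j i with rfl | h
  · simpa using hs
  · simpa [h] using hx j

lemma norm_sub_le_one_of_mem_cube {n : ℕ} {x y : Fin n → ℝ} (hx : x ∈ cube n) (hy : y ∈ cube n) :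
    ‖x - y‖ ≤ 1 := by
  rw [pi_norm_le_iff_of_nonneg zero_le_one]
  intro j
  have h1 := mem_cube.1 hx j
  have h2 := mem_cube.1 hy j
  rw [Real.norm_eq_abs, abs_le, Pi.sub_apply]
  constructor <;> linarith [h1.1, h1.2, h2.1, h2.2]

/-- The linear form with coefficients `c`. -/
def gradCLM {n : ℕ} (c : Fin n → ℝ) : (Fin n → ℝ) →L[ℝ] ℝ :=
  ∑ j, c j • ContinuousLinearMap.proj (R := ℝ) (φ := fun _ : Fin n => ℝ) j

lemma gradCLM_apply {n : ℕ} (c v : Fin n → ℝ) : gradCLM c v = ∑ j, c j * v j := by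
  simp [gradCLM]

lemma gradCLM_single {n : ℕ} (c : Fin n → ℝ) (j : Fin n) : gradCLM c (Pi.single j 1) = c j := by
  rw [gradCLM_apply, Finset.sum_eq_single j]
  · simp
  · intro b _ hb
    simp [hb]
  · simp

lemma eq_gradCLM {n : ℕ} (A : (Fin n → ℝ) →L[ℝ] ℝ) : A = gradCLM fun j => A (Pi.single j 1) := by
  ext v
  rw [gradCLM_apply]
  conv_lhs => rw [← Finset.univ_sum_single v]
  rw [map_sum]
  refine Finset.sum_congr rfl fun j _ => ?_
  rw [show (Pi.single j (v j) : Fin n → ℝ) = v j • Pi.single j (1 : ℝ) by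
    rw [← Pi.single_smul, smul_eq_mul, mul_one], map_smul, smul_eq_mul, mul_comm]

lemma abs_gradCLM_apply_le {n : ℕ} {c : Fin n → ℝ} {B : ℝ} (hc : ∀ j, |c j| ≤ B) (v : Fin n → ℝ) :
    |gradCLM c v| ≤ n * B * ‖v‖ := by
  rw [gradCLM_apply]
  calc |∑ j, c j * v j| ≤ ∑ j : Fin n, B * ‖v‖ := by
        refine (Finset.abs_sum_le_sum_abs _ _).trans (Finset.sum_le_sum fun j _ => ?_)
        rw [abs_mul]
        exact mul_le_mul (hc j) (norm_le_pi_norm v j) (abs_nonneg _) ((abs_nonneg _).trans (hc j))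
    _ = n * B * ‖v‖ := by simp [mul_assoc]

lemma norm_gradCLM_le {n : ℕ} {c : Fin n → ℝ} {B : ℝ} (hB : 0 ≤ B) (hc : ∀ j, |c j| ≤ B) :
    ‖gradCLM c‖ ≤ n * B :=
  ContinuousLinearMap.opNorm_le_bound _ (by positivity) fun v => abs_gradCLM_apply_le hc v

lemma hasFDerivWithinAt_cube_unique {n : ℕ} {f : (Fin n → ℝ) → ℝ} {c c' : Fin n → ℝ}
    {x : Fin n → ℝ} (hx : x ∈ cube n) (h : HasFDerivWithinAt f (gradCLM c) (cube n) x)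
    (h' : HasFDerivWithinAt f (gradCLM c') (cube n) x) : c = c' := by
  have := (uniqueDiffOn_cube n x hx).eq h h'
  funext j
  rw [← gradCLM_single c j, this, gradCLM_single]

/-- A family of functions that are `C^k` on the closed cube, with all derivatives of order at most
`k` bounded uniformly over the family. -/
def UniformCk {ι : Type*} {n : ℕ} : ℕ → (ι → (Fin n → ℝ) → ℝ) → Prop
  | 0, F => (∃ B : ℝ, ∀ i, ∀ x ∈ cube n, |F i x| ≤ B) ∧ ∀ i, ContinuousOn (F i) (cube n)
  | k + 1, F => (∃ B : ℝ, ∀ i, ∀ x ∈ cube n, |F i x| ≤ B) ∧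
      ∃ F' : Fin n → ι → (Fin n → ℝ) → ℝ,
        (∀ i, ∀ x ∈ cube n, HasFDerivWithinAt (F i) (gradCLM fun j => F' j i x) (cube n) x) ∧
        ∀ j, UniformCk k (F' j)

namespace UniformCk

variable {ι : Type*} {n m : ℕ} {k : ℕ} {F G : ι → (Fin n → ℝ) → ℝ}

lemma bounded (h : UniformCk k F) : ∃ B : ℝ, 0 < B ∧ ∀ i, ∀ x ∈ cube n, |F i x| ≤ B := by
  obtain ⟨B, hB⟩ : ∃ B : ℝ, ∀ i, ∀ x ∈ cube n, |F i x| ≤ B := by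
    cases k with
    | zero => exact h.1
    | succ k => exact h.1
  exact ⟨max B 1, by positivity, fun i x hx => (hB i x hx).trans (le_max_left _ _)⟩

lemma continuousOn (h : UniformCk k F) (i : ι) : ContinuousOn (F i) (cube n) := by
  cases k with
  | zero => exact h.2 i
  | succ k =>
    obtain ⟨-, F', hF', -⟩ := h
    exact fun x hx => (hF' i x hx).continuousWithinAt

lemma of_succ (h : UniformCk (k + 1) F) : UniformCk k F := by
  induction k generalizing F with
  | zero => exact ⟨h.1, h.continuousOn⟩
  | succ k ih =>
    obtain ⟨hB, F', hF', hk⟩ := h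
    exact ⟨hB, F', hF', fun j => ih (hk j)⟩

lemma mono {l : ℕ} (h : UniformCk k F) (hl : l ≤ k) : UniformCk l F := by
  obtain ⟨m, rfl⟩ := Nat.exists_eq_add_of_le hl
  clear hl
  induction m with
  | zero => exact h
  | succ m ih => exact ih (of_succ h)

lemma congr (h : UniformCk k F) (hFG : ∀ i, ∀ x ∈ cube n, F i x = G i x) : UniformCk k G := by
  cases k with
  | zero =>
    obtain ⟨⟨B, hB⟩, hc⟩ := h
    exact ⟨⟨B, fun i x hx => by rw [← hFG i x hx]; exact hB i x hx⟩,
      fun i => (hc i).congr fun x hx => (hFG i x hx).symm⟩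
  | succ k =>
    obtain ⟨⟨B, hB⟩, F', hF', hk⟩ := h
    exact ⟨⟨B, fun i x hx => by rw [← hFG i x hx]; exact hB i x hx⟩, F',
      fun i x hx => (hF' i x hx).congr (fun y hy => (hFG i y hy).symm) (hFG i x hx).symm, hk⟩

lemma reindex {ι' : Type*} (h : UniformCk k F) (σ : ι' → ι) : UniformCk k fun i => F (σ i) := by
  induction k generalizing F with
  | zero =>
    obtain ⟨⟨B, hB⟩, hc⟩ := h
    exact ⟨⟨B, fun i => hB (σ i)⟩, fun i => hc (σ i)⟩
  | succ k ih =>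
    obtain ⟨⟨B, hB⟩, F', hF', hk⟩ := h
    exact ⟨⟨B, fun i => hB (σ i)⟩, fun j i => F' j (σ i), fun i => hF' (σ i), fun j => ih (hk j)⟩

/-- Allows constants that vary with the index, such as a frozen time. -/
lemma const_of_bounded (c : ι → ℝ) {B : ℝ} (hc : ∀ i, |c i| ≤ B) :
    UniformCk k fun i (_ : Fin n → ℝ) => c i := by
  induction k generalizing c B with
  | zero => exact ⟨⟨B, fun i _ _ => hc i⟩, fun i => continuousOn_const⟩
  | succ k ih =>
    refine ⟨⟨B, fun i _ _ => hc i⟩, fun _ _ _ => 0, fun i x _ => ?_,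
      fun j => ih (fun _ => 0) (B := 0) (by simp)⟩
    convert hasFDerivWithinAt_const (c i) x (cube n)
    ext v
    simp [gradCLM_apply]

lemma const (c : ℝ) : UniformCk k fun (_ : ι) (_ : Fin n → ℝ) => c :=
  const_of_bounded (fun _ => c) fun _ => le_rfl

lemma coord (j : Fin n) : UniformCk k fun (_ : ι) (x : Fin n → ℝ) => x j := by
  have hb : ∃ B : ℝ, ∀ _ : ι, ∀ x ∈ cube n, |x j| ≤ B := ⟨1, fun _ x hx => by
    have := mem_cube.1 hx j
    rw [abs_of_nonneg this.1]
    exact this.2⟩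
  cases k with
  | zero => exact ⟨hb, fun i => (continuous_apply j).continuousOn⟩
  | succ k =>
    refine ⟨hb, fun l _ _ => if l = j then 1 else 0, fun i x _ => ?_, fun l => const _⟩
    refine ((ContinuousLinearMap.proj (R := ℝ) (φ := fun _ : Fin n => ℝ) j).hasFDerivWithinAt
      (s := cube n) (x := x)).congr_fderiv ?_
    ext v
    simp [gradCLM_apply]

lemma add (hF : UniformCk k F) (hG : UniformCk k G) : UniformCk k fun i x => F i x + G i x := by
  induction k generalizing F G with
  | zero =>
    obtain ⟨⟨B, hB⟩, hc⟩ := hF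
    obtain ⟨⟨C, hC⟩, hd⟩ := hG
    exact ⟨⟨B + C, fun i x hx => (abs_add_le _ _).trans (add_le_add (hB i x hx) (hC i x hx))⟩,
      fun i => (hc i).add (hd i)⟩
  | succ k ih =>
    obtain ⟨⟨B, hB⟩, F', hF', hk⟩ := hF
    obtain ⟨⟨C, hC⟩, G', hG', hl⟩ := hG
    refine ⟨⟨B + C, fun i x hx => (abs_add_le _ _).trans (add_le_add (hB i x hx) (hC i x hx))⟩,
      fun j i x => F' j i x + G' j i x, fun i x hx => ?_, fun j => ih (hk j) (hl j)⟩
    refine ((hF' i x hx).add (hG' i x hx)).congr_fderiv ?_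
    ext v
    simp [gradCLM_apply, add_mul, Finset.sum_add_distrib]

lemma mul (hF : UniformCk k F) (hG : UniformCk k G) : UniformCk k fun i x => F i x * G i x := by
  induction k generalizing F G with
  | zero =>
    obtain ⟨⟨B, hB⟩, hc⟩ := hF
    obtain ⟨⟨C, hC⟩, hd⟩ := hG
    refine ⟨⟨B * C, fun i x hx => ?_⟩, fun i => (hc i).mul (hd i)⟩
    rw [abs_mul]
    exact mul_le_mul (hB i x hx) (hC i x hx) (abs_nonneg _) ((abs_nonneg _).trans (hB i x hx))
  | succ k ih =>
    have hF0 := of_succ hF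
    have hG0 := of_succ hG
    obtain ⟨⟨B, hB⟩, F', hF', hk⟩ := hF
    obtain ⟨⟨C, hC⟩, G', hG', hl⟩ := hG
    refine ⟨⟨B * C, fun i x hx => ?_⟩,
      fun j i x => F i x * G' j i x + F' j i x * G i x, fun i x hx => ?_,
      fun j => add (ih hF0 (hl j)) (ih (hk j) hG0)⟩
    · rw [abs_mul]
      exact mul_le_mul (hB i x hx) (hC i x hx) (abs_nonneg _) ((abs_nonneg _).trans (hB i x hx))
    refine ((hF' i x hx).mul (hG' i x hx)).congr_fderiv ?_
    ext v
    simp only [gradCLM_apply, add_apply, smul_apply,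
      smul_eq_mul, Finset.mul_sum, ← Finset.sum_add_distrib]
    exact Finset.sum_congr rfl fun j _ => by ring

lemma const_mul (c : ℝ) (hF : UniformCk k F) : UniformCk k fun i x => c * F i x :=
  mul (const c) hF

lemma neg (hF : UniformCk k F) : UniformCk k fun i x => -F i x :=
  (const_mul (-1) hF).congr fun i x _ => by ring

lemma sub (hF : UniformCk k F) (hG : UniformCk k G) : UniformCk k fun i x => F i x - G i x :=
  (add hF (neg hG)).congr fun i x _ => by ring

lemma sum {β : Type*} (s : Finset β) {F : β → ι → (Fin n → ℝ) → ℝ}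
    (h : ∀ b ∈ s, UniformCk k (F b)) : UniformCk k fun i x => ∑ b ∈ s, F b i x := by
  classical
  induction s using Finset.induction_on with
  | empty => simpa using const (k := k) (ι := ι) (n := n) 0
  | insert b s hb ih =>
    refine (add (h b (Finset.mem_insert_self b s))
      (ih fun c hc => h c (Finset.mem_insert_of_mem hc))).congr fun i x _ => ?_
    rw [Finset.sum_insert hb]

/-- The derivative `-F' F⁻²` contains `F⁻¹` only to order `k`, which the induction hypothesis
already controls. -/
lemma inv (hF : UniformCk k F) {c : ℝ} (hc : 0 < c) (hFc : ∀ i, ∀ x ∈ cube n, c ≤ F i x) :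
    UniformCk k fun i x => (F i x)⁻¹ := by
  have hb : ∃ B : ℝ, ∀ i, ∀ x ∈ cube n, |(F i x)⁻¹| ≤ B := ⟨c⁻¹, fun i x hx => by
    have h := hFc i x hx
    rw [abs_of_pos (inv_pos.2 (hc.trans_le h))]
    exact inv_anti₀ hc h⟩
  have hne : ∀ i, ∀ x ∈ cube n, F i x ≠ 0 := fun i x hx => (hc.trans_le (hFc i x hx)).ne'
  induction k with
  | zero => exact ⟨hb, fun i => (hF.2 i).inv₀ (hne i)⟩
  | succ k ih =>
    have hinv := ih (of_succ hF)
    obtain ⟨-, F', hF', hk⟩ := hF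
    refine ⟨hb, fun j i x => -(F' j i x * ((F i x)⁻¹ * (F i x)⁻¹)), fun i x hx => ?_,
      fun j => neg (mul (hk j) (mul hinv hinv))⟩
    have := (hasDerivAt_inv (hne i x hx)).comp_hasFDerivWithinAt x (hF' i x hx)
    refine (this.congr_fderiv ?_)
    ext v
    simp only [gradCLM_apply, smul_apply, smul_eq_mul, Finset.mul_sum]
    refine Finset.sum_congr rfl fun j _ => ?_
    have := hne i x hx
    field_simp

lemma div (hF : UniformCk k F) (hG : UniformCk k G) {c : ℝ} (hc : 0 < c)
    (hGc : ∀ i, ∀ x ∈ cube n, c ≤ G i x) : UniformCk k fun i x => F i x / G i x := by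
  simp only [div_eq_mul_inv]
  exact mul hF (inv hG hc hGc)

lemma comp {H : Fin n → ι → (Fin m → ℝ) → ℝ} (hF : UniformCk k F) (hH : ∀ j, UniformCk k (H j))
    (hmaps : ∀ i, ∀ x ∈ cube m, (fun j => H j i x) ∈ cube n) :
    UniformCk k fun i x => F i fun j => H j i x := by
  have hcont : ∀ i, ContinuousOn (fun x => F i fun j => H j i x) (cube m) := fun i =>
    (hF.continuousOn i).comp (continuousOn_pi.2 fun j => (hH j).continuousOn i) (hmaps i)
  induction k generalizing F with
  | zero =>
    obtain ⟨⟨B, hB⟩, -⟩ := hF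
    exact ⟨⟨B, fun i x hx => hB i _ (hmaps i x hx)⟩, hcont⟩
  | succ k ih =>
    have hH0 : ∀ j, UniformCk k (H j) := fun j => of_succ (hH j)
    obtain ⟨⟨B, hB⟩, F', hF', hk⟩ := hF
    choose hHb H' hH' hHk using hH
    refine ⟨⟨B, fun i x hx => hB i _ (hmaps i x hx)⟩,
      fun l i x => ∑ j, F' j i (fun j => H j i x) * H' j l i x, fun i x hx => ?_, fun l => ?_⟩
    · have h1 : HasFDerivWithinAt (fun x => fun j => H j i x)
          (ContinuousLinearMap.pi fun j => gradCLM fun l => H' j l i x) (cube m) x :=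
        hasFDerivWithinAt_pi.2 fun j => hH' j i x hx
      refine ((hF' i _ (hmaps i x hx)).comp x h1 (hmaps i)).congr_fderiv ?_
      ext v
      simp only [gradCLM_apply, ContinuousLinearMap.comp_apply, ContinuousLinearMap.pi_apply,
        Finset.mul_sum, Finset.sum_mul]
      rw [Finset.sum_comm]
      exact Finset.sum_congr rfl fun l _ => Finset.sum_congr rfl fun j _ => by ring
    · exact sum _ fun j _ => mul
        (ih (hk j) hH0 fun i => (hk j).continuousOn i |>.comp
          (continuousOn_pi.2 fun j => (hH0 j).continuousOn i) (hmaps i)) (hHk j l)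

lemma update (i₀ : Fin n) {S : ι → (Fin n → ℝ) → ℝ} (hF : UniformCk k F) (hS : UniformCk k S)
    (hS01 : ∀ i, ∀ x ∈ cube n, S i x ∈ Icc (0 : ℝ) 1) :
    UniformCk k fun i x => F i (Function.update x i₀ (S i x)) := by
  have := comp (H := fun j i x => Function.update x i₀ (S i x) j) hF (fun j => ?_)
    (fun i x hx => update_mem_cube hx i₀ (hS01 i x hx))
  · exact this
  · rcases eq_or_ne j i₀ with rfl | h
    · simpa using hS
    · simpa [h] using coord (k := k) (ι := ι) j

lemma exists_grad (hF : UniformCk (k + 1) F) : ∃ F' : Fin n → ι → (Fin n → ℝ) → ℝ,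
    (∀ i, ∀ x ∈ cube n, HasFDerivWithinAt (F i) (gradCLM fun j => F' j i x) (cube n) x) ∧
    ∀ j, UniformCk k (F' j) := hF.2

lemma of_hasFDerivWithinAt (hF : UniformCk 0 F) {F' : Fin n → ι → (Fin n → ℝ) → ℝ}
    (h : ∀ i, ∀ x ∈ cube n, HasFDerivWithinAt (F i) (gradCLM fun j => F' j i x) (cube n) x)
    (h' : ∀ j, UniformCk k (F' j)) : UniformCk (k + 1) F := ⟨hF.1, F', h, h'⟩

lemma bounded_fin {β : Type*} [Finite β] {F : β → ι → (Fin n → ℝ) → ℝ}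
    (h : ∀ b, UniformCk k (F b)) : ∃ B : ℝ, 0 < B ∧ ∀ b i, ∀ x ∈ cube n, |F b i x| ≤ B := by
  cases nonempty_fintype β
  choose B hB0 hB using fun b => (h b).bounded
  refine ⟨1 + ∑ b, B b, by
    have := Finset.sum_nonneg fun b (_ : b ∈ Finset.univ) => (hB0 b).le
    linarith, fun b i x hx => (hB b i x hx).trans ?_⟩
  have := Finset.single_le_sum (fun b _ => (hB0 b).le) (Finset.mem_univ b)
  linarith

end UniformCk

/-! ### Mean value bounds, and the passage from `ckNorm` to `UniformCk`. -/

lemma abs_sub_le_of_hasFDerivWithinAt_gradCLM {n : ℕ} {f : (Fin n → ℝ) → ℝ}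
    {f' : Fin n → (Fin n → ℝ) → ℝ} {B : ℝ} {s : Set (Fin n → ℝ)} (hs : Convex ℝ s) (hB : 0 ≤ B)
    (h : ∀ x ∈ s, HasFDerivWithinAt f (gradCLM fun j => f' j x) s x)
    (hb : ∀ j, ∀ x ∈ s, |f' j x| ≤ B) {x y : Fin n → ℝ} (hx : x ∈ s) (hy : y ∈ s) :
    |f x - f y| ≤ n * B * ‖x - y‖ :=
  hs.norm_image_sub_le_of_norm_hasFDerivWithin_le h
    (fun z hz => norm_gradCLM_le hB fun j => hb j z hz) hy hx

lemma UniformCk.lipschitz {ι : Type*} {n k : ℕ} {F : ι → (Fin n → ℝ) → ℝ}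
    (hF : UniformCk (k + 1) F) : ∃ C : ℝ, 0 < C ∧ ∀ i, ∀ x ∈ cube n, ∀ y ∈ cube n,
      |F i x - F i y| ≤ C * ‖x - y‖ := by
  obtain ⟨F', hF', hk⟩ := hF.exists_grad
  obtain ⟨B, hB0, hB⟩ := UniformCk.bounded_fin hk
  refine ⟨n * B + 1, by positivity, fun i x hx y hy => ?_⟩
  refine (abs_sub_le_of_hasFDerivWithinAt_gradCLM (f' := fun j => F' j i) (convex_cube n) hB0.le
    (hF' i) (fun j => hB j i) hx hy).trans ?_
  nlinarith [norm_nonneg (x - y)]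

lemma contDiffOn_of_ckNorm_le {n k : ℕ} {f : (Fin n → ℝ) → ℝ} {M : ℝ≥0}
    (h : ckNorm k f ≤ M) : ContDiffOn ℝ k f (cube n) := by
  by_contra hc
  rw [ckNorm, if_neg hc] at h
  exact absurd h (by simp)

lemma abs_iteratedFDerivWithin_le_of_ckNorm_le {n k : ℕ} {f : (Fin n → ℝ) → ℝ} {M : ℝ≥0}
    (h : ckNorm k f ≤ M) {j : ℕ} (hj : j ≤ k) (I : Fin j → Fin n) {x : Fin n → ℝ}
    (hx : x ∈ cube n) :
    |iteratedFDerivWithin ℝ j f (cube n) x (fun l => Pi.single (I l) (1 : ℝ))| ≤ M := by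
  rw [ckNorm, if_pos (contDiffOn_of_ckNorm_le h)] at h
  simp only [iSup_le_iff] at h
  have := h j hj I x hx
  rw [← Real.norm_eq_abs, ← coe_nnnorm, NNReal.coe_le_coe]
  simpa [enorm] using this

lemma UniformCk.of_ckNorm_le {ι : Type*} {n k : ℕ} {F : ι → (Fin n → ℝ) → ℝ} {M : ℝ≥0}
    (h : ∀ i, ckNorm k (F i) ≤ M) : UniformCk k F := by
  -- Here `j` derivatives are already taken and `l` remain. Differentiating once more in direction
  -- `e` prepends `e` to the list of directions.
  have key : ∀ l j, j + l = k → ∀ I : Fin j → Fin n, UniformCk l fun i x =>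
      iteratedFDerivWithin ℝ j (F i) (cube n) x (fun q => Pi.single (I q) (1 : ℝ)) := by
    intro l
    induction l with
    | zero =>
      intro j hj I
      refine ⟨⟨M, fun i x hx => abs_iteratedFDerivWithin_le_of_ckNorm_le (h i) (by omega) I hx⟩,
        fun i => ?_⟩
      have := (contDiffOn_of_ckNorm_le (h i)).continuousOn_iteratedFDerivWithin (m := j)
        (by exact_mod_cast (by omega : j ≤ k)) (uniqueDiffOn_cube n)
      exact (ContinuousMultilinearMap.apply ℝ (fun _ => Fin n → ℝ) ℝ
        (fun q => Pi.single (I q) (1 : ℝ))).continuous.comp_continuousOn this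
    | succ l ih =>
      intro j hj I
      refine ⟨⟨M, fun i x hx => abs_iteratedFDerivWithin_le_of_ckNorm_le (h i) (by omega) I hx⟩,
        fun e i x => iteratedFDerivWithin ℝ (j + 1) (F i) (cube n) x
          (fun q => Pi.single ((Fin.cons e I : Fin (j + 1) → Fin n) q) (1 : ℝ)),
        fun i x hx => ?_, fun e => ih (j + 1) (by omega) _⟩
      have hd := ((contDiffOn_of_ckNorm_le (h i)).differentiableOn_iteratedFDerivWithin (m := j)
        (by exact_mod_cast (by omega : j < k)) (uniqueDiffOn_cube n)) x hx
      refine ((ContinuousMultilinearMap.apply ℝ (fun _ => Fin n → ℝ) ℝ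
        (fun q => Pi.single (I q) (1 : ℝ))).hasFDerivAt.comp_hasFDerivWithinAt x
          hd.hasFDerivWithinAt).congr_fderiv ?_
      rw [eq_gradCLM (ContinuousLinearMap.comp _ _)]
      congr 1
  exact (key k 0 (by omega) Fin.elim0).congr fun i x _ => iteratedFDerivWithin_zero_apply _

/-! ### Parameter integrals -/

/-- Differentiation under the integral at points that may lie on the boundary of `s`: the
first-order remainder divided by `‖y - x‖` tends to zero pointwise, and the mean value inequality
along segments of `s` dominates it. -/
lemma hasFDerivWithinAt_integral_gradCLM {Z : Type*} [MeasurableSpace Z] {ρ : Measure Z}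
    [IsFiniteMeasure ρ] {n : ℕ} {s : Set (Fin n → ℝ)} (hs : Convex ℝ s)
    {G : (Fin n → ℝ) → Z → ℝ} {G' : Fin n → (Fin n → ℝ) → Z → ℝ} {A B : ℝ}
    (hG : ∀ᵐ z ∂ρ, ∀ x ∈ s,
      HasFDerivWithinAt (fun y => G y z) (gradCLM fun j => G' j x z) s x)
    (hA : ∀ᵐ z ∂ρ, ∀ x ∈ s, |G x z| ≤ A)
    (hB : ∀ᵐ z ∂ρ, ∀ j, ∀ x ∈ s, |G' j x z| ≤ B)
    (hGm : ∀ x ∈ s, AEStronglyMeasurable (G x) ρ)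
    (hGm' : ∀ j, ∀ x ∈ s, AEStronglyMeasurable (G' j x) ρ) {x : Fin n → ℝ} (hx : x ∈ s) :
    HasFDerivWithinAt (fun y => ∫ z, G y z ∂ρ) (gradCLM fun j => ∫ z, G' j x z ∂ρ) s x := by
  have hBm : ∀ᵐ z ∂ρ, ∀ j, ∀ x ∈ s, |G' j x z| ≤ max B 0 := by
    filter_upwards [hB] with z hz j x hx using (hz j x hx).trans (le_max_left _ _)
  have hint : ∀ y ∈ s, Integrable (G y) ρ := fun y hy =>
    Integrable.of_bound (hGm y hy) A (by filter_upwards [hA] with z hz using hz y hy)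
  have hint' : ∀ j, Integrable (G' j x) ρ := fun j =>
    Integrable.of_bound (hGm' j x hx) B (by filter_upwards [hB] with z hz using hz j x hx)
  have hlin : ∀ v : Fin n → ℝ, Integrable (fun z => gradCLM (fun j => G' j x z) v) ρ := by
    intro v
    simp only [gradCLM_apply]
    exact integrable_finsetSum _ fun j _ => (hint' j).mul_const _
  have hlin_eq : ∀ v : Fin n → ℝ, gradCLM (fun j => ∫ z, G' j x z ∂ρ) v =
      ∫ z, gradCLM (fun j => G' j x z) v ∂ρ := by
    intro v
    simp only [gradCLM_apply]
    rw [integral_finsetSum _ fun j _ => (hint' j).mul_const _]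
    simp only [integral_mul_const]
  rw [hasFDerivWithinAt_iff_tendsto]
  have key : Filter.Tendsto (fun y => ∫ z, ‖y - x‖⁻¹ *
      ‖G y z - G x z - gradCLM (fun j => G' j x z) (y - x)‖ ∂ρ) (nhdsWithin x s)
      (nhds (∫ _, (0 : ℝ) ∂ρ)) := by
    refine tendsto_integral_filter_of_dominated_convergence
      (fun _ => n * max B 0 + n * max B 0) ?_ ?_ (integrable_const _) ?_
    · filter_upwards [self_mem_nhdsWithin] with y hy
      exact ((((hint y hy).sub (hint x hx)).sub (hlin _)).norm.const_mul _).aestronglyMeasurable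
    · filter_upwards [self_mem_nhdsWithin] with y hy
      filter_upwards [hG, hBm] with z hz hzB
      have h1 : |G y z - G x z| ≤ n * max B 0 * ‖y - x‖ :=
        abs_sub_le_of_hasFDerivWithinAt_gradCLM (f' := fun j w => G' j w z) hs (le_max_right _ _)
          hz hzB hy hx
      have h2 := abs_gradCLM_apply_le (fun j => hzB j x hx) (y - x)
      rw [norm_mul, norm_inv, norm_norm, norm_norm, ← div_eq_inv_mul]
      refine div_le_of_le_mul₀ (norm_nonneg _) (by positivity) ?_
      rw [Real.norm_eq_abs]
      refine (abs_sub _ _).trans ?_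
      linarith
    · filter_upwards [hG] with z hz
      exact hasFDerivWithinAt_iff_tendsto.1 (hz x hx)
  rw [integral_zero] at key
  refine squeeze_zero' (Filter.Eventually.of_forall fun y => by positivity) ?_ key
  filter_upwards [self_mem_nhdsWithin] with y hy
  have h3 : (∫ z, G y z ∂ρ) - (∫ z, G x z ∂ρ) - gradCLM (fun j => ∫ z, G' j x z ∂ρ) (y - x) =
      ∫ z, (G y z - G x z - gradCLM (fun j => G' j x z) (y - x)) ∂ρ := by
    rw [hlin_eq, integral_sub (f := fun z => G y z - G x z) ((hint y hy).sub (hint x hx)) (hlin _),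
      integral_sub (hint y hy) (hint x hx)]
  rw [integral_const_mul, h3]
  exact mul_le_mul_of_nonneg_left (norm_integral_le_integral_norm _) (by positivity)

/-- This form covers both integrals of the construction: marginals, where `a` kills the integrated
coordinates and `b` inserts them, and distribution functions, where `a` rescales one coordinate. The
weight `w` is present for the induction, since differentiation in `x_j` multiplies it by `a j`. -/
lemma UniformCk.integral_mix {Z : Type*} [TopologicalSpace Z] [MeasurableSpace Z]
    [OpensMeasurableSpace Z] [SecondCountableTopology Z] {ρ : Measure Z}
    [IsFiniteMeasureOnCompacts ρ] {K : Set Z} (hK : IsCompact K) (hKm : MeasurableSet K)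
    {n : ℕ} {a b : Fin n → Z → ℝ} (ha : ∀ q, ContinuousOn (a q) K)
    (hb : ∀ q, ContinuousOn (b q) K)
    (hmaps : ∀ x ∈ cube n, ∀ z ∈ K, (fun q => a q z * x q + b q z) ∈ cube n)
    {ι : Type*} {k : ℕ} {F : ι → (Fin n → ℝ) → ℝ} (hF : UniformCk k F) {w : Z → ℝ}
    (hw : ContinuousOn w K) :
    UniformCk k fun i x => ∫ z in K, w z * F i (fun q => a q z * x q + b q z) ∂ρ := by
  have : IsFiniteMeasure (ρ.restrict K) := ⟨by simpa using hK.measure_lt_top⟩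
  have hbw : ∀ {w : Z → ℝ}, ContinuousOn w K → ∃ W : ℝ, 0 ≤ W ∧ ∀ z ∈ K, |w z| ≤ W := by
    intro w hw
    obtain ⟨W, hW⟩ := hK.exists_bound_of_continuousOn hw
    exact ⟨max W 0, le_max_right _ _, fun z hz => (hW z hz).trans (le_max_left _ _)⟩
  have hcx : ∀ z ∈ K, ContinuousOn (fun x : Fin n → ℝ => fun q => a q z * x q + b q z)
      (cube n) := fun z _ => Continuous.continuousOn (by fun_prop)
  have hcz : ∀ x : Fin n → ℝ, ContinuousOn (fun z => fun q => a q z * x q + b q z) K := fun x =>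
    continuousOn_pi.2 fun q => ((ha q).mul continuousOn_const).add (hb q)
  have hcomp : ∀ {F : ι → (Fin n → ℝ) → ℝ}, (∀ i, ContinuousOn (F i) (cube n)) →
      ∀ i, ∀ x ∈ cube n, ContinuousOn (fun z => F i (fun q => a q z * x q + b q z)) K :=
    fun hF i x hx => (hF i).comp (hcz x) (hmaps x hx)
  have hmeas : ∀ {F : ι → (Fin n → ℝ) → ℝ} {w : Z → ℝ}, ContinuousOn w K →
      (∀ i, ContinuousOn (F i) (cube n)) → ∀ i, ∀ x ∈ cube n,
      AEStronglyMeasurable (fun z => w z * F i (fun q => a q z * x q + b q z))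
        (ρ.restrict K) :=
    fun hw hF i x hx => (hw.mul (hcomp hF i x hx)).aestronglyMeasurable hKm
  have hbound : ∀ {F : ι → (Fin n → ℝ) → ℝ} {w : Z → ℝ} {B W : ℝ}, 0 ≤ W →
      (∀ i, ∀ x ∈ cube n, |F i x| ≤ B) → (∀ z ∈ K, |w z| ≤ W) → ∀ i, ∀ z ∈ K, ∀ x ∈ cube n,
      |w z * F i (fun q => a q z * x q + b q z)| ≤ W * B := by
    intro F w B W hW0 hB hW i z hz x hx
    rw [abs_mul]
    exact mul_le_mul (hW z hz) (hB i _ (hmaps x hx z hz)) (abs_nonneg _) hW0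
  have base : ∀ {F : ι → (Fin n → ℝ) → ℝ} {w : Z → ℝ}, ContinuousOn w K → UniformCk 0 F →
      UniformCk 0 fun i x => ∫ z in K, w z * F i (fun q => a q z * x q + b q z) ∂ρ := by
    intro F w hw hF
    obtain ⟨⟨B, hB⟩, hc⟩ := hF
    obtain ⟨W, hW0, hW⟩ := hbw hw
    refine ⟨⟨W * B * (ρ.restrict K).real univ, fun i x hx => ?_⟩, fun i => ?_⟩
    · rw [← Real.norm_eq_abs]
      refine norm_integral_le_of_norm_le_const ?_
      filter_upwards [ae_restrict_mem hKm] with z hz using hbound hW0 hB hW i z hz x hx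
    · refine continuousOn_of_dominated (bound := fun _ => W * B) (hmeas hw hc i)
        (fun x hx => ?_) (integrable_const _) ?_
      · filter_upwards [ae_restrict_mem hKm] with z hz using hbound hW0 hB hW i z hz x hx
      · filter_upwards [ae_restrict_mem hKm] with z hz
        exact continuousOn_const.mul ((hc i).comp (hcx z hz) fun x hx => hmaps x hx z hz)
  induction k generalizing F w with
  | zero => exact base hw hF
  | succ k ih =>
    obtain ⟨B, -, hB⟩ := hF.bounded
    have hF0 := hF.mono (Nat.zero_le _)
    obtain ⟨F', hF', hk⟩ := hF.exists_grad
    obtain ⟨B', -, hB'⟩ := UniformCk.bounded_fin hk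
    obtain ⟨W, hW0, hW⟩ := hbw hw
    choose A hA0 hA using fun q => hbw (ha q)
    have hwa : ∀ q, ContinuousOn (fun z => w z * a q z) K := fun q => hw.mul (ha q)
    refine UniformCk.of_hasFDerivWithinAt (base hw hF0) (F' := fun j i x =>
      ∫ z in K, (w z * a j z) * F' j i (fun q => a q z * x q + b q z) ∂ρ) (fun i x hx => ?_)
      (fun j => ih (hk j) (hwa j))
    refine hasFDerivWithinAt_integral_gradCLM (convex_cube n) (A := W * B)
      (B := W * (∑ q, A q) * B')
      (G' := fun j x z => (w z * a j z) * F' j i (fun q => a q z * x q + b q z)) ?_ ?_ ?_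
      (hmeas hw hF0.2 i) (fun j => hmeas (hwa j) (fun i => (hk j).continuousOn i) i) hx
    · filter_upwards [ae_restrict_mem hKm] with z hz x hx
      have h1 : HasFDerivWithinAt (fun x : Fin n → ℝ => fun q => a q z * x q + b q z)
          (ContinuousLinearMap.pi fun q => a q z •
            ContinuousLinearMap.proj (R := ℝ) (φ := fun _ : Fin n => ℝ) q) (cube n) x := by
        refine hasFDerivWithinAt_pi.2 fun q => ?_
        exact (((ContinuousLinearMap.proj (R := ℝ) (φ := fun _ : Fin n => ℝ)
          q).hasFDerivWithinAt).const_mul (a q z)).add_const (b q z)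
      refine (((hF' i _ (hmaps x hx z hz)).comp x h1 fun x hx => hmaps x hx z hz).const_mul
        (w z)).congr_fderiv ?_
      ext v
      simp only [gradCLM_apply, ContinuousLinearMap.comp_apply, ContinuousLinearMap.pi_apply,
        smul_apply, smul_eq_mul, ContinuousLinearMap.proj_apply, Finset.mul_sum]
      exact Finset.sum_congr rfl fun j _ => by ring
    · filter_upwards [ae_restrict_mem hKm] with z hz x hx using hbound hW0 hB hW i z hz x hx
    · filter_upwards [ae_restrict_mem hKm] with z hz j x hx
      have hs : 0 ≤ ∑ q, A q := Finset.sum_nonneg fun q _ => hA0 q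
      refine hbound (w := fun z => w z * a j z) (by positivity) (hB' j) (fun z hz => ?_) i z hz x hx
      rw [abs_mul]
      exact mul_le_mul (hW z hz) ((hA j z hz).trans
        (Finset.single_le_sum (fun q _ => hA0 q) (Finset.mem_univ j))) (abs_nonneg _) hW0

/-! ### Marginals -/

lemma mix_mem_cube {d m : ℕ} {x : Fin d → ℝ} (hx : x ∈ cube d) {z : {i : Fin d // m ≤ i.val} → ℝ}
    (hz : z ∈ Icc (0 : {i : Fin d // m ≤ i.val} → ℝ) 1) :
    (fun i => if h : m ≤ i.val then z ⟨i, h⟩ else x i) ∈ cube d := by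
  rw [mem_cube]
  intro j
  split_ifs with h
  · exact ⟨hz.1 ⟨j, h⟩, hz.2 ⟨j, h⟩⟩
  · exact mem_cube.1 hx j

lemma UniformCk.marginal {ι : Type*} {d k : ℕ} {F : ι → (Fin d → ℝ) → ℝ} (hF : UniformCk k F)
    (m : ℕ) : UniformCk k fun i => marginal (F i) m := by
  have hmix : ∀ (x : Fin d → ℝ) (z : {i : Fin d // m ≤ i.val} → ℝ),
      (fun q : Fin d => (if m ≤ q.val then 0 else 1) * x q +
        (if h : m ≤ q.val then z ⟨q, h⟩ else 0)) =
      fun i => if h : m ≤ i.val then z ⟨i, h⟩ else x i := by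
    intro x z
    funext q
    split_ifs <;> simp
  have := UniformCk.integral_mix (ρ := volume)
    (K := Icc (0 : {i : Fin d // m ≤ i.val} → ℝ) 1) isCompact_Icc
    measurableSet_Icc (n := d) (a := fun q _ => if m ≤ q.val then 0 else 1)
    (b := fun q z => if h : m ≤ q.val then z ⟨q, h⟩ else 0) (fun q => continuousOn_const)
    (fun q => by
      split_ifs with h
      · exact (continuous_apply _).continuousOn
      · exact continuousOn_const)
    (fun x hx z hz => by rw [hmix]; exact mix_mem_cube hx hz) hF (w := fun _ => 1)
    continuousOn_const
  refine this.congr fun i x hx => ?_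
  simp only [hmix, one_mul]
  rfl

lemma continuousOn_marginal {d : ℕ} {f : (Fin d → ℝ) → ℝ} (hf : ContinuousOn f (cube d)) (m : ℕ) :
    ContinuousOn (marginal f m) (cube d) := by
  obtain ⟨B, hB⟩ := (isCompact_cube d).exists_bound_of_continuousOn hf
  exact (UniformCk.marginal (F := fun _ : Unit => f) (k := 0)
    ⟨⟨B, fun _ => hB⟩, fun _ => hf⟩ m).2 ()

lemma marginal_congr {d m : ℕ} {f : (Fin d → ℝ) → ℝ} {x y : Fin d → ℝ}
    (h : ∀ i : Fin d, i.val < m → x i = y i) : marginal f m x = marginal f m y := by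
  have : ∀ z : {i : Fin d // m ≤ i.val} → ℝ,
      (fun i => if h : m ≤ i.val then z ⟨i, h⟩ else x i) =
      fun i => if h : m ≤ i.val then z ⟨i, h⟩ else y i := by
    intro z
    funext i
    split_ifs with hi
    · rfl
    · exact h i (not_le.1 hi)
  simp only [marginal, this]

lemma volume_Icc_zero_one_pi (ι : Type*) [Fintype ι] :
    (volume (Icc (0 : ι → ℝ) 1)) = 1 := by
  rw [Real.volume_Icc_pi]
  simp

lemma continuousOn_mix {d : ℕ} {f : (Fin d → ℝ) → ℝ} (hf : ContinuousOn f (cube d)) (m : ℕ)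
    {x : Fin d → ℝ} (hx : x ∈ cube d) :
    ContinuousOn (fun z : {i : Fin d // m ≤ i.val} → ℝ =>
      f (fun i => if h : m ≤ i.val then z ⟨i, h⟩ else x i)) (Icc 0 1) := by
  refine hf.comp (Continuous.continuousOn (continuous_pi fun i => ?_))
    fun z hz => mix_mem_cube hx hz
  split_ifs with h
  · exact continuous_apply _
  · exact continuous_const

lemma marginal_mem_Icc {d : ℕ} {f : (Fin d → ℝ) → ℝ} {a b : ℝ} (hf : ContinuousOn f (cube d))
    (ha : ∀ x ∈ cube d, a ≤ f x) (hb : ∀ x ∈ cube d, f x ≤ b) (m : ℕ) {x : Fin d → ℝ}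
    (hx : x ∈ cube d) : marginal f m x ∈ Icc a b := by
  have hvol : volume.real (Icc (0 : {i : Fin d // m ≤ i.val} → ℝ) 1) = 1 := by
    simp [measureReal_def, volume_Icc_zero_one_pi]
  have hfin : volume (Icc (0 : {i : Fin d // m ≤ i.val} → ℝ) 1) ≠ ∞ := by
    simp [volume_Icc_zero_one_pi]
  have hint := (continuousOn_mix hf m hx).integrableOn_compact (μ := volume) isCompact_Icc
  constructor
  · have := setIntegral_mono_on (integrableOn_const (C := a) hfin) hint measurableSet_Icc
      fun z hz => ha _ (mix_mem_cube hx hz)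
    simpa [hvol, LtI.marginal] using this
  · have := setIntegral_mono_on hint (integrableOn_const (C := b) hfin) measurableSet_Icc
      fun z hz => hb _ (mix_mem_cube hx hz)
    simpa [hvol, LtI.marginal] using this

lemma marginal_eq_self {d : ℕ} (f : (Fin d → ℝ) → ℝ) {m : ℕ} (hm : d ≤ m) (x : Fin d → ℝ) :
    marginal f m x = f x := by
  have : IsEmpty {i : Fin d // m ≤ i.val} := ⟨fun i => by have := i.1.2; have := i.2; omega⟩
  have hx : ∀ z : {i : Fin d // m ≤ i.val} → ℝ,
      (fun i => if h : m ≤ i.val then z ⟨i, h⟩ else x i) = x := by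
    intro z
    funext i
    rw [dif_neg (by omega)]
  have hI : Icc (0 : {i : Fin d // m ≤ i.val} → ℝ) 1 = univ := by
    ext z
    simp [Subsingleton.elim z 0, Subsingleton.elim (1 : {i : Fin d // m ≤ i.val} → ℝ) 0]
  have hv : volume.real (Icc (0 : {i : Fin d // m ≤ i.val} → ℝ) 1) = 1 := by
    simp [measureReal_def, volume_Icc_zero_one_pi]
  simp only [marginal, hx, setIntegral_const, hv, one_smul]

-- Extending the density by zero outside the cube turns the marginal into an `lmarginal`, for which
-- Tonelli removes one coordinate at a time.
open Classical in
lemma ofReal_marginal {d : ℕ} {f : (Fin d → ℝ) → ℝ} (hf : ContinuousOn f (cube d))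
    (h0 : ∀ x ∈ cube d, 0 ≤ f x) (m : ℕ) {x : Fin d → ℝ} (hx : x ∈ cube d) :
    ENNReal.ofReal (marginal f m x) =
      lmarginal (fun _ => volume) (Finset.univ.filter fun i : Fin d => m ≤ i.val)
        ((cube d).indicator fun x => ENNReal.ofReal (f x)) x := by
  rw [marginal, ofReal_integral_eq_lintegral_ofReal
    ((continuousOn_mix hf m hx).integrableOn_compact isCompact_Icc)
    (by filter_upwards [ae_restrict_mem measurableSet_Icc] with z hz
          using h0 _ (mix_mem_cube hx hz)), lmarginal,
    ← lintegral_indicator measurableSet_Icc]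
  let e : {i : Fin d // m ≤ i.val} ≃ ↥(Finset.univ.filter fun i : Fin d => m ≤ i.val) :=
    Equiv.subtypeEquivRight fun i => by simp
  have he := (measurePreserving_piCongrLeft
    (fun _ : ↥(Finset.univ.filter fun i : Fin d => m ≤ i.val) => (volume : Measure ℝ)) e)
  rw [he.lintegral_map_equiv, ← volume_pi]
  refine lintegral_congr fun z => ?_
  have h1 : Function.updateFinset x (Finset.univ.filter fun i : Fin d => m ≤ i.val)
      ((MeasurableEquiv.piCongrLeft (fun _ => ℝ) e) z) =
      fun i => if h : m ≤ i.val then z ⟨i, h⟩ else x i := by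
    funext i
    by_cases hi : m ≤ i.val
    · have : (MeasurableEquiv.piCongrLeft (fun _ => ℝ) e) z (e ⟨i, hi⟩) = z ⟨i, hi⟩ :=
        Equiv.piCongrLeft_apply_apply (P := fun _ => ℝ) e z ⟨i, hi⟩
      simp only [Function.updateFinset, Finset.mem_filter, Finset.mem_univ, true_and, hi, dite_true]
      exact this
    · simp [Function.updateFinset, hi]
  rw [h1]
  by_cases hz : z ∈ Icc (0 : {i : Fin d // m ≤ i.val} → ℝ) 1
  · rw [indicator_of_mem hz, indicator_of_mem (mix_mem_cube hx hz)]
  · rw [indicator_of_notMem hz, indicator_of_notMem]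
    contrapose! hz
    have := mem_cube.1 hz
    refine ⟨fun i => ?_, fun i => ?_⟩ <;> have h2 := this i.1 <;> simp only [i.2, dite_true] at h2
    · exact h2.1
    · exact h2.2

lemma measurable_indicator_ofReal {d : ℕ} {f : (Fin d → ℝ) → ℝ} (hf : ContinuousOn f (cube d)) :
    Measurable ((cube d).indicator fun x => ENNReal.ofReal (f x)) := by
  have h : Measurable ((cube d).indicator f) := by
    classical
    rw [← piecewise_eq_indicator]
    exact hf.measurable_piecewise continuousOn_const (measurableSet_cube d)
  convert ENNReal.measurable_ofReal.comp h using 1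
  funext x
  by_cases hx : x ∈ cube d <;> simp [hx]

lemma continuousOn_update_Icc {d : ℕ} {g : (Fin d → ℝ) → ℝ} (hg : ContinuousOn g (cube d))
    (i : Fin d) {x : Fin d → ℝ} (hx : x ∈ cube d) :
    ContinuousOn (fun s => g (Function.update x i s)) (Icc (0 : ℝ) 1) :=
  hg.comp (by fun_prop) fun s hs => update_mem_cube hx i hs

/-- Tonelli, with the `i`-th coordinate split off. This is why a conditional distribution function
reaches the value `1` at the end of its interval. -/
lemma marginal_eq_integral {d : ℕ} {f : (Fin d → ℝ) → ℝ} (hf : ContinuousOn f (cube d))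
    (h0 : ∀ x ∈ cube d, 0 ≤ f x) (i : Fin d) {x : Fin d → ℝ} (hx : x ∈ cube d) :
    marginal f i.val x = ∫ s in (0 : ℝ)..1, marginal f (i.val + 1) (Function.update x i s) := by
  classical
  have hnn : ∀ m, ∀ x ∈ cube d, 0 ≤ marginal f m x := fun m x hx => by
    obtain ⟨B, hB⟩ := (isCompact_cube d).exists_bound_of_continuousOn hf
    exact (marginal_mem_Icc hf h0 (fun y hy => (le_abs_self _).trans (hB y hy)) m hx).1
  have hc := continuousOn_update_Icc (continuousOn_marginal hf (i.val + 1)) i hx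
  rw [intervalIntegral.integral_of_le zero_le_one, ← integral_Icc_eq_integral_Ioc]
  have hnn' : 0 ≤ᵐ[volume.restrict (Icc (0 : ℝ) 1)]
      fun s => marginal f (i.val + 1) (Function.update x i s) := by
    filter_upwards [ae_restrict_mem measurableSet_Icc] with s hs
      using hnn _ _ (update_mem_cube hx i hs)
  have : ENNReal.ofReal (marginal f i.val x) = ENNReal.ofReal
      (∫ s in Icc (0 : ℝ) 1, marginal f (i.val + 1) (Function.update x i s)) := by
    rw [ofReal_integral_eq_lintegral_ofReal (hc.integrableOn_compact isCompact_Icc) hnn',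
      ofReal_marginal hf h0 _ hx]
    have hins : (Finset.univ.filter fun j : Fin d => i.val ≤ j.val) =
        insert i (Finset.univ.filter fun j : Fin d => i.val + 1 ≤ j.val) := by
      ext j
      simp only [Finset.mem_filter, Finset.mem_univ, true_and, Finset.mem_insert, Fin.ext_iff]
      omega
    rw [hins, lmarginal_insert _ (measurable_indicator_ofReal hf) (by simp),
      ← lintegral_indicator measurableSet_Icc]
    refine lintegral_congr fun s => ?_
    by_cases hs : s ∈ Icc (0 : ℝ) 1
    · rw [indicator_of_mem hs, ofReal_marginal hf h0 _ (update_mem_cube hx i hs)]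
    · rw [indicator_of_notMem hs, lmarginal]
      refine lintegral_eq_zero_of_ae_eq_zero (Filter.Eventually.of_forall fun z => ?_)
      simp only [Pi.zero_apply]
      rw [indicator_of_notMem]
      contrapose! hs
      have := mem_cube.1 hs i
      simpa [Function.updateFinset] using this
  rwa [ENNReal.ofReal_eq_ofReal_iff (hnn _ _ hx) (integral_nonneg_of_ae hnn')] at this

lemma marginal_zero_eq_one {d : ℕ} {f : (Fin d → ℝ) → ℝ} (hf : ContinuousOn f (cube d))
    (h0 : ∀ x ∈ cube d, 0 ≤ f x)
    (h1 : IsProbabilityMeasure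
      ((volume.restrict (cube d)).withDensity fun x => ENNReal.ofReal (f x)))
    {x : Fin d → ℝ} (hx : x ∈ cube d) : marginal f 0 x = 1 := by
  classical
  have := ofReal_marginal hf h0 0 hx
  simp only [zero_le, Finset.filter_true, lmarginal_univ] at this
  have h2 := h1.measure_univ
  rw [withDensity_apply _ MeasurableSet.univ, Measure.restrict_univ,
    ← lintegral_indicator (measurableSet_cube d)] at h2
  rw [← volume_pi, h2] at this
  simpa using this

/-! ### Inverting one coordinate -/

lemma hasDerivWithinAt_slice {n : ℕ} {E : (Fin n → ℝ) → ℝ} {c x : Fin n → ℝ} (hx : x ∈ cube n)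
    (h : HasFDerivWithinAt E (gradCLM c) (cube n) x) (e : Fin n) :
    HasDerivWithinAt (fun s => E (Function.update x e s)) (c e) (Icc 0 1) (x e) := by
  have h1 : HasDerivWithinAt (Function.update x e) (Pi.single e 1) (Icc (0 : ℝ) 1) (x e) :=
    (hasDerivAt_update x e (x e)).hasDerivWithinAt
  have h2 : HasFDerivWithinAt E (gradCLM c) (cube n) (Function.update x e (x e)) := by
    rwa [Function.update_eq_self]
  have := h2.comp_hasDerivWithinAt (x e) h1 fun s hs => update_mem_cube hx e hs
  rwa [gradCLM_single] at this

/-- `E` is, in the coordinate `e`, an increasing bijection of `[0,1]` with slope at least `c`. -/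
structure SliceIncreasing {n : ℕ} (c : ℝ) (e : Fin n) (E : (Fin n → ℝ) → ℝ) : Prop where
  cont : ContinuousOn E (cube n)
  incr : ∀ x ∈ cube n, ∀ s ∈ Icc (0 : ℝ) 1, ∀ s' ∈ Icc (0 : ℝ) 1, s ≤ s' →
    c * (s' - s) ≤ E (Function.update x e s') - E (Function.update x e s)
  zero : ∀ x ∈ cube n, E (Function.update x e 0) = 0
  one : ∀ x ∈ cube n, E (Function.update x e 1) = 1

/-- The solution `s ∈ [0,1]` of `E(x₁, …, s, …, xₙ) = x_e`, where `s` is in the place `e`. -/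
def solve {n : ℕ} (e : Fin n) (E : (Fin n → ℝ) → ℝ) (x : Fin n → ℝ) : ℝ :=
  Function.invFunOn (fun s => E (Function.update x e s)) (Icc 0 1) (x e)

namespace SliceIncreasing

variable {n : ℕ} {c : ℝ} {e : Fin n} {E : (Fin n → ℝ) → ℝ}

lemma abs_le (h : SliceIncreasing c e E) {x : Fin n → ℝ} (hx : x ∈ cube n) {s s' : ℝ}
    (hs : s ∈ Icc (0 : ℝ) 1) (hs' : s' ∈ Icc (0 : ℝ) 1) :
    c * |s' - s| ≤ |E (Function.update x e s') - E (Function.update x e s)| := by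
  rcases le_total s s' with hle | hle
  · rw [abs_of_nonneg (sub_nonneg.2 hle)]
    exact (h.incr x hx s hs s' hs' hle).trans (le_abs_self _)
  · rw [abs_sub_comm, abs_of_nonneg (sub_nonneg.2 hle), abs_sub_comm]
    exact (h.incr x hx s' hs' s hs hle).trans (le_abs_self _)

lemma injOn (h : SliceIncreasing c e E) (hc : 0 < c) {x : Fin n → ℝ} (hx : x ∈ cube n) :
    InjOn (fun s => E (Function.update x e s)) (Icc 0 1) := by
  intro s hs s' hs' heq
  have := h.abs_le hx hs hs'
  simp only at heq
  rw [heq, sub_self, abs_zero] at this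
  have h0 : |s' - s| ≤ 0 := by
    by_contra! hlt
    nlinarith
  linarith [abs_eq_zero.1 (le_antisymm h0 (abs_nonneg _))]

lemma mem_Icc (h : SliceIncreasing c e E) (hc : 0 < c) {x : Fin n → ℝ} (hx : x ∈ cube n) :
    E x ∈ Icc (0 : ℝ) 1 := by
  have hxe := mem_cube.1 hx e
  have h0 := h.incr x hx 0 (by simp) (x e) hxe hxe.1
  have h1 := h.incr x hx (x e) hxe 1 (by simp) hxe.2
  rw [Function.update_eq_self, h.zero x hx] at h0
  rw [Function.update_eq_self, h.one x hx] at h1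
  constructor <;> nlinarith [hxe.1, hxe.2]

lemma exists_solution (h : SliceIncreasing c e E) {x : Fin n → ℝ} (hx : x ∈ cube n) :
    ∃ s ∈ Icc (0 : ℝ) 1, E (Function.update x e s) = x e := by
  have hc : ContinuousOn (fun s => E (Function.update x e s)) (Icc (0 : ℝ) 1) :=
    continuousOn_update_Icc h.cont e hx
  have := intermediate_value_Icc zero_le_one hc
  simp only [h.zero x hx, h.one x hx] at this
  exact this (mem_cube.1 hx e)

lemma solve_mem (h : SliceIncreasing c e E) {x : Fin n → ℝ} (hx : x ∈ cube n) :
    solve e E x ∈ Icc (0 : ℝ) 1 :=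
  Function.invFunOn_mem (h.exists_solution hx)

lemma apply_solve (h : SliceIncreasing c e E) {x : Fin n → ℝ} (hx : x ∈ cube n) :
    E (Function.update x e (solve e E x)) = x e :=
  Function.invFunOn_eq (h.exists_solution hx)

lemma eq_solve (h : SliceIncreasing c e E) (hc : 0 < c) {x : Fin n → ℝ} (hx : x ∈ cube n) {s : ℝ}
    (hs : s ∈ Icc (0 : ℝ) 1) (heq : E (Function.update x e s) = x e) : s = solve e E x :=
  h.injOn hc hx hs (h.solve_mem hx) (heq.trans (h.apply_solve hx).symm)

lemma eq_of_apply_eq (h : SliceIncreasing c e E) (hc : 0 < c) {x y : Fin n → ℝ}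
    (hx : x ∈ cube n) (hy : y ∈ cube n) (hxy : E (Function.update x e (y e)) = E x) :
    y e = x e := by
  refine h.injOn hc hx (mem_cube.1 hy e) (mem_cube.1 hx e) ?_
  simpa using hxy

/-- By the slope bound, the solutions at `y` and at `x` differ by at most `1 / c` times the residual
at `y` of the solution at `x`, and that residual is continuous in `y`. -/
lemma continuousOn_solve (h : SliceIncreasing c e E) (hc : 0 < c) :
    ContinuousOn (solve e E) (cube n) := by
  intro x hx
  have h1 : ContinuousOn (fun y => |E (Function.update y e (solve e E x)) - y e|) (cube n) := by
    refine ((h.cont.comp (by fun_prop) fun y hy => update_mem_cube hy e (h.solve_mem hx)).sub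
      (continuous_apply e).continuousOn).abs
  have h2 := (h1 x hx).tendsto
  rw [h.apply_solve hx, sub_self, abs_zero] at h2
  have h3 : Filter.Tendsto (fun y => c⁻¹ * |E (Function.update y e (solve e E x)) - y e|)
      (nhdsWithin x (cube n)) (nhds 0) := by simpa using h2.const_mul c⁻¹
  rw [ContinuousWithinAt, tendsto_iff_norm_sub_tendsto_zero]
  refine squeeze_zero' (Filter.Eventually.of_forall fun _ => norm_nonneg _) ?_ h3
  filter_upwards [self_mem_nhdsWithin] with y hy
  have := h.abs_le hy (h.solve_mem hy) (h.solve_mem hx)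
  rw [h.apply_solve hy] at this
  rw [Real.norm_eq_abs, abs_sub_comm, inv_mul_eq_div, le_div_iff₀ hc, mul_comm]
  exact this

/-- Along the slice, `E - c s` is monotone, so its derivative within `[0,1]` is nonnegative, at the
endpoints too. -/
lemma le_deriv (h : SliceIncreasing c e E) {g x : Fin n → ℝ} (hx : x ∈ cube n)
    (hd : HasFDerivWithinAt E (gradCLM g) (cube n) x) : c ≤ g e := by
  have h1 := (hasDerivWithinAt_slice hx hd e).sub
    ((hasDerivWithinAt_id (x e) (Icc (0 : ℝ) 1)).const_mul c)
  have hm : MonotoneOn ((fun s => E (Function.update x e s)) - fun s => c * id s)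
      (Icc (0 : ℝ) 1) := by
    intro s hs s' hs' hle
    have := h.incr x hx s hs s' hs' hle
    simp only [Pi.sub_apply, id]
    linarith
  have h2 : 0 ≤ derivWithin ((fun s => E (Function.update x e s)) - fun s => c * id s)
      (Icc (0 : ℝ) 1) (x e) := hm.derivWithin_nonneg
  have h3 := h1.derivWithin (uniqueDiffOn_Icc zero_lt_one _ (mem_cube.1 hx e))
  have h4 : 0 ≤ g e - c * 1 := by
    rw [← h3]
    exact h2
  linarith

/-- The map that replaces `y_e` by `E y` has as right inverse the map that replaces `y_e` by `solve
e E y`. The inverse is already known to be continuous, so inverting the linear map `Ψ'` yields its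
derivative, on the boundary of the cube as well. -/
lemma hasFDerivWithinAt_solve (h : SliceIncreasing c e E) (hc : 0 < c) {g x : Fin n → ℝ}
    (hx : x ∈ cube n)
    (hd : HasFDerivWithinAt E (gradCLM g) (cube n) (Function.update x e (solve e E x))) :
    HasFDerivWithinAt (solve e E) (gradCLM fun j => if j = e then (g e)⁻¹ else -(g j * (g e)⁻¹))
      (cube n) x := by
  have hge : g e ≠ 0 := (hc.trans_le (h.le_deriv (update_mem_cube hx e (h.solve_mem hx)) hd)).ne'
  let Ψ' : (Fin n → ℝ) →L[ℝ] (Fin n → ℝ) := ContinuousLinearMap.pi fun j =>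
    if j = e then gradCLM g else ContinuousLinearMap.proj (R := ℝ) (φ := fun _ : Fin n => ℝ) j
  let Φ' : (Fin n → ℝ) →L[ℝ] (Fin n → ℝ) := ContinuousLinearMap.pi fun j =>
    if j = e then gradCLM (fun j => if j = e then (g e)⁻¹ else -(g j * (g e)⁻¹))
    else ContinuousLinearMap.proj (R := ℝ) (φ := fun _ : Fin n => ℝ) j
  have hgc : ContinuousOn (fun y => Function.update y e (solve e E y)) (cube n) :=
    continuousOn_pi.2 fun j => by
      rcases eq_or_ne j e with rfl | hj
      · simpa using h.continuousOn_solve hc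
      · simpa [hj] using (continuous_apply j).continuousOn
  have hΨ : HasFDerivWithinAt (fun y => Function.update y e (E y)) Ψ' (cube n)
      (Function.update x e (solve e E x)) := by
    refine hasFDerivWithinAt_pi.2 fun j => ?_
    rcases eq_or_ne j e with rfl | hj
    · simpa using hd
    · simp only [hj, ne_eq, not_false_eq_true, Function.update_of_ne, if_false]
      exact (hasFDerivAt_apply j _).hasFDerivWithinAt
  have key : HasFDerivWithinAt (fun y => Function.update y e (solve e E y))
      (Φ'.comp (ContinuousLinearMap.id ℝ _)) (cube n) x := by
    refine HasFDerivWithinAt.of_comp_of_leftInverse (f := fun y => Function.update y e (E y))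
      (t := cube n) ?_ hΨ (hasFDerivWithinAt_id x _) ?_ ?_ hx
    · exact (hgc x hx).tendsto_nhdsWithin fun y hy => update_mem_cube hy e (h.solve_mem hy)
    · filter_upwards [self_mem_nhdsWithin] with y hy
      simp only [Function.comp_apply, Function.update_idem, h.apply_solve hy,
        Function.update_eq_self, id]
    -- `Φ'` undoes `Ψ'`; only the row `e` is not immediate, and there division by `g e` is possible
    -- because `c ≤ g e`.
    · intro v
      funext j
      rcases eq_or_ne j e with rfl | hj
      · simp only [Φ', Ψ', ContinuousLinearMap.pi_apply, if_true, gradCLM_apply]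
        rw [← Finset.add_sum_erase _ _ (Finset.mem_univ j)]
        have : ∀ l ∈ Finset.univ.erase j, (if l = j then (g j)⁻¹ else -(g l * (g j)⁻¹)) *
            (if l = j then gradCLM g else ContinuousLinearMap.proj (R := ℝ)
              (φ := fun _ : Fin n => ℝ) l) v = -(g j)⁻¹ * (g l * v l) := by
          intro l hl
          simp only [(Finset.mem_erase.1 hl).1, if_false, ContinuousLinearMap.proj_apply]
          ring
        rw [Finset.sum_congr rfl this, ← Finset.mul_sum]
        simp only [if_true, gradCLM_apply]
        rw [← Finset.add_sum_erase _ _ (Finset.mem_univ j)]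
        field_simp
        ring
      · simp [Φ', Ψ', hj]
  have := hasFDerivWithinAt_pi.1 key e
  simpa [Φ'] using this

end SliceIncreasing

/-- A bootstrap: the gradient of the solution is rational in the gradient of `E` evaluated at the
solution, so order `k` for the solution gives order `k` for its gradient. The denominator is at
least `c`. -/
lemma UniformCk.solve {ι : Type*} {n k : ℕ} {E : ι → (Fin n → ℝ) → ℝ} (hE : UniformCk k E)
    {c : ℝ} (hc : 0 < c) {e : Fin n} (h : ∀ i, SliceIncreasing c e (E i)) :
    UniformCk k fun i => solve e (E i) := by
  have base : UniformCk 0 fun i => LtI.solve e (E i) :=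
    ⟨⟨1, fun i x hx => by
      have := (h i).solve_mem hx
      rw [abs_of_nonneg this.1]
      exact this.2⟩, fun i => (h i).continuousOn_solve hc⟩
  have hmem : ∀ i, ∀ x ∈ cube n, LtI.solve e (E i) x ∈ Icc (0 : ℝ) 1 := fun i x hx =>
    (h i).solve_mem hx
  induction k with
  | zero => exact base
  | succ k ih =>
    have hS := ih hE.of_succ
    obtain ⟨E', hE', hk⟩ := hE.exists_grad
    have hinv : UniformCk k fun i x =>
        (E' e i (Function.update x e (LtI.solve e (E i) x)))⁻¹ :=
      UniformCk.inv (UniformCk.update e (hk e) hS hmem) hc fun i x hx =>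
        (h i).le_deriv (update_mem_cube hx e (hmem i x hx))
          (hE' i _ (update_mem_cube hx e (hmem i x hx)))
    refine UniformCk.of_hasFDerivWithinAt base (F' := fun j i x => if j = e then
        (E' e i (Function.update x e (LtI.solve e (E i) x)))⁻¹
      else -(E' j i (Function.update x e (LtI.solve e (E i) x)) *
        (E' e i (Function.update x e (LtI.solve e (E i) x)))⁻¹)) (fun i x hx => ?_) fun j => ?_
    · exact (h i).hasFDerivWithinAt_solve hc hx (hE' i _ (update_mem_cube hx e (hmem i x hx)))
    · rcases eq_or_ne j e with rfl | hj
      · simpa using hinv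
      · simp only [hj, if_false]
        exact UniformCk.neg (UniformCk.mul (UniformCk.update e (hk j) hS hmem) hinv)

/-! ### Conditional distribution functions -/

/-- A continuous probability density on the cube with values in `[κ, 𝒦]`. -/
structure IsCubeDensity {d : ℕ} (κ 𝒦 : ℝ) (f : (Fin d → ℝ) → ℝ) : Prop where
  pos : 0 < κ
  cont : ContinuousOn f (cube d)
  lower : ∀ x ∈ cube d, κ ≤ f x
  upper : ∀ x ∈ cube d, f x ≤ 𝒦
  total : ∀ x ∈ cube d, marginal f 0 x = 1

lemma HasCkDensity.isCubeDensity {d k : ℕ} {κ 𝒦 : ℝ} {M : ℝ≥0} {μ : Measure (Fin d → ℝ)}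
    {f : (Fin d → ℝ) → ℝ} (h : HasCkDensity k κ 𝒦 M μ f) (hκ : 0 < κ) : IsCubeDensity κ 𝒦 f := by
  have hc := (contDiffOn_of_ckNorm_le h.norm_le).continuousOn
  refine ⟨hκ, hc, h.lower, h.upper, fun x hx => ?_⟩
  exact marginal_zero_eq_one hc (fun x hx => hκ.le.trans (h.lower x hx))
    (h.density ▸ h.prob) hx

/-- The conditional distribution function `F_i(x_i | x_1, …, x_{i-1})` as a function on the cube. -/
def diagCDF {d : ℕ} (f : (Fin d → ℝ) → ℝ) (i : Fin d) (x : Fin d → ℝ) : ℝ :=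
  condCDF f i x (x i)

lemma condDensity_congr {d : ℕ} {f : (Fin d → ℝ) → ℝ} {i : Fin d} {x y : Fin d → ℝ}
    (h : ∀ j ≤ i, x j = y j) : condDensity f i x = condDensity f i y := by
  rw [condDensity, condDensity, marginal_congr fun j hj => h j (Fin.le_def.2 (by omega)),
    marginal_congr fun j hj => h j (Fin.le_def.2 (by omega))]

lemma condCDF_congr {d : ℕ} {f : (Fin d → ℝ) → ℝ} {i : Fin d} {x y : Fin d → ℝ}
    (h : ∀ j < i, x j = y j) (s : ℝ) : condCDF f i x s = condCDF f i y s := by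
  have : ∀ z, condDensity f i (Function.update x i z) = condDensity f i (Function.update y i z) :=
    fun z => condDensity_congr fun j hj => by
      rcases hj.eq_or_lt with rfl | hj
      · simp
      · simp [hj.ne, h j hj]
  simp only [condCDF, this]

lemma diagCDF_update {d : ℕ} (f : (Fin d → ℝ) → ℝ) (i : Fin d) (x : Fin d → ℝ) (s : ℝ) :
    diagCDF f i (Function.update x i s) = condCDF f i x s := by
  rw [diagCDF, Function.update_self]
  exact condCDF_congr (fun j hj => by simp [hj.ne]) s

lemma diagCDF_congr {d : ℕ} {f : (Fin d → ℝ) → ℝ} {i : Fin d} {x y : Fin d → ℝ}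
    (h : ∀ j ≤ i, x j = y j) : diagCDF f i x = diagCDF f i y := by
  rw [diagCDF, diagCDF, h i le_rfl, condCDF_congr fun j hj => h j hj.le]

/-- The substitution `z = s x_e` replaces the variable endpoint by the fixed interval `[0,1]`, at
the price of a factor `x_e`. -/
lemma UniformCk.diagCDF {ι : Type*} {d k : ℕ} {F : ι → (Fin d → ℝ) → ℝ} (hF : UniformCk k F)
    {c : ℝ} (hc : 0 < c) (hm : ∀ m i, ∀ x ∈ cube d, c ≤ LtI.marginal (F i) m x) (e : Fin d) :
    UniformCk k fun i => diagCDF (F i) e := by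
  have h1 : UniformCk k fun i => condDensity (F i) e :=
    UniformCk.div (hF.marginal _) (hF.marginal _) hc (hm _)
  have hmix : ∀ (x : Fin d → ℝ) (s : ℝ), (fun q => (if q = e then s else 1) * x q + (0 : ℝ)) =
      Function.update x e (s * x e) := by
    intro x s
    funext q
    rcases eq_or_ne q e with rfl | hq <;> simp [*]
  have h2 := UniformCk.integral_mix (ρ := volume) (K := Icc (0 : ℝ) 1) isCompact_Icc
    measurableSet_Icc (n := d) (a := fun q s => if q = e then s else 1) (b := fun _ _ => 0)
    (fun q => by split_ifs <;> fun_prop) (fun q => continuousOn_const)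
    (fun x hx s hs => by
      rw [hmix]
      have := mem_cube.1 hx e
      exact update_mem_cube hx e ⟨mul_nonneg hs.1 this.1, mul_le_one₀ hs.2 this.1 this.2⟩) h1
    (w := fun _ => 1) continuousOn_const
  refine (UniformCk.mul (UniformCk.coord e) h2).congr fun i x hx => ?_
  simp only [hmix, one_mul]
  rw [integral_Icc_eq_integral_Ioc, ← intervalIntegral.integral_of_le zero_le_one, LtI.diagCDF,
    condCDF]
  have := intervalIntegral.mul_integral_comp_mul_right (a := 0) (b := 1)
    (f := fun z => condDensity (F i) e (Function.update x e z)) (x e)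
  simpa using this

namespace IsCubeDensity

variable {d : ℕ} {κ 𝒦 : ℝ} {f : (Fin d → ℝ) → ℝ}

lemma marginal_mem (h : IsCubeDensity κ 𝒦 f) (m : ℕ) {x : Fin d → ℝ} (hx : x ∈ cube d) :
    marginal f m x ∈ Icc κ 𝒦 := marginal_mem_Icc h.cont h.lower h.upper m hx

lemma upper_pos (h : IsCubeDensity κ 𝒦 f) : 0 < 𝒦 :=
  h.pos.trans_le ((h.lower 0 (zero_mem_cube d)).trans (h.upper 0 (zero_mem_cube d)))

lemma condDensity_mem (h : IsCubeDensity κ 𝒦 f) (i : Fin d) {x : Fin d → ℝ} (hx : x ∈ cube d) :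
    condDensity f i x ∈ Icc (κ / 𝒦) (𝒦 / κ) := by
  have h1 := h.marginal_mem (i.val + 1) hx
  have h2 := h.marginal_mem i.val hx
  have hκ := h.pos
  have h𝒦 := h.upper_pos
  exact ⟨div_le_div₀ (hκ.le.trans h1.1) h1.1 (hκ.trans_le h2.1) h2.2,
    div_le_div₀ h𝒦.le h1.2 hκ h2.1⟩

lemma continuousOn_condDensity (h : IsCubeDensity κ 𝒦 f) (i : Fin d) :
    ContinuousOn (condDensity f i) (cube d) :=
  (continuousOn_marginal h.cont _).div (continuousOn_marginal h.cont _) fun _ hx =>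
    (h.pos.trans_le (h.marginal_mem i.val hx).1).ne'

lemma intervalIntegrable_condDensity (h : IsCubeDensity κ 𝒦 f) (i : Fin d) {x : Fin d → ℝ}
    (hx : x ∈ cube d) {s s' : ℝ} (hs : s ∈ Icc (0 : ℝ) 1) (hs' : s' ∈ Icc (0 : ℝ) 1) :
    IntervalIntegrable (fun z => condDensity f i (Function.update x i z)) volume s s' :=
  ((continuousOn_update_Icc (h.continuousOn_condDensity i) i hx).mono
    (uIcc_subset_Icc hs hs')).intervalIntegrable

lemma condCDF_sub (h : IsCubeDensity κ 𝒦 f) (i : Fin d) {x : Fin d → ℝ}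
    (hx : x ∈ cube d) {s s' : ℝ} (hs : s ∈ Icc (0 : ℝ) 1) (hs' : s' ∈ Icc (0 : ℝ) 1)
    (hle : s ≤ s') :
    condCDF f i x s' - condCDF f i x s ∈ Icc (κ / 𝒦 * (s' - s)) (𝒦 / κ * (s' - s)) := by
  have h0 : (0 : ℝ) ∈ Icc (0 : ℝ) 1 := by simp
  rw [condCDF, condCDF, intervalIntegral.integral_interval_sub_left
    (h.intervalIntegrable_condDensity i hx h0 hs') (h.intervalIntegrable_condDensity i hx h0 hs)]
  have hmem : ∀ z ∈ Icc s s', condDensity f i (Function.update x i z) ∈ Icc (κ / 𝒦) (𝒦 / κ) :=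
    fun z hz => h.condDensity_mem i (update_mem_cube hx i ⟨hs.1.trans hz.1, hz.2.trans hs'.2⟩)
  have hint := h.intervalIntegrable_condDensity i hx hs hs'
  constructor
  · have := intervalIntegral.integral_mono_on hle intervalIntegrable_const hint
      fun z hz => (hmem z hz).1
    rw [intervalIntegral.integral_const, smul_eq_mul] at this
    linarith
  · have := intervalIntegral.integral_mono_on hle hint intervalIntegrable_const
      fun z hz => (hmem z hz).2
    rw [intervalIntegral.integral_const, smul_eq_mul] at this
    linarith

lemma sliceIncreasing (h : IsCubeDensity κ 𝒦 f) (i : Fin d) :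
    SliceIncreasing (κ / 𝒦) i (diagCDF f i) where
  cont := by
    obtain ⟨B, hB⟩ := (isCompact_cube d).exists_bound_of_continuousOn h.cont
    exact (UniformCk.diagCDF (F := fun _ : Unit => f) (k := 0) ⟨⟨B, fun _ => hB⟩, fun _ => h.cont⟩
      h.pos (fun m _ _ hx => (h.marginal_mem m hx).1) i).2 ()
  incr x hx s hs s' hs' hle := by
    rw [diagCDF_update, diagCDF_update]
    exact (h.condCDF_sub i hx hs hs' hle).1
  zero x hx := by rw [diagCDF_update, condCDF, intervalIntegral.integral_same]
  one x hx := by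
    rw [diagCDF_update, condCDF]
    have : ∀ z, condDensity f i (Function.update x i z) =
        marginal f (i.val + 1) (Function.update x i z) / marginal f i.val x := by
      intro z
      rw [condDensity, marginal_congr (m := i.val) (y := x) fun j hj => by
        rw [Function.update_of_ne (by rintro rfl; omega)]]
    simp only [this]
    rw [intervalIntegral.integral_div,
      ← marginal_eq_integral h.cont (fun x hx => h.pos.le.trans (h.lower x hx)) i hx]
    exact div_self (h.pos.trans_le (h.marginal_mem i.val hx).1).ne'

lemma diagCDF_mem (h : IsCubeDensity κ 𝒦 f) (i : Fin d) {x : Fin d → ℝ} (hx : x ∈ cube d) :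
    diagCDF f i x ∈ Icc (0 : ℝ) 1 :=
  (h.sliceIncreasing i).mem_Icc (div_pos h.pos h.upper_pos) hx

end IsCubeDensity

/-! ### The Knothe–Rosenblatt transport -/

/-- The argument at which the inverse of the `i`-th conditional distribution function is taken. -/
def krArg {d : ℕ} (fν fμ : (Fin d → ℝ) → ℝ) (i : Fin d) (x : Fin d → ℝ) : Fin d → ℝ :=
  Function.update (fun j => if j < i then krMap fν fμ x j else 0) i (diagCDF fν i x)

/-- Each coordinate of the transport solves one slice equation. The level `diagCDF fν i x` sits in
place `i` of the argument, and the zeros in later places are harmless because the conditional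
distribution function ignores them. -/
lemma krMap_eq_solve {d : ℕ} (fν fμ : (Fin d → ℝ) → ℝ) (i : Fin d) (x : Fin d → ℝ) :
    krMap fν fμ x i = solve i (diagCDF fμ i) (krArg fν fμ i x) := by
  rw [krMap, krComponent, solve, krArg]
  simp only [Function.update_self, Function.update_idem, diagCDF_update]
  rfl

section KnotheRosenblatt

variable {d : ℕ} {κ 𝒦 : ℝ} {fν fμ : (Fin d → ℝ) → ℝ}

lemma krMap_mem_Icc (hν : IsCubeDensity κ 𝒦 fν) (hμ : IsCubeDensity κ 𝒦 fμ) {x : Fin d → ℝ}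
    (hx : x ∈ cube d) (i : Fin d) :
    krArg fν fμ i x ∈ cube d ∧ krMap fν fμ x i ∈ Icc (0 : ℝ) 1 := by
  induction i using WellFoundedLT.induction with
  | ind i ih =>
    have : krArg fν fμ i x ∈ cube d := by
      refine update_mem_cube (mem_cube.2 fun j => ?_) i (hν.diagCDF_mem i hx)
      split_ifs with hj
      · exact (ih j hj).2
      · simp
    exact ⟨this, krMap_eq_solve fν fμ i x ▸ (hμ.sliceIncreasing i).solve_mem this⟩

lemma krArg_mem_cube (hν : IsCubeDensity κ 𝒦 fν) (hμ : IsCubeDensity κ 𝒦 fμ) {x : Fin d → ℝ}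
    (hx : x ∈ cube d) (i : Fin d) : krArg fν fμ i x ∈ cube d := (krMap_mem_Icc hν hμ hx i).1

lemma krMap_mem_cube (hν : IsCubeDensity κ 𝒦 fν) (hμ : IsCubeDensity κ 𝒦 fμ) {x : Fin d → ℝ}
    (hx : x ∈ cube d) : krMap fν fμ x ∈ cube d := mem_cube.2 fun i => (krMap_mem_Icc hν hμ hx i).2

lemma diagCDF_krMap (hν : IsCubeDensity κ 𝒦 fν) (hμ : IsCubeDensity κ 𝒦 fμ) {x : Fin d → ℝ}
    (hx : x ∈ cube d) (i : Fin d) : diagCDF fμ i (krMap fν fμ x) = diagCDF fν i x := by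
  have h := (hμ.sliceIncreasing i).apply_solve (krArg_mem_cube hν hμ hx i)
  rw [← krMap_eq_solve] at h
  conv_rhs at h => rw [krArg, Function.update_self]
  rw [← h]
  refine diagCDF_congr fun j hj => ?_
  rcases hj.eq_or_lt with rfl | hj
  · simp
  · simp [hj.ne, krArg, hj]

lemma krMap_congr {x y : Fin d → ℝ} (i : Fin d) (h : ∀ j ≤ i, x j = y j) :
    krMap fν fμ x i = krMap fν fμ y i := by
  induction i using WellFoundedLT.induction with
  | ind i ih =>
    rw [krMap_eq_solve, krMap_eq_solve]
    congr 1
    rw [krArg, krArg, diagCDF_congr h]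
    congr 1
    funext j
    split_ifs with hj
    · exact ih j hj fun l hl => h l (hl.trans hj.le)
    · rfl

lemma krMap_update_of_lt (x : Fin d → ℝ) {i j : Fin d} (hj : j < i) (s : ℝ) :
    krMap fν fμ (Function.update x i s) j = krMap fν fμ x j :=
  krMap_congr j fun l hl => by rw [Function.update_of_ne (hl.trans_lt hj).ne]

/-- Induction along the triangular structure: component `e` is a `solve` composed with the
components before it. -/
lemma UniformCk.krMap {ι : Type*} {k : ℕ} {Fν Fμ : ι → (Fin d → ℝ) → ℝ} (hν : UniformCk k Fν)
    (hμ : UniformCk k Fμ) (hdν : ∀ i, IsCubeDensity κ 𝒦 (Fν i))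
    (hdμ : ∀ i, IsCubeDensity κ 𝒦 (Fμ i)) (hκ : 0 < κ) (h𝒦 : 0 < 𝒦) (e : Fin d) :
    UniformCk k fun i x => krMap (Fν i) (Fμ i) x e := by
  have hCν := fun e => hν.diagCDF hκ (fun m i x hx => ((hdν i).marginal_mem m hx).1) e
  have hCμ := fun e => hμ.diagCDF hκ (fun m i x hx => ((hdμ i).marginal_mem m hx).1) e
  induction e using WellFoundedLT.induction with
  | ind e ih =>
    have hs := UniformCk.solve (hCμ e) (div_pos hκ h𝒦) fun i => (hdμ i).sliceIncreasing e
    refine (UniformCk.comp (H := fun j i x => krArg (Fν i) (Fμ i) e x j) hs (fun j => ?_)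
      (fun i x hx => krArg_mem_cube (hdν i) (hdμ i) hx e)).congr fun i x hx => ?_
    · rcases lt_trichotomy j e with hj | rfl | hj
      · simpa only [krArg, ne_eq, hj.ne, not_false_eq_true, Function.update_of_ne, hj, if_true]
          using ih j hj
      · simpa only [krArg, Function.update_self] using hCν j
      · simpa only [krArg, ne_eq, hj.ne', not_false_eq_true, Function.update_of_ne, hj.not_gt,
          if_false] using UniformCk.const 0
    · exact (krMap_eq_solve (Fν i) (Fμ i) e x).symm

lemma continuousOn_krMap (hν : IsCubeDensity κ 𝒦 fν) (hμ : IsCubeDensity κ 𝒦 fμ) :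
    ContinuousOn (krMap fν fμ) (cube d) := by
  obtain ⟨B, hB⟩ := (isCompact_cube d).exists_bound_of_continuousOn hν.cont
  obtain ⟨C, hC⟩ := (isCompact_cube d).exists_bound_of_continuousOn hμ.cont
  exact continuousOn_pi.2 fun e => (UniformCk.krMap (ι := Unit) (k := 0) (Fν := fun _ => fν)
    (Fμ := fun _ => fμ) ⟨⟨B, fun _ => hB⟩, fun _ => hν.cont⟩ ⟨⟨C, fun _ => hC⟩, fun _ => hμ.cont⟩
    (fun _ => hν) (fun _ => hμ) hν.pos hν.upper_pos e).2 ()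

/-- The source distribution function has slope at least `κ / 𝒦` and the target one slope at most `𝒦
/ κ`; `T_i` equates the two, so the quotient bounds its slope from below. Both functions run from
`0` to `1`, so the endpoints are fixed. -/
lemma krMap_sliceIncreasing (hν : IsCubeDensity κ 𝒦 fν) (hμ : IsCubeDensity κ 𝒦 fμ)
    (i : Fin d) : SliceIncreasing (κ / 𝒦 / (𝒦 / κ)) i (fun x => krMap fν fμ x i) where
  cont := (continuous_apply i).comp_continuousOn (continuousOn_krMap hν hμ)
  incr x hx s hs s' hs' hle := by
    have hκ := hν.pos
    have h𝒦 := hν.upper_pos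
    have hxs := update_mem_cube hx i hs
    have hxs' := update_mem_cube hx i hs'
    have ht := (krMap_mem_Icc hν hμ hxs i).2
    have ht' := (krMap_mem_Icc hν hμ hxs' i).2
    have h1 := (hν.condCDF_sub i hx hs hs' hle).1
    have hy := krMap_mem_cube hν hμ hx
    have e1 : ∀ r, r ∈ Icc (0 : ℝ) 1 → condCDF fμ i (krMap fν fμ x)
        (krMap fν fμ (Function.update x i r) i) = condCDF fν i x r := by
      intro r hr
      rw [← diagCDF_update fν, ← diagCDF_krMap hν hμ (update_mem_cube hx i hr), diagCDF]
      exact condCDF_congr (fun j hj => (krMap_update_of_lt x hj r).symm) _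
    rw [← e1 s hs, ← e1 s' hs'] at h1
    have hpos : 0 ≤ κ / 𝒦 * (s' - s) :=
      mul_nonneg (div_pos hκ h𝒦).le (sub_nonneg.2 hle)
    -- The upper slope bound needs the order of the two images, which the strict monotonicity of the
    -- target distribution function gives.
    have hle' : krMap fν fμ (Function.update x i s) i ≤ krMap fν fμ (Function.update x i s') i := by
      by_contra! hlt
      have h2 := (hμ.condCDF_sub i hy ht' ht hlt.le).1
      have : 0 < κ / 𝒦 * (krMap fν fμ (Function.update x i s) i -
        krMap fν fμ (Function.update x i s') i) := mul_pos (div_pos hκ h𝒦) (sub_pos.2 hlt)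
      linarith
    have h2 := (hμ.condCDF_sub i hy ht ht' hle').2
    rw [div_mul_eq_mul_div, div_le_iff₀ (div_pos h𝒦 hκ)]
    linarith
  zero x hx := by
    have hx0 := update_mem_cube hx i (s := 0) (by simp)
    have h1 := diagCDF_krMap hν hμ hx0 i
    rw [(hν.sliceIncreasing i).zero x hx] at h1
    have h2 := (hμ.sliceIncreasing i).zero _ (krMap_mem_cube hν hμ hx0)
    exact ((hμ.sliceIncreasing i).eq_of_apply_eq (div_pos hν.pos hν.upper_pos)
      (krMap_mem_cube hν hμ hx0) (zero_mem_cube d) (h2.trans h1.symm)).symm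
  one x hx := by
    have hx0 := update_mem_cube hx i (s := 1) (by simp)
    have h1 := diagCDF_krMap hν hμ hx0 i
    rw [(hν.sliceIncreasing i).one x hx] at h1
    have h2 := (hμ.sliceIncreasing i).one _ (krMap_mem_cube hν hμ hx0)
    exact ((hμ.sliceIncreasing i).eq_of_apply_eq (div_pos hν.pos hν.upper_pos)
      (krMap_mem_cube hν hμ hx0) (y := fun _ => 1) (mem_cube.2 fun _ => by simp)
      (h2.trans h1.symm)).symm

end KnotheRosenblatt

/-! ### The displacement interpolation and its velocity field -/

/-- The space part of a point of space-time. -/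
def spacePart {d : ℕ} (z : Fin (d + 1) → ℝ) : Fin d → ℝ := fun i => z i.castSucc

lemma spacePart_mem_cube {d : ℕ} {z : Fin (d + 1) → ℝ} (hz : z ∈ cube (d + 1)) :
    spacePart z ∈ cube d := mem_cube.2 fun i => mem_cube.1 hz i.castSucc

lemma snoc_mem_cube {d : ℕ} {x : Fin d → ℝ} (hx : x ∈ cube d) {t : ℝ} (ht : t ∈ Icc (0 : ℝ) 1) :
    (Fin.snoc x t : Fin (d + 1) → ℝ) ∈ cube (d + 1) := by
  refine mem_cube.2 fun j => ?_
  refine Fin.lastCases ?_ (fun i => ?_) j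
  · simpa using ht
  · simpa using mem_cube.1 hx i

@[simp] lemma spacePart_snoc {d : ℕ} (x : Fin d → ℝ) (t : ℝ) :
    spacePart (Fin.snoc x t : Fin (d + 1) → ℝ) = x := by
  funext i
  simp [spacePart]

lemma snoc_spacePart {d : ℕ} (z : Fin (d + 1) → ℝ) :
    (Fin.snoc (spacePart z) (z (Fin.last d)) : Fin (d + 1) → ℝ) = z := by
  funext j
  refine Fin.lastCases ?_ (fun i => ?_) j <;> simp [spacePart]

lemma spacePart_update {d : ℕ} (z : Fin (d + 1) → ℝ) (i : Fin d) (s : ℝ) :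
    spacePart (Function.update z i.castSucc s) = Function.update (spacePart z) i s := by
  funext j
  rcases eq_or_ne j i with rfl | h
  · simp [spacePart]
  · simp [spacePart, h]

lemma update_castSucc_last {d : ℕ} (z : Fin (d + 1) → ℝ) (i : Fin d) (s : ℝ) :
    Function.update z i.castSucc s (Fin.last d) = z (Fin.last d) := by
  rw [Function.update_of_ne (Fin.castSucc_lt_last i).ne']

lemma UniformCk.spacePart {ι : Type*} {d k : ℕ} {F : ι → (Fin d → ℝ) → ℝ} (hF : UniformCk k F) :
    UniformCk k fun i z => F i (LtI.spacePart z) :=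
  UniformCk.comp (H := fun j _ z => z (Fin.castSucc j)) hF (fun _ => UniformCk.coord _)
    fun _ _ hz => spacePart_mem_cube hz

/-- The `i`-th component of the displacement interpolation as a function on space-time. -/
def displacementST {d : ℕ} (fν fμ : (Fin d → ℝ) → ℝ) (i : Fin d) (z : Fin (d + 1) → ℝ) : ℝ :=
  displacement fν fμ (z (Fin.last d)) (spacePart z) i

lemma displacement_apply {d : ℕ} (fν fμ : (Fin d → ℝ) → ℝ) (t : ℝ) (x : Fin d → ℝ) (i : Fin d) :
    displacement fν fμ t x i = t * krMap fν fμ x i + (1 - t) * x i := by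
  simp [displacement]

section Displacement

variable {d : ℕ} {κ 𝒦 : ℝ} {fν fμ : (Fin d → ℝ) → ℝ}

lemma displacement_congr {x y : Fin d → ℝ} (t : ℝ) (i : Fin d) (h : ∀ j ≤ i, x j = y j) :
    displacement fν fμ t x i = displacement fν fμ t y i := by
  rw [displacement_apply, displacement_apply, krMap_congr i h, h i le_rfl]

lemma IsCubeDensity.slope_pos (hν : IsCubeDensity κ 𝒦 fν) : 0 < κ / 𝒦 / (𝒦 / κ) :=
  div_pos (div_pos hν.pos hν.upper_pos) (div_pos hν.upper_pos hν.pos)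

lemma IsCubeDensity.slope_le_one (hν : IsCubeDensity κ 𝒦 fν) : κ / 𝒦 / (𝒦 / κ) ≤ 1 := by
  have hκ := hν.pos
  have h𝒦 := hν.upper_pos
  have hle : κ ≤ 𝒦 := (hν.lower 0 (zero_mem_cube d)).trans (hν.upper 0 (zero_mem_cube d))
  have h1 : κ / 𝒦 ≤ 1 := (div_le_one h𝒦).2 hle
  have h2 : 1 ≤ 𝒦 / κ := (one_le_div hκ).2 hle
  exact (div_le_one (by positivity)).2 (h1.trans h2)

lemma displacement_mem_cube (hν : IsCubeDensity κ 𝒦 fν) (hμ : IsCubeDensity κ 𝒦 fμ)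
    {x : Fin d → ℝ} (hx : x ∈ cube d) {t : ℝ} (ht : t ∈ Icc (0 : ℝ) 1) :
    displacement fν fμ t x ∈ cube d :=
  convex_cube d (krMap_mem_cube hν hμ hx) hx ht.1 (sub_nonneg.2 ht.2) (by ring)

/-- A convex combination of the slope of `T_i` and the slope `1` of the identity; as the constant is
at most `1`, it survives for all times. -/
lemma displacementST_sliceIncreasing (hν : IsCubeDensity κ 𝒦 fν) (hμ : IsCubeDensity κ 𝒦 fμ)
    (i : Fin d) :
    SliceIncreasing (κ / 𝒦 / (𝒦 / κ)) i.castSucc (displacementST fν fμ i) where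
  cont := by
    have h0 : displacementST fν fμ i = fun z => z (Fin.last d) * krMap fν fμ (spacePart z) i +
        (1 - z (Fin.last d)) * spacePart z i := funext fun z => displacement_apply ..
    rw [h0]
    have h1 : ContinuousOn (fun z : Fin (d + 1) → ℝ => krMap fν fμ (spacePart z) i)
        (cube (d + 1)) :=
      (continuous_apply i).comp_continuousOn ((continuousOn_krMap hν hμ).comp
        (Continuous.continuousOn (by unfold spacePart; fun_prop)) fun z hz => spacePart_mem_cube hz)
    have h2 : Continuous fun z : Fin (d + 1) → ℝ => spacePart z i := by
      unfold spacePart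
      fun_prop
    fun_prop
  incr z hz s hs s' hs' hle := by
    simp only [displacementST, displacement_apply, spacePart_update, update_castSucc_last,
      Function.update_self]
    have ht := mem_cube.1 hz (Fin.last d)
    have h := (krMap_sliceIncreasing hν hμ i).incr _ (spacePart_mem_cube hz) s hs s' hs' hle
    have h1 := mul_le_mul_of_nonneg_left h ht.1
    have h2 := mul_nonneg (mul_nonneg (sub_nonneg.2 ht.2) (sub_nonneg.2 hν.slope_le_one))
      (sub_nonneg.2 hle)
    nlinarith
  zero z hz := by
    simp only [displacementST, displacement_apply, spacePart_update, update_castSucc_last,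
      Function.update_self, (krMap_sliceIncreasing hν hμ i).zero _ (spacePart_mem_cube hz)]
    ring
  one z hz := by
    simp only [displacementST, displacement_apply, spacePart_update, update_castSucc_last,
      Function.update_self, (krMap_sliceIncreasing hν hμ i).one _ (spacePart_mem_cube hz)]
    ring

lemma displacementST_snoc (t : ℝ) (x : Fin d → ℝ) (i : Fin d) :
    displacementST fν fμ i (Fin.snoc x t : Fin (d + 1) → ℝ) = displacement fν fμ t x i := by
  simp [displacementST]

/-- Forward substitution: once the earlier coordinates agree, the `i`-th equation is a slice
equation in `x i` alone. -/
lemma displacement_injOn (hν : IsCubeDensity κ 𝒦 fν) (hμ : IsCubeDensity κ 𝒦 fμ) {t : ℝ}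
    (ht : t ∈ Icc (0 : ℝ) 1) : InjOn (displacement fν fμ t) (cube d) := by
  intro x hx y hy hxy
  funext i
  induction i using WellFoundedLT.induction with
  | ind i ih =>
    have h := (displacementST_sliceIncreasing hν hμ i).eq_of_apply_eq hν.slope_pos
      (snoc_mem_cube hy ht) (snoc_mem_cube hx ht) ?_
    · simpa using h
    · have : displacement fν fμ t (Function.update y i (x i)) i = displacement fν fμ t x i :=
        displacement_congr t i fun j hj => by
          rcases hj.eq_or_lt with rfl | hj
          · simp
          · simp [hj.ne, ih j hj]
      rw [displacementST_snoc, displacementST, spacePart_update, update_castSucc_last,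
        spacePart_snoc, Fin.snoc_castSucc, Fin.snoc_last, this, hxy]

lemma exists_displacement_eq (hν : IsCubeDensity κ 𝒦 fν) (hμ : IsCubeDensity κ 𝒦 fμ)
    {y : Fin d → ℝ} (hy : y ∈ cube d) {t : ℝ} (ht : t ∈ Icc (0 : ℝ) 1) :
    ∃ x ∈ cube d, displacement fν fμ t x = y := by
  -- The first `m` equations are solved in turn; changing coordinate `m` does not disturb the
  -- earlier ones, by triangularity.
  have : ∀ m ≤ d, ∃ x ∈ cube d, ∀ j : Fin d, j.val < m → displacement fν fμ t x j = y j := by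
    intro m
    induction m with
    | zero => exact fun _ => ⟨0, zero_mem_cube d, fun j hj => absurd hj (Nat.not_lt_zero _)⟩
    | succ m ih =>
      intro hm
      obtain ⟨x, hx, hxy⟩ := ih (by omega)
      let i : Fin d := ⟨m, by omega⟩
      have hs := displacementST_sliceIncreasing hν hμ i
      have hz := snoc_mem_cube (update_mem_cube hx i (mem_cube.1 hy i)) ht
      obtain ⟨s, hs01, hs⟩ := hs.exists_solution hz
      rw [displacementST, spacePart_update, spacePart_snoc, update_castSucc_last, Fin.snoc_last,
        Fin.snoc_castSucc, Function.update_idem, Function.update_self] at hs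
      refine ⟨Function.update x i s, update_mem_cube hx i hs01, fun j hj => ?_⟩
      rcases Nat.lt_succ_iff_lt_or_eq.1 hj with hj | hj
      · rw [← hxy j hj]
        exact displacement_congr t j fun l hl => Function.update_of_ne (by
          rintro rfl
          have : m ≤ j.val := hl
          omega) _ _
      · rw [show j = i from Fin.ext hj, hs]
  obtain ⟨x, hx, h⟩ := this d le_rfl
  exact ⟨x, hx, funext fun j => h j j.2⟩

lemma displacementInv_mem (hν : IsCubeDensity κ 𝒦 fν) (hμ : IsCubeDensity κ 𝒦 fμ)
    {y : Fin d → ℝ} (hy : y ∈ cube d) {t : ℝ} (ht : t ∈ Icc (0 : ℝ) 1) :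
    displacementInv fν fμ y t ∈ cube d :=
  Function.invFunOn_mem (exists_displacement_eq hν hμ hy ht)

lemma displacement_displacementInv (hν : IsCubeDensity κ 𝒦 fν) (hμ : IsCubeDensity κ 𝒦 fμ)
    {y : Fin d → ℝ} (hy : y ∈ cube d) {t : ℝ} (ht : t ∈ Icc (0 : ℝ) 1) :
    displacement fν fμ t (displacementInv fν fμ y t) = y :=
  Function.invFunOn_eq (exists_displacement_eq hν hμ hy ht)

lemma displacementInv_displacement (hν : IsCubeDensity κ 𝒦 fν) (hμ : IsCubeDensity κ 𝒦 fμ)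
    {x : Fin d → ℝ} (hx : x ∈ cube d) {t : ℝ} (ht : t ∈ Icc (0 : ℝ) 1) :
    displacementInv fν fμ (displacement fν fμ t x) t = x :=
  (displacement_injOn hν hμ ht).leftInvOn_invFunOn hx

lemma displacement_zero (x : Fin d → ℝ) : displacement fν fμ 0 x = x := by simp [displacement]

lemma displacement_one (x : Fin d → ℝ) : displacement fν fμ 1 x = krMap fν fμ x := by
  simp [displacement]

/-- The velocity seen along `t ↦ I_t(x)` is the constant `T(x) - x`. Hence these segments are flow
lines of `u`. -/
lemma targetField_displacement (hν : IsCubeDensity κ 𝒦 fν) (hμ : IsCubeDensity κ 𝒦 fμ)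
    {x : Fin d → ℝ} (hx : x ∈ cube d) {t : ℝ} (ht : t ∈ Icc (0 : ℝ) 1) :
    targetField fν fμ (displacement fν fμ t x) t = krMap fν fμ x - x := by
  rw [targetField, displacementInv_displacement hν hμ hx ht]

/-- The inverse of the displacement interpolation as a function on space-time. -/
def displacementInvST (fν fμ : (Fin d → ℝ) → ℝ) (z : Fin (d + 1) → ℝ) : Fin d → ℝ :=
  displacementInv fν fμ (spacePart z) (z (Fin.last d))

lemma displacementInvST_mem (hν : IsCubeDensity κ 𝒦 fν) (hμ : IsCubeDensity κ 𝒦 fμ)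
    {z : Fin (d + 1) → ℝ} (hz : z ∈ cube (d + 1)) : displacementInvST fν fμ z ∈ cube d :=
  displacementInv_mem hν hμ (spacePart_mem_cube hz) (mem_cube.1 hz _)

/-- The argument at which the `i`-th coordinate of the displacement is inverted. -/
def displacementArg (fν fμ : (Fin d → ℝ) → ℝ) (i : Fin d) (z : Fin (d + 1) → ℝ) :
    Fin (d + 1) → ℝ :=
  Fin.snoc (Function.update (fun j => if j < i then displacementInvST fν fμ z j else 0) i
    (z i.castSucc)) (z (Fin.last d))

lemma displacementArg_mem (hν : IsCubeDensity κ 𝒦 fν) (hμ : IsCubeDensity κ 𝒦 fμ) (i : Fin d)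
    {z : Fin (d + 1) → ℝ} (hz : z ∈ cube (d + 1)) :
    displacementArg fν fμ i z ∈ cube (d + 1) := by
  refine snoc_mem_cube (update_mem_cube (mem_cube.2 fun j => ?_) i (mem_cube.1 hz _))
    (mem_cube.1 hz _)
  split_ifs
  · exact mem_cube.1 (displacementInvST_mem hν hμ hz) j
  · simp

lemma displacementInvST_eq_solve (hν : IsCubeDensity κ 𝒦 fν) (hμ : IsCubeDensity κ 𝒦 fμ)
    (i : Fin d) {z : Fin (d + 1) → ℝ} (hz : z ∈ cube (d + 1)) :
    displacementInvST fν fμ z i =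
      solve i.castSucc (displacementST fν fμ i) (displacementArg fν fμ i z) := by
  refine (displacementST_sliceIncreasing hν hμ i).eq_solve hν.slope_pos
    (displacementArg_mem hν hμ i hz) (mem_cube.1 (displacementInvST_mem hν hμ hz) i) ?_
  rw [displacementST, spacePart_update, update_castSucc_last, displacementArg, spacePart_snoc,
    Fin.snoc_last, Fin.snoc_castSucc, Function.update_idem, Function.update_self]
  have := congrFun (displacement_displacementInv hν hμ (spacePart_mem_cube hz)
    (mem_cube.1 hz (Fin.last d))) i
  rw [spacePart] at this
  rw [← this]
  refine displacement_congr _ i fun j hj => ?_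
  rcases hj.eq_or_lt with rfl | hj
  · simp [displacementInvST]
  · simp [hj.ne, hj, displacementInvST]

/-! ### Uniform regularity of the inverse displacement and of the target field. -/

variable {ι : Type*} {k : ℕ} {Fν Fμ : ι → (Fin d → ℝ) → ℝ}

/-- The same triangular recursion as for the transport, with time as one more smooth variable. -/
lemma UniformCk.displacementInvST (hν : UniformCk k Fν)
    (hμ : UniformCk k Fμ) (hdν : ∀ i, IsCubeDensity κ 𝒦 (Fν i))
    (hdμ : ∀ i, IsCubeDensity κ 𝒦 (Fμ i)) (hκ : 0 < κ) (h𝒦 : 0 < 𝒦) (e : Fin d) :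
    UniformCk k fun i z => displacementInvST (Fν i) (Fμ i) z e := by
  have hT := fun e => (UniformCk.krMap hν hμ hdν hdμ hκ h𝒦 e).spacePart
  have hE : ∀ e, UniformCk k fun i => displacementST (Fν i) (Fμ i) e := by
    intro e
    have ht : UniformCk k fun (_ : ι) (z : Fin (d + 1) → ℝ) => z (Fin.last d) :=
      UniformCk.coord _
    refine (UniformCk.add (UniformCk.mul ht (hT e)) (UniformCk.mul
      (UniformCk.sub (UniformCk.const 1) ht) (UniformCk.coord e.castSucc))).congr fun i z _ => ?_
    rw [displacementST, displacement_apply]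
    rfl
  induction e using WellFoundedLT.induction with
  | ind e ih =>
    have hs := UniformCk.solve (hE e) (div_pos (div_pos hκ h𝒦) (div_pos h𝒦 hκ))
      fun i => displacementST_sliceIncreasing (hdν i) (hdμ i) e
    refine (UniformCk.comp (H := fun j i z => displacementArg (Fν i) (Fμ i) e z j) hs (fun j => ?_)
      (fun i z hz => displacementArg_mem (hdν i) (hdμ i) e hz)).congr fun i z hz => ?_
    · refine Fin.lastCases ?_ (fun j => ?_) j
      · simpa only [displacementArg, Fin.snoc_last] using UniformCk.coord _
      · simp only [displacementArg, Fin.snoc_castSucc]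
        rcases lt_trichotomy j e with hj | rfl | hj
        · simpa only [ne_eq, hj.ne, not_false_eq_true, Function.update_of_ne, hj,
            if_true] using ih j hj
        · simpa only [Function.update_self] using UniformCk.coord _
        · simpa only [ne_eq, hj.ne', not_false_eq_true, Function.update_of_ne, hj.not_gt,
            if_false] using UniformCk.const 0
    · exact (displacementInvST_eq_solve (hdν i) (hdμ i) e hz).symm

/-- The `i`-th component of the target field as a function on space-time. -/
def targetST (fν fμ : (Fin d → ℝ) → ℝ) (i : Fin d) (z : Fin (d + 1) → ℝ) : ℝ :=
  targetField fν fμ (spacePart z) (z (Fin.last d)) i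

lemma UniformCk.targetST (hν : UniformCk k Fν)
    (hμ : UniformCk k Fμ) (hdν : ∀ i, IsCubeDensity κ 𝒦 (Fν i))
    (hdμ : ∀ i, IsCubeDensity κ 𝒦 (Fμ i)) (hκ : 0 < κ) (h𝒦 : 0 < 𝒦) (e : Fin d) :
    UniformCk k fun i => targetST (Fν i) (Fμ i) e := by
  have hG := fun e => UniformCk.displacementInvST hν hμ hdν hdμ hκ h𝒦 e
  exact UniformCk.sub (UniformCk.comp (UniformCk.krMap hν hμ hdν hdμ hκ h𝒦 e) hG
    fun i z hz => displacementInvST_mem (hdν i) (hdμ i) hz) (hG e)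

lemma UniformCk.krInv (hν : UniformCk k Fν)
    (hμ : UniformCk k Fμ) (hdν : ∀ i, IsCubeDensity κ 𝒦 (Fν i))
    (hdμ : ∀ i, IsCubeDensity κ 𝒦 (Fμ i)) (hκ : 0 < κ) (h𝒦 : 0 < 𝒦) (e : Fin d) :
    UniformCk k fun i y => displacementInv (Fν i) (Fμ i) y 1 e := by
  refine (UniformCk.comp (H := fun j _ y => (Fin.snoc y 1 : Fin (d + 1) → ℝ) j)
    (UniformCk.displacementInvST hν hμ hdν hdμ hκ h𝒦 e) (fun j => ?_)
    fun i y hy => snoc_mem_cube hy (by simp)).congr fun i y _ => ?_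
  · refine Fin.lastCases ?_ (fun j => ?_) j
    · simpa only [Fin.snoc_last] using UniformCk.const 1
    · simpa only [Fin.snoc_castSucc] using UniformCk.coord _
  · simp [LtI.displacementInvST]

/-- A point of a face comes, under `I_t`, from the same face, since the slices are injective and fix
their endpoints; on that face `T` does not move the coordinate `e`. -/
lemma targetST_eq_zero (hν : IsCubeDensity κ 𝒦 fν) (hμ : IsCubeDensity κ 𝒦 fμ) (e : Fin d)
    {z : Fin (d + 1) → ℝ} (hz : z ∈ cube (d + 1)) (h : z e.castSucc = 0 ∨ z e.castSucc = 1) :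
    targetST fν fμ e z = 0 := by
  have ht := mem_cube.1 hz (Fin.last d)
  have hG := displacementInvST_mem hν hμ hz
  have hsG := snoc_mem_cube hG ht
  have hs := displacementST_sliceIncreasing hν hμ e
  have heq : displacementST fν fμ e (Fin.snoc (displacementInvST fν fμ z) (z (Fin.last d))) =
      z e.castSucc := by
    rw [displacementST_snoc]
    exact congrFun (displacement_displacementInv hν hμ (spacePart_mem_cube hz) ht) e
  have hval : ∀ s ∈ Icc (0 : ℝ) 1, krMap fν fμ (Function.update (displacementInvST fν fμ z) e s) e
      = s → s = displacementInvST fν fμ z e → targetST fν fμ e z = 0 := by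
    intro s _ hs1 hs2
    rw [hs2, Function.update_eq_self] at hs1
    rw [targetST, targetField, Pi.sub_apply]
    exact sub_eq_zero.2 hs1
  rcases h with h | h
  · refine hval 0 (by simp) ((krMap_sliceIncreasing hν hμ e).zero _ hG) ?_
    have := hs.eq_of_apply_eq hν.slope_pos hsG (zero_mem_cube _)
      ((hs.zero _ hsG).trans (heq.trans h).symm)
    simpa using this
  · refine hval 1 (by simp) ((krMap_sliceIncreasing hν hμ e).one _ hG) ?_
    have := hs.eq_of_apply_eq hν.slope_pos hsG (y := fun _ => 1) (mem_cube.2 fun _ => by simp)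
      ((hs.one _ hsG).trans (heq.trans h).symm)
    simpa using this

end Displacement

/-! ### The Knothe–Rosenblatt transport pushes the source to the target -/

lemma IsCubeDensity.hasDerivWithinAt_condCDF {d : ℕ} {κ 𝒦 : ℝ} {f : (Fin d → ℝ) → ℝ}
    (h : IsCubeDensity κ 𝒦 f) (i : Fin d) {x : Fin d → ℝ} (hx : x ∈ cube d) {s : ℝ}
    (hs : s ∈ Icc (0 : ℝ) 1) :
    HasDerivWithinAt (condCDF f i x) (condDensity f i (Function.update x i s)) (Icc 0 1) s := by
  have : Fact (s ∈ Icc (0 : ℝ) 1) := ⟨hs⟩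
  have hc := continuousOn_update_Icc (h.continuousOn_condDensity i) i hx
  exact intervalIntegral.integral_hasDerivWithinAt_right
    (h.intervalIntegrable_condDensity i hx (by simp) hs)
    (hc.stronglyMeasurableAtFilter_nhdsWithin measurableSet_Icc s) (hc s hs)

/-- The quotients of consecutive marginals telescope from the total mass `1` to `f` itself. -/
lemma prod_condDensity {d : ℕ} {κ 𝒦 : ℝ} {f : (Fin d → ℝ) → ℝ} (h : IsCubeDensity κ 𝒦 f)
    {x : Fin d → ℝ} (hx : x ∈ cube d) : ∏ i, condDensity f i x = f x := by
  have h1 : ∏ i : Fin d, condDensity f i x =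
      ∏ m ∈ Finset.range d, marginal f (m + 1) x / marginal f m x :=
    Fin.prod_univ_eq_prod_range (fun m => marginal f (m + 1) x / marginal f m x) d
  have h2 : ∀ n, ∏ m ∈ Finset.range n, marginal f (m + 1) x / marginal f m x =
      marginal f n x := by
    intro n
    induction n with
    | zero => simp [h.total x hx]
    | succ n ih =>
      rw [Finset.prod_range_succ, ih, mul_div_cancel₀]
      exact (h.pos.trans_le (h.marginal_mem n hx).1).ne'
  rw [h1, h2, marginal_eq_self f le_rfl]

lemma measurableSet_cube_inter_preimage {d : ℕ} {E : Type*} [TopologicalSpace E]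
    [MeasurableSpace E] [BorelSpace E] [Inhabited E] {g : (Fin d → ℝ) → E}
    (hg : ContinuousOn g (cube d)) {A : Set E} (hA : MeasurableSet A) :
    MeasurableSet (cube d ∩ g ⁻¹' A) := by
  classical
  have : cube d ∩ g ⁻¹' A = cube d ∩ ((cube d).piecewise g fun _ => default) ⁻¹' A := by
    ext x
    refine and_congr_right fun hx => ?_
    rw [mem_preimage, mem_preimage, piecewise_eq_of_mem _ _ _ hx]
  rw [this]
  exact (measurableSet_cube d).inter ((hg.measurable_piecewise
    continuousOn_const (measurableSet_cube d)) hA)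

section

variable {d : ℕ} {κ 𝒦 : ℝ} {fν fμ : (Fin d → ℝ) → ℝ}

/-- The Jacobian matrix is lower triangular. Differentiating the defining equation in `x_i` shows
that its diagonal entry is the quotient of the two conditional densities, and their products are the
densities. -/
lemma det_krMap_deriv (hν : IsCubeDensity κ 𝒦 fν) (hμ : IsCubeDensity κ 𝒦 fμ)
    {x : Fin d → ℝ} (hx : x ∈ cube d) {A : Fin d → Fin d → ℝ}
    (hA : ∀ i, HasFDerivWithinAt (fun y => krMap fν fμ y i) (gradCLM (A i)) (cube d) x) :
    (ContinuousLinearMap.pi fun i => gradCLM (A i)).det * fμ (krMap fν fμ x) = fν x := by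
  have hTx := krMap_mem_cube hν hμ hx
  have hslice := fun i j => hasDerivWithinAt_slice hx (hA i) j
  have huniq : ∀ s ∈ Icc (0 : ℝ) 1, UniqueDiffWithinAt ℝ (Icc (0 : ℝ) 1) s :=
    uniqueDiffOn_Icc zero_lt_one
  have htri : ∀ i j, i < j → A i j = 0 := by
    intro i j hij
    have h1 := (hslice i j).congr (f₁ := fun _ => krMap fν fμ x i)
      (fun s _ => (krMap_update_of_lt x hij s).symm) (krMap_update_of_lt x hij _).symm
    exact (huniq _ (mem_cube.1 hx j)).eq_deriv _ h1 (hasDerivWithinAt_const _ _ _)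
  have hdiag : ∀ i, A i i * condDensity fμ i (krMap fν fμ x) = condDensity fν i x := by
    intro i
    have hxi := mem_cube.1 hx i
    have h1 := (hμ.hasDerivWithinAt_condCDF i hTx (mem_cube.1 hTx i))
    rw [Function.update_eq_self] at h1
    have h2 : HasDerivWithinAt (condCDF fμ i (krMap fν fμ x))
        (condDensity fμ i (krMap fν fμ x)) (Icc 0 1)
        (krMap fν fμ (Function.update x i (x i)) i) := by rwa [Function.update_eq_self]
    have h3 := h2.comp (x i) (hslice i i) fun s hs =>
      (krMap_mem_Icc hν hμ (update_mem_cube hx i hs) i).2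
    have h4 := hν.hasDerivWithinAt_condCDF i hx hxi
    rw [Function.update_eq_self] at h4
    have heq : ∀ s ∈ Icc (0 : ℝ) 1, condCDF fν i x s = (condCDF fμ i (krMap fν fμ x) ∘
        fun s => krMap fν fμ (Function.update x i s) i) s := by
      intro s hs
      rw [← diagCDF_update fν, ← diagCDF_krMap hν hμ (update_mem_cube hx i hs), diagCDF]
      exact condCDF_congr (fun j hj => krMap_update_of_lt x hj s) _
    rw [mul_comm]
    exact (huniq _ hxi).eq_deriv _ (h3.congr heq (heq _ hxi)) h4
  have hdet : (ContinuousLinearMap.pi fun i => gradCLM (A i)).det = ∏ i, A i i := by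
    have : ((ContinuousLinearMap.pi fun i => gradCLM (A i) : (Fin d → ℝ) →L[ℝ] (Fin d → ℝ)) :
        (Fin d → ℝ) →ₗ[ℝ] (Fin d → ℝ)) = Matrix.toLin' (Matrix.of A) := by
      ext1 j
      ext i
      simp [gradCLM_single, Matrix.toLin'_apply]
    rw [ContinuousLinearMap.det, this, LinearMap.det_toLin', Matrix.det_of_isLowerTriangular]
    · rfl
    · intro i j hij
      exact htri i j hij
  rw [hdet, ← prod_condDensity hμ hTx, ← Finset.prod_mul_distrib, Finset.prod_congr rfl
    fun i _ => hdiag i, prod_condDensity hν hx]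

lemma krMap_image_preimage (hν : IsCubeDensity κ 𝒦 fν) (hμ : IsCubeDensity κ 𝒦 fμ)
    (A : Set (Fin d → ℝ)) : krMap fν fμ '' (cube d ∩ krMap fν fμ ⁻¹' A) = A ∩ cube d := by
  ext y
  constructor
  · rintro ⟨x, ⟨hx, hxA⟩, rfl⟩
    exact ⟨hxA, krMap_mem_cube hν hμ hx⟩
  · rintro ⟨hyA, hy⟩
    obtain ⟨x, hx, rfl⟩ := exists_displacement_eq hν hμ hy (t := 1) (by simp)
    rw [displacement_one] at hyA ⊢
    exact ⟨x, ⟨hx, hyA⟩, rfl⟩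

lemma krMap_injOn (hν : IsCubeDensity κ 𝒦 fν) (hμ : IsCubeDensity κ 𝒦 fμ) :
    InjOn (krMap fν fμ) (cube d) := by
  simpa only [funext displacement_one] using displacement_injOn hν hμ (t := 1) (by simp)

/-- This is `T_*ν = μ`, by change of variables; the absolute value of the Jacobian can be dropped
because both densities are positive. -/
lemma setLIntegral_krMap {k : ℕ} {M : ℝ≥0} (hν : IsCubeDensity κ 𝒦 fν)
    (hμ : IsCubeDensity κ 𝒦 fμ) (hνk : ckNorm (k + 1) fν ≤ M) (hμk : ckNorm (k + 1) fμ ≤ M)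
    {A : Set (Fin d → ℝ)} (hA : MeasurableSet A) :
    ∫⁻ y in A ∩ cube d, ENNReal.ofReal (fμ y) =
      ∫⁻ x in cube d ∩ krMap fν fμ ⁻¹' A, ENNReal.ofReal (fν x) := by
  have hT := fun e => UniformCk.krMap (ι := Unit) (UniformCk.of_ckNorm_le (fun _ => hνk))
    (UniformCk.of_ckNorm_le (fun _ => hμk)) (fun _ => hν) (fun _ => hμ) hν.pos hν.upper_pos e
  choose T' hT' _ using fun e => (hT e).exists_grad
  have hB := measurableSet_cube_inter_preimage (continuousOn_krMap hν hμ) hA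
  rw [← krMap_image_preimage hν hμ A, lintegral_image_eq_lintegral_abs_det_fderiv_mul volume hB
    (f' := fun x => ContinuousLinearMap.pi fun i => gradCLM fun j => T' i j () x)
    (fun x hx => (hasFDerivWithinAt_pi.2 fun i => hT' i () x hx.1).mono inter_subset_left)
    ((krMap_injOn hν hμ).mono inter_subset_left)]
  refine setLIntegral_congr_fun hB fun x hx => ?_
  have hdet := det_krMap_deriv hν hμ hx.1 (A := fun i j => T' i j () x) fun i => hT' i () x hx.1
  have hpos := hν.pos.trans_le (hν.lower x hx.1)
  have hpos' := hμ.pos.trans_le (hμ.lower _ (krMap_mem_cube hν hμ hx.1))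
  have hd : 0 ≤ (ContinuousLinearMap.pi fun i => gradCLM fun j => T' i j () x).det := by
    by_contra! hneg
    nlinarith
  rw [abs_of_nonneg hd, ← ENNReal.ofReal_mul hd, hdet]

end

/-! ### Flows of fields that are tangent to the faces of the cube -/

lemma hasDerivAt_sq_max_zero (r : ℝ) :
    HasDerivAt (fun r : ℝ => max r 0 ^ 2) (2 * max r 0) r := by
  rcases lt_trichotomy r 0 with h | rfl | h
  · rw [max_eq_right h.le, mul_zero]
    refine (hasDerivAt_const r (0 : ℝ)).congr_of_eventuallyEq ?_
    filter_upwards [Iio_mem_nhds h] with s hs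
    rw [max_eq_right (le_of_lt hs), zero_pow two_ne_zero]
  · rw [hasDerivAt_iff_isLittleO_nhds_zero]
    have h1 : (fun h : ℝ => h ^ 2) =o[nhds 0] fun h => h := Asymptotics.isLittleO_pow_id one_lt_two
    refine Asymptotics.IsBigO.trans_isLittleO (Asymptotics.IsBigO.of_bound 1 ?_) h1
    refine Filter.Eventually.of_forall fun h => ?_
    simp only [zero_add, max_self, mul_zero, smul_zero, sub_zero, one_mul, Real.norm_eq_abs,
      ne_eq, OfNat.ofNat_ne_zero, not_false_eq_true, zero_pow, abs_pow, sq_abs]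
    rcases le_total h 0 with h0 | h0 <;> simp [h0, sq_nonneg]
  · rw [max_eq_left h.le]
    refine ((hasDerivAt_pow 2 r).congr_deriv (by norm_num)).congr_of_eventuallyEq ?_
    filter_upwards [Ioi_mem_nhds h] with s hs
    rw [max_eq_left (le_of_lt hs)]

lemma norm_le_of_hasDerivWithinAt {F : Type*} [NormedAddCommGroup F] [NormedSpace ℝ F]
    {E E' : ℝ → F} {K ε : ℝ} (hK : 0 < K) (hε : 0 ≤ ε)
    (hE : ∀ t ∈ Icc (0 : ℝ) 1, HasDerivWithinAt E (E' t) (Icc 0 1) t)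
    (hb : ∀ t ∈ Icc (0 : ℝ) 1, ‖E' t‖ ≤ K * ‖E t‖ + ε) {t : ℝ} (ht : t ∈ Icc (0 : ℝ) 1) :
    ‖E t‖ ≤ (‖E 0‖ + ε) * Real.exp K := by
  have h := norm_le_gronwallBound_of_norm_deriv_right_le (f := E) (f' := E') (δ := ‖E 0‖)
    (K := K) (ε := ε) (a := 0) (b := 1) (fun s hs => (hE s hs).continuousWithinAt)
    (fun s hs => (hE s (Ico_subset_Icc_self hs)).mono_of_mem_nhdsWithin
      (Icc_mem_nhdsGE_of_mem hs)) le_rfl (fun s hs => hb s (Ico_subset_Icc_self hs)) t ht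
  rw [gronwallBound_of_K_ne_0 hK.ne', sub_zero] at h
  refine h.trans ?_
  have h1 : Real.exp (K * t) ≤ Real.exp K := Real.exp_le_exp.2 (by nlinarith [ht.2])
  -- Equivalent to `1 - K ≤ exp (-K)`; it avoids dividing by `K` in the final constant.
  have h2 : (Real.exp (K * t) - 1) / K ≤ Real.exp K := by
    rw [div_le_iff₀ hK]
    have h3 := Real.add_one_le_exp (-K)
    have h4 : Real.exp K * Real.exp (-K) = 1 := by rw [← Real.exp_add, add_neg_cancel, Real.exp_zero]
    nlinarith [Real.exp_pos K]
  calc ‖E 0‖ * Real.exp (K * t) + ε / K * (Real.exp (K * t) - 1)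
      = ‖E 0‖ * Real.exp (K * t) + ε * ((Real.exp (K * t) - 1) / K) := by ring
    _ ≤ ‖E 0‖ * Real.exp K + ε * Real.exp K := by gcongr
    _ = _ := by ring

/-- A time-dependent field on the cube, Lipschitz in space, continuous in time, and tangent to
all faces of the cube. -/
structure IsTangentField {d : ℕ} (K : ℝ) (w : (Fin d → ℝ) → ℝ → (Fin d → ℝ)) : Prop where
  lip : ∀ t ∈ Icc (0 : ℝ) 1, ∀ x ∈ cube d, ∀ y ∈ cube d, ‖w x t - w y t‖ ≤ K * ‖x - y‖
  cont : ∀ x ∈ cube d, ContinuousOn (w x) (Icc 0 1)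
  tangent : ∀ x ∈ cube d, ∀ t ∈ Icc (0 : ℝ) 1, ∀ i, x i = 0 ∨ x i = 1 → w x t i = 0

/-- The curve `y` solves `y' = w(y, t)` in the cube for `t ∈ [0,1]`, with `y(0) = x`. -/
def IsFlowLine {d : ℕ} (w : (Fin d → ℝ) → ℝ → (Fin d → ℝ)) (x : Fin d → ℝ)
    (y : ℝ → Fin d → ℝ) : Prop :=
  y 0 = x ∧ ∀ t ∈ Icc (0 : ℝ) 1, y t ∈ cube d ∧ HasDerivWithinAt y (w (y t) t) (Icc 0 1) t

/-- The nearest point of the cube. -/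
def clampCube {d : ℕ} (y : Fin d → ℝ) : Fin d → ℝ := fun i => max 0 (min 1 (y i))

lemma clampCube_mem {d : ℕ} (y : Fin d → ℝ) : clampCube y ∈ cube d :=
  mem_cube.2 fun _ => ⟨le_max_left _ _, max_le zero_le_one (min_le_left _ _)⟩

lemma clampCube_eq {d : ℕ} {y : Fin d → ℝ} (hy : y ∈ cube d) : clampCube y = y := by
  funext i
  have := mem_cube.1 hy i
  rw [clampCube, min_eq_right this.2, max_eq_right this.1]

lemma norm_clampCube_sub_le {d : ℕ} (x y : Fin d → ℝ) : ‖clampCube x - clampCube y‖ ≤ ‖x - y‖ := by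
  rw [pi_norm_le_iff_of_nonneg (norm_nonneg _)]
  intro i
  refine le_trans ?_ (norm_le_pi_norm (x - y) i)
  simp only [Real.norm_eq_abs, Pi.sub_apply, clampCube]
  have h1 := abs_max_sub_max_le_max 0 (min 1 (x i)) 0 (min 1 (y i))
  have h2 := abs_min_sub_min_le_max 1 (x i) 1 (y i)
  rw [sub_self, abs_zero] at h1 h2
  exact h1.trans (max_le (abs_nonneg _) (h2.trans (max_le (abs_nonneg _) le_rfl)))

namespace IsTangentField

variable {d : ℕ} {K : ℝ} {w : (Fin d → ℝ) → ℝ → (Fin d → ℝ)}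

lemma norm_le (h : IsTangentField K w) {x : Fin d → ℝ} (hx : x ∈ cube d) {t : ℝ}
    (ht : t ∈ Icc (0 : ℝ) 1) (hK : 0 ≤ K) : ‖w x t‖ ≤ K := by
  have h0 : w 0 t = 0 := funext fun i => h.tangent 0 (zero_mem_cube d) t ht i (Or.inl rfl)
  have h1 := h.lip t ht x hx 0 (zero_mem_cube d)
  rw [h0, sub_zero] at h1
  have h2 := norm_sub_le_one_of_mem_cube hx (zero_mem_cube d)
  nlinarith

lemma reverse (h : IsTangentField K w) : IsTangentField K fun x t => -w x (1 - t) where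
  lip t ht x hx y hy := by
    rw [neg_sub_neg, norm_sub_rev]
    exact h.lip (1 - t) ⟨by linarith [ht.2], by linarith [ht.1]⟩ x hx y hy
  cont x hx := ((h.cont x hx).comp (by fun_prop) fun t ht =>
    ⟨by linarith [ht.2], by linarith [ht.1]⟩).neg
  tangent x hx t ht i hi := by
    rw [Pi.neg_apply, h.tangent x hx (1 - t) ⟨by linarith [ht.2], by linarith [ht.1]⟩ i hi,
      neg_zero]

/-- Composing with the nearest-point projection makes the field bounded and Lipschitz on the whole
space, so Picard–Lindelöf gives a solution on all of `[0,1]`. Tangency then confines it to the cube,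
where the projection does nothing. -/
lemma exists_isFlowLine (h : IsTangentField K w) (hK : 0 ≤ K) {x : Fin d → ℝ} (hx : x ∈ cube d) :
    ∃ y, IsFlowLine w x y := by
  lift K to ℝ≥0 using hK
  have hPL : IsPicardLindelof (fun t y => w (clampCube y) t) (tmin := 0) (tmax := 1)
      ⟨0, by simp⟩ x K 0 K K := by
    refine ⟨fun t ht => ?_, fun y _ => h.cont _ (clampCube_mem y), fun t ht y _ =>
      h.norm_le (clampCube_mem y) ht K.2, by simp⟩
    refine LipschitzOnWith.of_dist_le_mul fun y _ z _ => ?_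
    rw [dist_eq_norm, dist_eq_norm]
    exact (h.lip t ht _ (clampCube_mem y) _ (clampCube_mem z)).trans
      (mul_le_mul_of_nonneg_left (norm_clampCube_sub_le y z) K.2)
  obtain ⟨y, hy0, hy⟩ := hPL.exists_eq_forall_mem_Icc_hasDerivWithinAt₀
  replace hy0 : y 0 = x := hy0
  have hyi : ∀ i, ∀ t ∈ Icc (0 : ℝ) 1,
      HasDerivWithinAt (fun t => y t i) (w (clampCube (y t)) t i) (Icc 0 1) t :=
    fun i t ht => hasDerivWithinAt_pi.1 (hy t ht) i
  have hconst : ∀ g : ℝ → ℝ, g 0 = 0 →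
      (∀ t ∈ Icc (0 : ℝ) 1, HasDerivWithinAt g 0 (Icc 0 1) t) → ∀ t ∈ Icc (0 : ℝ) 1, g t = 0 := by
    intro g hg0 hg t ht
    have := norm_le_of_hasDerivWithinAt (E' := fun _ => (0 : ℝ)) one_pos le_rfl hg (by simp) ht
    simpa [hg0] using this
  have hmem : ∀ t ∈ Icc (0 : ℝ) 1, y t ∈ cube d := by
    intro t ht
    rw [mem_cube]
    intro i
    have hxi := mem_cube.1 hx i
    constructor
    -- The squared excess beyond a face has zero derivative: where the excess is positive, the
    -- projected point lies on that face and the `i`-th velocity vanishes.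
    · have := hconst (fun t => max (-y t i) 0 ^ 2) (by simp [hy0, hxi.1]) (fun t ht => by
        refine ((hasDerivAt_sq_max_zero (-y t i)).comp_hasDerivWithinAt t
          (hyi i t ht).neg).congr_deriv ?_
        rcases le_total (-y t i) 0 with hle | hle
        · simp [hle]
        · rw [h.tangent _ (clampCube_mem _) t ht i (Or.inl ?_)]
          · simp
          · have : y t i ≤ 0 := by linarith
            rw [clampCube, min_eq_right (this.trans zero_le_one), max_eq_left this]) t ht
      have h2 := pow_eq_zero_iff two_ne_zero |>.1 this
      have := le_max_left (-y t i) 0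
      linarith
    · have := hconst (fun t => max (y t i - 1) 0 ^ 2) (by simp [hy0, hxi.2]) (fun t ht => by
        refine ((hasDerivAt_sq_max_zero (y t i - 1)).comp_hasDerivWithinAt t
          ((hyi i t ht).sub_const 1)).congr_deriv ?_
        rcases le_total (y t i - 1) 0 with hle | hle
        · simp [hle]
        · rw [h.tangent _ (clampCube_mem _) t ht i (Or.inr ?_)]
          · simp
          · have : 1 ≤ y t i := by linarith
            rw [clampCube, min_eq_left this, max_eq_right zero_le_one]) t ht
      have h2 := pow_eq_zero_iff two_ne_zero |>.1 this
      have := le_max_left (y t i - 1) 0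
      linarith
  refine ⟨y, hy0, fun t ht => ⟨hmem t ht, ?_⟩⟩
  have := hy t ht
  rwa [clampCube_eq (hmem t ht)] at this

lemma norm_flowLine_sub_le (h : IsTangentField K w) (hK : 0 < K) {x x' : Fin d → ℝ}
    {y y' : ℝ → Fin d → ℝ} (hy : IsFlowLine w x y) (hy' : IsFlowLine w x' y') {t : ℝ}
    (ht : t ∈ Icc (0 : ℝ) 1) : ‖y t - y' t‖ ≤ ‖x - x'‖ * Real.exp K := by
  have := norm_le_of_hasDerivWithinAt (E := fun t => y t - y' t)
    (E' := fun t => w (y t) t - w (y' t) t) hK le_rfl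
    (fun t ht => ((hy.2 t ht).2).sub (hy'.2 t ht).2)
    (fun t ht => by simpa using h.lip t ht _ (hy.2 t ht).1 _ (hy'.2 t ht).1) ht
  simpa [hy.1, hy'.1] using this

lemma flowEndpoint_eq (h : IsTangentField K w) (hK : 0 < K) {x : Fin d → ℝ}
    {y : ℝ → Fin d → ℝ} (hy : IsFlowLine w x y) : flowEndpoint w x = y 1 := by
  have hex : ∃ y : ℝ → Fin d → ℝ, y 0 = x ∧ ∀ t ∈ Icc (0 : ℝ) 1,
      y t ∈ cube d ∧ HasDerivWithinAt y (w (y t) t) (Icc 0 1) t := ⟨y, hy⟩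
  rw [flowEndpoint, dif_pos hex]
  have hc : IsFlowLine w x hex.choose := hex.choose_spec
  have := h.norm_flowLine_sub_le hK hc hy (t := 1) (by simp)
  rw [sub_self, norm_zero, zero_mul] at this
  exact sub_eq_zero.1 (norm_le_zero_iff.1 this)

lemma flowEndpoint_mem (h : IsTangentField K w) (hK : 0 < K) {x : Fin d → ℝ} (hx : x ∈ cube d) :
    flowEndpoint w x ∈ cube d := by
  obtain ⟨y, hy⟩ := h.exists_isFlowLine hK.le hx
  rw [h.flowEndpoint_eq hK hy]
  exact (hy.2 1 (by simp)).1

lemma norm_flowEndpoint_sub_le (h : IsTangentField K w) (hK : 0 < K) {x x' : Fin d → ℝ}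
    (hx : x ∈ cube d) (hx' : x' ∈ cube d) :
    ‖flowEndpoint w x - flowEndpoint w x'‖ ≤ ‖x - x'‖ * Real.exp K := by
  obtain ⟨y, hy⟩ := h.exists_isFlowLine hK.le hx
  obtain ⟨y', hy'⟩ := h.exists_isFlowLine hK.le hx'
  rw [h.flowEndpoint_eq hK hy, h.flowEndpoint_eq hK hy']
  exact h.norm_flowLine_sub_le hK hy hy' (by simp)

lemma continuousOn_flowEndpoint (h : IsTangentField K w) (hK : 0 < K) :
    ContinuousOn (flowEndpoint w) (cube d) := by
  refine LipschitzOnWith.continuousOn (K := ⟨Real.exp K, (Real.exp_pos K).le⟩) ?_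
  refine LipschitzOnWith.of_dist_le_mul fun x hx y hy => ?_
  rw [dist_eq_norm, dist_eq_norm, mul_comm]
  exact h.norm_flowEndpoint_sub_le hK hx hy

lemma flowEndpoint_of_notMem (w : (Fin d → ℝ) → ℝ → (Fin d → ℝ)) {x : Fin d → ℝ}
    (hx : x ∉ cube d) : flowEndpoint w x = x := by
  rw [flowEndpoint, dif_neg]
  rintro ⟨y, rfl, hy⟩
  exact hx (hy 0 (by simp)).1

lemma measurable_flowEndpoint (h : IsTangentField K w) (hK : 0 < K) :
    Measurable (flowEndpoint w) := by
  classical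
  suffices heq : flowEndpoint w = (cube d).piecewise (flowEndpoint w) id by
    rw [heq]
    exact (h.continuousOn_flowEndpoint hK).measurable_piecewise continuousOn_id
      (measurableSet_cube d)
  funext x
  by_cases hx : x ∈ cube d
  · rw [piecewise_eq_of_mem _ _ _ hx]
  · rw [piecewise_eq_of_notMem _ _ _ hx, flowEndpoint_of_notMem w hx, id]

/-- Surjectivity by running time backwards from `p`. -/
lemma exists_flowEndpoint_eq (h : IsTangentField K w) (hK : 0 < K) {p : Fin d → ℝ}
    (hp : p ∈ cube d) : ∃ x ∈ cube d, flowEndpoint w x = p := by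
  obtain ⟨y, hy⟩ := h.reverse.exists_isFlowLine hK.le hp
  have hrev : ∀ t ∈ Icc (0 : ℝ) 1, 1 - t ∈ Icc (0 : ℝ) 1 := fun t ht =>
    ⟨by linarith [ht.2], by linarith [ht.1]⟩
  have hline : IsFlowLine w (y 1) fun t => y (1 - t) := by
    refine ⟨by simp, fun t ht => ⟨(hy.2 _ (hrev t ht)).1, ?_⟩⟩
    have h1 := (hy.2 _ (hrev t ht)).2
    have h2 : HasDerivWithinAt (fun t : ℝ => 1 - t) (-1) (Icc 0 1) t :=
      ((hasDerivAt_id t).const_sub 1).hasDerivWithinAt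
    refine (h1.scomp t h2 hrev).congr_deriv ?_
    simp
  refine ⟨y 1, (hy.2 1 (by simp)).1, ?_⟩
  rw [h.flowEndpoint_eq hK hline, sub_self, hy.1]

end IsTangentField

/-! ### The Kullback–Leibler divergence of comparable measures -/

/-- The hypothesis bounds the density of `μ` with respect to `m` by `exp δ` almost everywhere, so
the logarithm in the divergence is at most `δ`. Boundedness of the density also gives integrability.
-/
lemma klDiv_le_of_le_smul {α : Type*} [MeasurableSpace α] {μ m : Measure α}
    [IsProbabilityMeasure μ] [IsProbabilityMeasure m] {δ : ℝ}
    (h : ∀ A, MeasurableSet A → μ A ≤ ENNReal.ofReal (Real.exp δ) * m A) :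
    InformationTheory.klDiv μ m ≤ ENNReal.ofReal δ := by
  have hac : μ ≪ m := Measure.AbsolutelyContinuous.mk fun A hA hmA =>
    le_antisymm ((h A hA).trans (by simp [hmA])) zero_le
  have hr : ∀ᵐ x ∂m, μ.rnDeriv m x ≤ ENNReal.ofReal (Real.exp δ) := by
    refine ae_le_of_forall_setLIntegral_le_of_sigmaFinite (Measure.measurable_rnDeriv μ m) ?_
    intro A hA _
    rw [Measure.setLIntegral_rnDeriv hac, setLIntegral_const]
    exact h A hA
  have hreal : ∀ᵐ x ∂m, (μ.rnDeriv m x).toReal ∈ Icc 0 (Real.exp δ) := by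
    filter_upwards [hr] with x hx
    exact ⟨ENNReal.toReal_nonneg, ENNReal.toReal_le_of_le_ofReal (Real.exp_pos δ).le hx⟩
  have hint : Integrable (llr μ m) μ := by
    rw [← InformationTheory.integrable_klFun_rnDeriv_iff hac]
    obtain ⟨B, hB⟩ := (isCompact_Icc (a := (0 : ℝ)) (b := Real.exp δ)).exists_bound_of_continuousOn
      InformationTheory.continuous_klFun.continuousOn
    refine Integrable.of_bound (Measurable.aestronglyMeasurable (by fun_prop)) B ?_
    filter_upwards [hreal] with x hx using hB _ hx
  have hle : ∀ᵐ x ∂μ, llr μ m x ≤ δ := by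
    filter_upwards [hac.ae_le hreal, Measure.rnDeriv_pos hac, hac.ae_le (Measure.rnDeriv_lt_top μ m)]
      with x hx hpos hlt
    rw [llr, Real.log_le_iff_le_exp (ENNReal.toReal_pos hpos.ne' hlt.ne)]
    exact hx.2
  rw [InformationTheory.klDiv_of_ac_of_integrable hac hint]
  refine ENNReal.ofReal_le_ofReal ?_
  have := integral_mono_ae hint (integrable_const δ) hle
  simpa using this

/-! ### Images under Lipschitz maps of the cube -/

/-- For the sup norm, Lebesgue measure is `d`-dimensional Hausdorff measure, which a Lipschitz map
enlarges by at most the `d`-th power of its constant. -/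
lemma volume_image_le {d : ℕ} {χ : (Fin d → ℝ) → (Fin d → ℝ)} {L : ℝ≥0} {S : Set (Fin d → ℝ)}
    (h : LipschitzOnWith L χ S) : volume (χ '' S) ≤ (L : ℝ≥0∞) ^ d * volume S := by
  have := h.hausdorffMeasure_image_le (d := (Fintype.card (Fin d) : ℝ)) (by positivity)
  rw [hausdorffMeasure_pi_real] at this
  simpa using this

/-- Layer-cake reduction to `volume_image_le` on each superlevel set. -/
lemma setLIntegral_image_le {d : ℕ} {χ : (Fin d → ℝ) → (Fin d → ℝ)} {L : ℝ≥0}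
    {S : Set (Fin d → ℝ)} (hS : MeasurableSet S) (h : LipschitzOnWith L χ S) {g : (Fin d → ℝ) → ℝ}
    (hg : Measurable g) (hg0 : ∀ x, 0 ≤ g x) (hgχ : AEMeasurable (fun x => g (χ x))
      (volume.restrict S)) :
    ∫⁻ y in χ '' S, ENNReal.ofReal (g y) ≤ (L : ℝ≥0∞) ^ d * ∫⁻ x in S, ENNReal.ofReal (g (χ x)) := by
  rw [lintegral_eq_lintegral_meas_lt _ (Filter.Eventually.of_forall hg0) hg.aemeasurable,
    lintegral_eq_lintegral_meas_lt _ (Filter.Eventually.of_forall fun x => hg0 (χ x)) hgχ,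
    ← lintegral_const_mul' _ _ (by simp)]
  refine lintegral_mono fun t => ?_
  simp only
  rw [Measure.restrict_apply (measurableSet_lt measurable_const hg),
    Measure.restrict_apply' hS]
  have : {y | t < g y} ∩ χ '' S ⊆ χ '' ({x | t < g (χ x)} ∩ S) := by
    rintro _ ⟨hy, x, hx, rfl⟩
    exact ⟨x, ⟨hy, hx⟩, rfl⟩
  exact (measure_mono this).trans (volume_image_le (h.mono inter_subset_right))

/-! ### Lipschitz bounds and second differences -/

lemma exists_forall_fin_of_mono {n : ℕ} {P : Fin n → ℝ → Prop}
    (hmono : ∀ e C C', C ≤ C' → P e C → P e C') (h : ∀ e, ∃ C : ℝ, 0 < C ∧ P e C) :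
    ∃ C : ℝ, 0 < C ∧ ∀ e, P e C := by
  choose C hC hP using h
  refine ⟨1 + ∑ e, C e, by
    have := Finset.sum_nonneg fun e (_ : e ∈ Finset.univ) => (hC e).le
    linarith, fun e => hmono e _ _ ?_ (hP e)⟩
  have := Finset.single_le_sum (fun e _ => (hC e).le) (Finset.mem_univ e)
  linarith

variable {ι : Type*} {n m : ℕ}

lemma UniformCk.lipschitz_pi {F : Fin m → ι → (Fin n → ℝ) → ℝ} (hF : ∀ e, UniformCk 1 (F e)) :
    ∃ C : ℝ, 0 < C ∧ ∀ i, ∀ x ∈ cube n, ∀ y ∈ cube n,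
      ‖(fun e => F e i x) - fun e => F e i y‖ ≤ C * ‖x - y‖ := by
  obtain ⟨C, hC, h⟩ := exists_forall_fin_of_mono (P := fun e C => ∀ i, ∀ x ∈ cube n,
    ∀ y ∈ cube n, |F e i x - F e i y| ≤ C * ‖x - y‖) (fun e C C' hCC h i x hx y hy =>
      (h i x hx y hy).trans (mul_le_mul_of_nonneg_right hCC (norm_nonneg _)))
      fun e => (hF e).lipschitz
  exact ⟨C, hC, fun i x hx y hy => (pi_norm_le_iff_of_nonneg (by positivity)).2
    fun e => h e i x hx y hy⟩

/-- A substitute for comparing Jacobians: it controls how `F` acts on the difference of two nearly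
equal maps, without differentiating these maps. It comes from the difference of the derivatives of
`F` along the segments from `b` to `a` and from `b'` to `a'`. -/
lemma UniformCk.second_difference {F : ι → (Fin n → ℝ) → ℝ} (hF : UniformCk 2 F) :
    ∃ C : ℝ, 0 < C ∧ ∀ i, ∀ a ∈ cube n, ∀ b ∈ cube n, ∀ a' ∈ cube n, ∀ b' ∈ cube n,
      |(F i a - F i b) - (F i a' - F i b')| ≤
        C * (‖(a - b) - (a' - b')‖ + (‖a - a'‖ + ‖b - b'‖) * ‖a - b‖) := by
  obtain ⟨F', hF', hk⟩ := hF.exists_grad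
  obtain ⟨B, hB0, hB⟩ := UniformCk.bounded_fin hk
  obtain ⟨L, hL0, hL⟩ := exists_forall_fin_of_mono (P := fun e C => ∀ i, ∀ x ∈ cube n,
    ∀ y ∈ cube n, |F' e i x - F' e i y| ≤ C * ‖x - y‖) (fun e C C' hCC h i x hx y hy =>
      (h i x hx y hy).trans (mul_le_mul_of_nonneg_right hCC (norm_nonneg _)))
      fun e => (hk e).lipschitz
  refine ⟨n * B + n * L + 1, by positivity, fun i a ha b hb a' ha' b' hb' => ?_⟩
  have hseg : ∀ {p q : Fin n → ℝ}, p ∈ cube n → q ∈ cube n → ∀ s ∈ Icc (0 : ℝ) 1,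
      q + s • (p - q) ∈ cube n := fun hp hq s hs => by
    have := convex_cube n hp hq hs.1 (sub_nonneg.2 hs.2) (by ring)
    convert this using 1
    module
  have hd : ∀ {p q : Fin n → ℝ}, p ∈ cube n → q ∈ cube n → ∀ s ∈ Icc (0 : ℝ) 1,
      HasDerivWithinAt (fun s : ℝ => F i (q + s • (p - q)))
        (gradCLM (fun j => F' j i (q + s • (p - q))) (p - q)) (Icc 0 1) s := by
    intro p q hp hq s hs
    have h1 : HasDerivWithinAt (fun s : ℝ => q + s • (p - q)) (p - q) (Icc 0 1) s := by
      simpa using (((hasDerivAt_id s).smul_const (p - q)).const_add q).hasDerivWithinAt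
    exact (hF' i _ (hseg hp hq s hs)).comp_hasDerivWithinAt s h1 fun s hs => hseg hp hq s hs
  have key := norm_image_sub_le_of_norm_deriv_le_segment_01'
    (f := fun s : ℝ => F i (b + s • (a - b)) - F i (b' + s • (a' - b')))
    (C := (n * B + n * L + 1) * (‖(a - b) - (a' - b')‖ + (‖a - a'‖ + ‖b - b'‖) * ‖a - b‖))
    (fun s hs => (hd ha hb s hs).sub (hd ha' hb' s hs)) fun s hs => ?_
  · simp only [one_smul, add_sub_cancel, zero_smul, add_zero, Real.norm_eq_abs] at key
    refine le_trans (le_of_eq ?_) key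
    congr 1
    ring
  have hs' := Ico_subset_Icc_self hs
  set p := b + s • (a - b) with hp
  set q := b' + s • (a' - b') with hq
  have hpm : p ∈ cube n := hseg ha hb s hs'
  have hqm : q ∈ cube n := hseg ha' hb' s hs'
  have hpq : ‖p - q‖ ≤ ‖a - a'‖ + ‖b - b'‖ := by
    have : p - q = s • (a - a') + (1 - s) • (b - b') := by
      rw [hp, hq]
      module
    rw [this]
    refine (norm_add_le _ _).trans (add_le_add ?_ ?_)
    · rw [norm_smul, Real.norm_eq_abs, abs_of_nonneg hs'.1]
      exact mul_le_of_le_one_left (norm_nonneg _) hs'.2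
    · rw [norm_smul, Real.norm_eq_abs, abs_of_nonneg (sub_nonneg.2 hs'.2)]
      exact mul_le_of_le_one_left (norm_nonneg _) (by linarith [hs'.1])
  have e1 : gradCLM (fun j => F' j i p) (a - b) - gradCLM (fun j => F' j i q) (a' - b') =
      gradCLM (fun j => F' j i q) ((a - b) - (a' - b')) +
        gradCLM (fun j => F' j i p - F' j i q) (a - b) := by
    simp only [gradCLM_apply, ← Finset.sum_sub_distrib, ← Finset.sum_add_distrib]
    refine Finset.sum_congr rfl fun j _ => ?_
    simp only [Pi.sub_apply]
    ring
  rw [Real.norm_eq_abs, e1]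
  have h1 := abs_gradCLM_apply_le (fun j => hB j i q hqm) ((a - b) - (a' - b'))
  have h2 := abs_gradCLM_apply_le (c := fun j => F' j i p - F' j i q)
    (fun j => (hL j i p hpm q hqm).trans (mul_le_mul_of_nonneg_left hpq hL0.le)) (a - b)
  refine (abs_add_le _ _).trans ((add_le_add h1 h2).trans ?_)
  have hX := norm_nonneg ((a - b) - (a' - b'))
  have hY : 0 ≤ (‖a - a'‖ + ‖b - b'‖) * ‖a - b‖ := by positivity
  have hn : (0 : ℝ) ≤ n := Nat.cast_nonneg n
  nlinarith [mul_nonneg (mul_nonneg hn hL0.le) hX, mul_nonneg (mul_nonneg hn hB0.le) hY]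

lemma UniformCk.second_difference_pi {F : Fin m → ι → (Fin n → ℝ) → ℝ}
    (hF : ∀ e, UniformCk 2 (F e)) :
    ∃ C : ℝ, 0 < C ∧ ∀ i, ∀ a ∈ cube n, ∀ b ∈ cube n, ∀ a' ∈ cube n, ∀ b' ∈ cube n,
      ‖((fun e => F e i a) - fun e => F e i b) - ((fun e => F e i a') - fun e => F e i b')‖ ≤
        C * (‖(a - b) - (a' - b')‖ + (‖a - a'‖ + ‖b - b'‖) * ‖a - b‖) := by
  obtain ⟨C, hC, h⟩ := exists_forall_fin_of_mono (P := fun e C => ∀ i, ∀ a ∈ cube n, ∀ b ∈ cube n,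
    ∀ a' ∈ cube n, ∀ b' ∈ cube n, |(F e i a - F e i b) - (F e i a' - F e i b')| ≤
        C * (‖(a - b) - (a' - b')‖ + (‖a - a'‖ + ‖b - b'‖) * ‖a - b‖))
    (fun e C C' hCC h i a ha b hb a' ha' b' hb' =>
      (h i a ha b hb a' ha' b' hb').trans (mul_le_mul_of_nonneg_right hCC (by positivity)))
      fun e => (hF e).second_difference
  exact ⟨C, hC, fun i a ha b hb a' ha' b' hb' => (pi_norm_le_iff_of_nonneg (by positivity)).2
    fun e => h e i a ha b hb a' ha' b' hb'⟩

/-! ### Stability of the flow and of the model distribution -/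

section Stability

variable {d : ℕ} {κ 𝒦 : ℝ} {Fν Fμ : ι → (Fin d → ℝ) → ℝ}

/-- The field `w` is tangent to the faces of the cube and `ε`-close to `u` in the Lipschitz norm. -/
structure IsCloseField (ε : ℝ) (u w : (Fin d → ℝ) → ℝ → (Fin d → ℝ)) : Prop where
  cont : ∀ x ∈ cube d, ContinuousOn (w x) (Icc 0 1)
  tangent : ∀ x ∈ cube d, ∀ t ∈ Icc (0 : ℝ) 1, ∀ i, x i = 0 ∨ x i = 1 → w x t i = 0
  close : ∀ x ∈ cube d, ∀ t ∈ Icc (0 : ℝ) 1, ‖w x t - u x t‖ ≤ ε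
  lip : ∀ x ∈ cube d, ∀ y ∈ cube d, ∀ t ∈ Icc (0 : ℝ) 1,
    ‖(w x t - u x t) - (w y t - u y t)‖ ≤ ε * ‖x - y‖

lemma hasDerivWithinAt_displacement (fν fμ : (Fin d → ℝ) → ℝ) (x : Fin d → ℝ) (t : ℝ) :
    HasDerivWithinAt (fun t => displacement fν fμ t x) (krMap fν fμ x - x) (Icc 0 1) t := by
  have h1 := (hasDerivAt_id t).smul_const (krMap fν fμ x)
  have h2 := ((hasDerivAt_id t).const_sub 1).smul_const x
  refine ((h1.add h2).congr_deriv ?_).hasDerivWithinAt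
  simp [sub_eq_add_neg]

/-- Grönwall is applied to `y - I`, for the distance of the flow from `T`, and then to `(y - I) -
(y' - I')`, for the Lipschitz constant of that difference. The a priori bound `ε ≤ R` makes the
Lipschitz constant of `w` independent of `ε`. -/
lemma flowEndpoint_close_krMap (hν : UniformCk 2 Fν)
    (hμ : UniformCk 2 Fμ) (hdν : ∀ i, IsCubeDensity κ 𝒦 (Fν i))
    (hdμ : ∀ i, IsCubeDensity κ 𝒦 (Fμ i)) (hκ : 0 < κ) (h𝒦 : 0 < 𝒦) {R : ℝ} (hR : 0 < R) :
    ∃ K C : ℝ, 0 < K ∧ 0 < C ∧ ∀ i ε w, 0 ≤ ε → ε ≤ R →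
      IsCloseField ε (targetField (Fν i) (Fμ i)) w → IsTangentField K w ∧
      (∀ x ∈ cube d, ‖flowEndpoint w x - krMap (Fν i) (Fμ i) x‖ ≤ C * ε) ∧
      ∀ x ∈ cube d, ∀ x' ∈ cube d,
        ‖(flowEndpoint w x - krMap (Fν i) (Fμ i) x) -
          (flowEndpoint w x' - krMap (Fν i) (Fμ i) x')‖ ≤ C * ε * ‖x - x'‖ := by
  -- Time becomes part of the index, so that every constant below is uniform in `t`.
  have hu : ∀ e, UniformCk 2 fun (p : ι × Icc (0 : ℝ) 1) x =>
      targetField (Fν p.1) (Fμ p.1) x p.2 e := by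
    intro e
    have h1 := ((UniformCk.targetST hν hμ hdν hdμ hκ h𝒦 e)).reindex
      (fun p : ι × Icc (0 : ℝ) 1 => p.1)
    refine (UniformCk.comp (H := fun j p x => (Fin.snoc x (p.2 : ℝ) : Fin (d + 1) → ℝ) j) h1
      (fun j => ?_) fun p x hx => snoc_mem_cube hx p.2.2).congr fun p x _ => ?_
    · refine Fin.lastCases ?_ (fun j => ?_) j
      · simp only [Fin.snoc_last]
        exact UniformCk.const_of_bounded _ (B := 1) fun p => by
          rw [abs_of_nonneg p.2.2.1]
          exact p.2.2.2
      · simpa only [Fin.snoc_castSucc] using UniformCk.coord j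
    · simp [targetST]
  obtain ⟨Lu, hLu0, hLu⟩ := UniformCk.lipschitz_pi fun e => (hu e).of_succ
  obtain ⟨Cu, hCu0, hCu⟩ := UniformCk.second_difference_pi hu
  obtain ⟨LT, hLT0, hLT⟩ := UniformCk.lipschitz_pi fun e =>
    (UniformCk.krMap hν hμ hdν hdμ hκ h𝒦 e).of_succ
  have hK0 : 0 < Lu + R := by positivity
  -- The forcing of the second Grönwall estimate: the first term bounds the Lipschitz defect of `w -
  -- u` between two flow lines, the second the quadratic term of the second difference of `u`.
  set D := Real.exp (Lu + R) + (Cu * (Real.exp (Lu + R) + (LT + 1))) * Real.exp Lu with hD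
  have hD0 : 0 < D := by positivity
  refine ⟨Lu + R, Real.exp Lu + D * Real.exp Cu, hK0, by positivity,
    fun i ε w hε hεR hw => ?_⟩
  set u := targetField (Fν i) (Fμ i) with hudef
  have hLu' : ∀ t ∈ Icc (0 : ℝ) 1, ∀ x ∈ cube d, ∀ y ∈ cube d, ‖u x t - u y t‖ ≤ Lu * ‖x - y‖ :=
    fun t ht x hx y hy => hLu (i, ⟨t, ht⟩) x hx y hy
  have hT : IsTangentField (Lu + R) w := by
    refine ⟨fun t ht x hx y hy => ?_, hw.cont, hw.tangent⟩
    have e1 : w x t - w y t = ((w x t - u x t) - (w y t - u y t)) + (u x t - u y t) := by abel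
    rw [e1]
    refine (norm_add_le _ _).trans ((add_le_add (hw.lip x hx y hy t ht) (hLu' t ht x hx y hy)).trans ?_)
    nlinarith [norm_nonneg (x - y)]
  have hIm : ∀ x ∈ cube d, ∀ t ∈ Icc (0 : ℝ) 1, displacement (Fν i) (Fμ i) t x ∈ cube d :=
    fun x hx t ht => displacement_mem_cube (hdν i) (hdμ i) hx ht
  have hvel : ∀ x ∈ cube d, ∀ t ∈ Icc (0 : ℝ) 1,
      HasDerivWithinAt (fun t => displacement (Fν i) (Fμ i) t x)
        (u (displacement (Fν i) (Fμ i) t x) t) (Icc 0 1) t := by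
    intro x hx t ht
    rw [hudef, targetField_displacement (hdν i) (hdμ i) hx ht]
    exact hasDerivWithinAt_displacement _ _ x t
  have hclose : ∀ x ∈ cube d, ∀ y, IsFlowLine w x y → ∀ t ∈ Icc (0 : ℝ) 1,
      ‖y t - displacement (Fν i) (Fμ i) t x‖ ≤ ε * Real.exp Lu := by
    intro x hx y hy t ht
    have := norm_le_of_hasDerivWithinAt (E := fun t => y t - displacement (Fν i) (Fμ i) t x)
      hLu0 hε (fun t ht => (hy.2 t ht).2.sub (hvel x hx t ht)) (fun t ht => ?_) ht
    · simpa [hy.1, displacement_zero] using this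
    · have e1 : w (y t) t - u (displacement (Fν i) (Fμ i) t x) t = (w (y t) t - u (y t) t) +
          (u (y t) t - u (displacement (Fν i) (Fμ i) t x) t) := by abel
      rw [e1, add_comm (Lu * _)]
      exact (norm_add_le _ _).trans (add_le_add (hw.close _ (hy.2 t ht).1 t ht)
        (hLu' t ht _ (hy.2 t ht).1 _ (hIm x hx t ht)))
  refine ⟨hT, fun x hx => ?_, fun x hx x' hx' => ?_⟩
  · obtain ⟨y, hy⟩ := hT.exists_isFlowLine hK0.le hx
    rw [hT.flowEndpoint_eq hK0 hy, ← displacement_one]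
    refine (hclose x hx y hy 1 (by simp)).trans ?_
    have : 0 ≤ D * Real.exp Cu * ε := by positivity
    linarith
  obtain ⟨y, hy⟩ := hT.exists_isFlowLine hK0.le hx
  obtain ⟨y', hy'⟩ := hT.exists_isFlowLine hK0.le hx'
  rw [hT.flowEndpoint_eq hK0 hy, hT.flowEndpoint_eq hK0 hy', ← displacement_one, ← displacement_one]
  have hI : ∀ t ∈ Icc (0 : ℝ) 1, ‖displacement (Fν i) (Fμ i) t x - displacement (Fν i) (Fμ i) t x'‖
      ≤ (LT + 1) * ‖x - x'‖ := by
    intro t ht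
    have e1 : displacement (Fν i) (Fμ i) t x - displacement (Fν i) (Fμ i) t x' =
        t • (krMap (Fν i) (Fμ i) x - krMap (Fν i) (Fμ i) x') + (1 - t) • (x - x') := by
      rw [displacement, displacement]
      module
    have h1 : ‖krMap (Fν i) (Fμ i) x - krMap (Fν i) (Fμ i) x'‖ ≤ LT * ‖x - x'‖ :=
      hLT i x hx x' hx'
    rw [e1, add_mul]
    refine (norm_add_le _ _).trans (add_le_add ?_ ?_)
    · rw [norm_smul, Real.norm_eq_abs, abs_of_nonneg ht.1]
      exact (mul_le_of_le_one_left (norm_nonneg _) ht.2).trans h1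
    · rw [norm_smul, Real.norm_eq_abs, abs_of_nonneg (sub_nonneg.2 ht.2)]
      exact mul_le_mul_of_nonneg_right (by linarith [ht.1]) (norm_nonneg _)
  have key := norm_le_of_hasDerivWithinAt (E := fun t => (y t - displacement (Fν i) (Fμ i) t x) -
    (y' t - displacement (Fν i) (Fμ i) t x')) (K := Cu) (ε := D * ε * ‖x - x'‖) hCu0
    (by positivity) (fun t ht => ((hy.2 t ht).2.sub (hvel x hx t ht)).sub
      ((hy'.2 t ht).2.sub (hvel x' hx' t ht))) (fun t ht => ?_) (t := 1) (by simp)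
  · simp only [hy.1, hy'.1, displacement_zero, sub_self, norm_zero, zero_add] at key
    refine key.trans ?_
    have : 0 ≤ Real.exp Lu * ε * ‖x - x'‖ := by positivity
    nlinarith
  have hym := (hy.2 t ht).1
  have hym' := (hy'.2 t ht).1
  set I := displacement (Fν i) (Fμ i) t x
  set I' := displacement (Fν i) (Fμ i) t x'
  have hyy := hT.norm_flowLine_sub_le hK0 hy hy' ht
  have h1 := hw.lip _ hym _ hym' t ht
  have h2 : ‖(u (y t) t - u I t) - (u (y' t) t - u I' t)‖ ≤ Cu * (‖(y t - I) - (y' t - I')‖ +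
      (‖y t - y' t‖ + ‖I - I'‖) * ‖y t - I‖) :=
    hCu (i, ⟨t, ht⟩) _ hym _ (hIm x hx t ht) _ hym' _ (hIm x' hx' t ht)
  -- Split into the error field `w - u` at two points of the perturbed flow, and a second difference
  -- of `u` alone.
  have e1 : w (y t) t - u I t - (w (y' t) t - u I' t) = ((w (y t) t - u (y t) t) -
      (w (y' t) t - u (y' t) t)) + ((u (y t) t - u I t) - (u (y' t) t - u I' t)) := by abel
  rw [e1]
  refine (norm_add_le _ _).trans ((add_le_add h1 h2).trans ?_)
  have h3 : (‖y t - y' t‖ + ‖I - I'‖) * ‖y t - I‖ ≤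
      (‖x - x'‖ * Real.exp (Lu + R) + (LT + 1) * ‖x - x'‖) * (ε * Real.exp Lu) :=
    mul_le_mul (add_le_add hyy (hI t ht)) (hclose x hx y hy t ht) (norm_nonneg _) (by positivity)
  have h4 := mul_le_mul_of_nonneg_left h3 hCu0.le
  have h5 := mul_le_mul_of_nonneg_left hyy hε
  rw [hD]
  nlinarith

/-- With `S = T⁻¹` and `χ = S ∘ Φ`, the set `T⁻¹ A` is contained in the `χ`-image of `Φ⁻¹ A`. Since
`χ` is nearly an isometry and nearly the identity, and the source density is Lipschitz and bounded
below, `ν` gains only a factor `1 + O(ε)`. -/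
lemma klDiv_map_flowEndpoint_le (M : ℝ≥0) (hνk : ∀ i, ckNorm 2 (Fν i) ≤ M)
    (hμk : ∀ i, ckNorm 2 (Fμ i) ≤ M) (hdν : ∀ i, IsCubeDensity κ 𝒦 (Fν i))
    (hdμ : ∀ i, IsCubeDensity κ 𝒦 (Fμ i)) (hκ : 0 < κ) (h𝒦 : 0 < 𝒦) {R : ℝ} (hR : 0 < R) :
    ∃ C : ℝ, 0 < C ∧ ∀ i ε w, 0 ≤ ε → ε ≤ R →
      IsCloseField ε (targetField (Fν i) (Fμ i)) w → ∀ ν μ : Measure (Fin d → ℝ),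
      IsProbabilityMeasure ν → IsProbabilityMeasure μ →
      ν = (volume.restrict (cube d)).withDensity (fun x => ENNReal.ofReal (Fν i x)) →
      μ = (volume.restrict (cube d)).withDensity (fun x => ENNReal.ofReal (Fμ i x)) →
      InformationTheory.klDiv μ (ν.map (flowEndpoint w)) ≤ ENNReal.ofReal (C * ε) := by
  have hν : UniformCk 2 Fν := UniformCk.of_ckNorm_le hνk
  have hμ : UniformCk 2 Fμ := UniformCk.of_ckNorm_le hμk
  obtain ⟨K, C₀, hK, hC₀, hflow⟩ := flowEndpoint_close_krMap hν hμ hdν hdμ hκ h𝒦 hR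
  have hS := fun e => UniformCk.krInv hν hμ hdν hdμ hκ h𝒦 e
  obtain ⟨LS, hLS0, hLS⟩ := UniformCk.lipschitz_pi fun e => (hS e).of_succ
  obtain ⟨CS, hCS0, hCS⟩ := UniformCk.second_difference_pi hS
  obtain ⟨LT, hLT0, hLT⟩ := UniformCk.lipschitz_pi fun e =>
    (UniformCk.krMap hν hμ hdν hdμ hκ h𝒦 e).of_succ
  obtain ⟨Lf, hLf0, hLf⟩ := hν.of_succ.lipschitz
  set C₁ := CS * (C₀ + (Real.exp K + LT) * C₀) with hC₁
  set C₂ := Lf * (LS * C₀) / κ with hC₂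
  have hC₁0 : 0 < C₁ := by positivity
  have hC₂0 : 0 < C₂ := by positivity
  refine ⟨d * C₁ + C₂, by positivity, fun i ε w hε hεR hw ν μ hνp hμp hνd hμd => ?_⟩
  obtain ⟨hT, hΦ, hΦ'⟩ := hflow i ε w hε hεR hw
  set T := krMap (Fν i) (Fμ i)
  set Φ := flowEndpoint w
  set S : (Fin d → ℝ) → (Fin d → ℝ) := fun y => displacementInv (Fν i) (Fμ i) y 1
  have hTm : ∀ x ∈ cube d, T x ∈ cube d := fun x hx => krMap_mem_cube (hdν i) (hdμ i) hx
  have hΦm : ∀ x ∈ cube d, Φ x ∈ cube d := fun x hx => hT.flowEndpoint_mem hK hx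
  have hSm : ∀ y ∈ cube d, S y ∈ cube d := fun y hy =>
    displacementInv_mem (hdν i) (hdμ i) hy (by simp)
  have hST : ∀ x ∈ cube d, S (T x) = x := fun x hx => by
    have := displacementInv_displacement (hdν i) (hdμ i) hx (t := 1) (by simp)
    rwa [displacement_one] at this
  have hχclose : ∀ x ∈ cube d, ‖S (Φ x) - x‖ ≤ LS * (C₀ * ε) := fun x hx => by
    have h1 : ‖S (Φ x) - S (T x)‖ ≤ LS * ‖Φ x - T x‖ := hLS i _ (hΦm x hx) _ (hTm x hx)
    rw [hST x hx] at h1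
    exact h1.trans (mul_le_mul_of_nonneg_left (hΦ x hx) hLS0.le)
  -- As `S ∘ T` is the identity, `χ - id` is `S ∘ Φ - S ∘ T`, to which the second-difference bound
  -- for `S` applies.
  have hχlip : ∀ x ∈ cube d, ∀ x' ∈ cube d,
      ‖S (Φ x) - S (Φ x')‖ ≤ (1 + C₁ * ε) * ‖x - x'‖ := by
    intro x hx x' hx'
    have h1 : ‖(S (Φ x) - S (T x)) - (S (Φ x') - S (T x'))‖ ≤
        CS * (‖(Φ x - T x) - (Φ x' - T x')‖ + (‖Φ x - Φ x'‖ + ‖T x - T x'‖) * ‖Φ x - T x‖) :=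
      hCS i _ (hΦm x hx) _ (hTm x hx) _ (hΦm x' hx') _ (hTm x' hx')
    rw [hST x hx, hST x' hx'] at h1
    have h2 := hΦ' x hx x' hx'
    have h3 := hT.norm_flowEndpoint_sub_le hK hx hx'
    have h4 : ‖T x - T x'‖ ≤ LT * ‖x - x'‖ := hLT i x hx x' hx'
    have h5 : (‖Φ x - Φ x'‖ + ‖T x - T x'‖) * ‖Φ x - T x‖ ≤
        (‖x - x'‖ * Real.exp K + LT * ‖x - x'‖) * (C₀ * ε) :=
      mul_le_mul (add_le_add h3 h4) (hΦ x hx) (norm_nonneg _) (by positivity)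
    have h6 := mul_le_mul_of_nonneg_left (add_le_add h2 h5) hCS0.le
    have e1 : S (Φ x) - S (Φ x') = ((S (Φ x) - x) - (S (Φ x') - x')) + (x - x') := by abel
    rw [e1]
    refine (norm_add_le _ _).trans ((add_le_add (h1.trans h6) le_rfl).trans (le_of_eq ?_))
    rw [hC₁]
    ring
  have hratio : ∀ x ∈ cube d, Fν i (S (Φ x)) ≤ (1 + C₂ * ε) * Fν i x := by
    intro x hx
    have h1 := hLf i _ (hSm _ (hΦm x hx)) x hx
    have h2 := h1.trans (mul_le_mul_of_nonneg_left (hχclose x hx) hLf0.le)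
    have h3 := (le_abs_self _).trans h2
    have h4 : Lf * (LS * (C₀ * ε)) = C₂ * ε * κ := by
      rw [hC₂]
      field_simp
    have h5 : C₂ * ε * κ ≤ C₂ * ε * Fν i x :=
      mul_le_mul_of_nonneg_left ((hdν i).lower x hx) (by positivity)
    linarith
  let L : ℝ≥0 := ⟨1 + C₁ * ε, by positivity⟩
  have hχL : LipschitzOnWith L (fun x => S (Φ x)) (cube d) :=
    LipschitzOnWith.of_dist_le_mul fun x hx x' hx' => by
      rw [dist_eq_norm, dist_eq_norm]
      exact hχlip x hx x' hx'
  have hΦmeas : Measurable Φ := hT.measurable_flowEndpoint hK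
  have : IsProbabilityMeasure (ν.map Φ) := Measure.isProbabilityMeasure_map hΦmeas.aemeasurable
  refine klDiv_le_of_le_smul fun A hA => ?_
  set B := Φ ⁻¹' A ∩ cube d with hB
  have hBm : MeasurableSet B := (hΦmeas hA).inter (measurableSet_cube d)
  have hμA : μ A = ∫⁻ y in A ∩ cube d, ENNReal.ofReal (Fμ i y) := by
    rw [hμd, withDensity_apply _ hA, Measure.restrict_restrict hA]
  have hνB : ν.map Φ A = ∫⁻ x in B, ENNReal.ofReal (Fν i x) := by
    rw [Measure.map_apply hΦmeas hA, hνd, withDensity_apply _ (hΦmeas hA),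
      Measure.restrict_restrict (hΦmeas hA)]
  -- Surjectivity of `Φ` enters here: a preimage `x'` of `T x` under `Φ` satisfies `χ x' = x`.
  have hsub : cube d ∩ T ⁻¹' A ⊆ (fun x => S (Φ x)) '' B := by
    rintro x ⟨hx, hxA⟩
    obtain ⟨x', hx', he⟩ := hT.exists_flowEndpoint_eq hK (hTm x hx)
    refine ⟨x', ⟨?_, hx'⟩, ?_⟩
    · rw [mem_preimage, show Φ x' = T x from he]
      exact hxA
    · change S (Φ x') = x
      rw [show Φ x' = T x from he]
      exact hST x hx
  set g := (cube d).indicator (Fν i) with hg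
  have hgm : Measurable g := by
    classical
    rw [hg, ← piecewise_eq_indicator]
    exact (hdν i).cont.measurable_piecewise continuousOn_const (measurableSet_cube d)
  have hg0 : ∀ x, 0 ≤ g x := fun x =>
    indicator_nonneg (fun x hx => hκ.le.trans ((hdν i).lower x hx)) x
  have hgeq : ∀ x ∈ cube d, g x = Fν i x := fun x hx => indicator_of_mem hx _
  have hgχ : AEMeasurable (fun x => g (S (Φ x))) (volume.restrict B) := by
    have hc : ContinuousOn (fun x => g (S (Φ x))) B :=
      ((hdν i).cont.comp (hχL.continuousOn.mono inter_subset_right)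
        fun x hx => hSm _ (hΦm x hx.2)).congr fun x hx => hgeq _ (hSm _ (hΦm x hx.2))
    exact hc.aemeasurable hBm
  rw [hμA, setLIntegral_krMap (k := 1) (hdν i) (hdμ i) (hνk i) (hμk i) hA, hνB]
  calc ∫⁻ x in cube d ∩ T ⁻¹' A, ENNReal.ofReal (Fν i x)
      ≤ ∫⁻ x in cube d ∩ T ⁻¹' A, ENNReal.ofReal (g x) := by
        refine setLIntegral_mono' (measurableSet_cube_inter_preimage
          (continuousOn_krMap (hdν i) (hdμ i)) hA) fun x hx => ?_
        rw [hgeq x hx.1]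
    _ ≤ ∫⁻ x in (fun x => S (Φ x)) '' B, ENNReal.ofReal (g x) :=
        lintegral_mono_set hsub
    _ ≤ (L : ℝ≥0∞) ^ d * ∫⁻ x in B, ENNReal.ofReal (g (S (Φ x))) :=
        setLIntegral_image_le hBm (hχL.mono inter_subset_right) hgm hg0 hgχ
    _ ≤ (L : ℝ≥0∞) ^ d * ∫⁻ x in B, ENNReal.ofReal (1 + C₂ * ε) * ENNReal.ofReal (Fν i x) := by
        refine mul_le_mul' le_rfl (setLIntegral_mono' hBm fun x hx => ?_)
        rw [← ENNReal.ofReal_mul (by positivity), hgeq _ (hSm _ (hΦm x hx.2))]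
        exact ENNReal.ofReal_le_ofReal (hratio x hx.2)
    _ = ENNReal.ofReal ((1 + C₁ * ε) ^ d * (1 + C₂ * ε)) * ∫⁻ x in B, ENNReal.ofReal (Fν i x) := by
        rw [lintegral_const_mul' _ _ ENNReal.ofReal_ne_top, ← mul_assoc,
          ENNReal.ofReal_mul (by positivity), ENNReal.ofReal_pow (by positivity)]
        congr 3
        exact (ENNReal.ofReal_eq_coe_nnreal _).symm
    _ ≤ _ := by
        gcongr
        have h1 : 1 + C₁ * ε ≤ Real.exp (C₁ * ε) := by linarith [Real.add_one_le_exp (C₁ * ε)]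
        have h2 : 1 + C₂ * ε ≤ Real.exp (C₂ * ε) := by linarith [Real.add_one_le_exp (C₂ * ε)]
        rw [show (d * C₁ + C₂) * ε = d * (C₁ * ε) + C₂ * ε by ring, Real.exp_add, Real.exp_nat_mul]
        gcongr

end Stability

/-! ### Gradients on the cube -/

lemma gradCLM_congr {n : ℕ} {A : (Fin n → ℝ) →L[ℝ] ℝ} {c : Fin n → ℝ}
    (h : ∀ l, A (Pi.single l 1) = c l) : A = gradCLM c := by
  rw [eq_gradCLM A]
  exact congrArg _ (funext h)

/-- The function `f` on the cube is differentiable at `z` with gradient `g`. -/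
def HasGrad {n : ℕ} (f : (Fin n → ℝ) → ℝ) (g : Fin n → ℝ) (z : Fin n → ℝ) : Prop :=
  HasFDerivWithinAt f (gradCLM g) (cube n) z

namespace HasGrad

variable {n : ℕ} {f h : (Fin n → ℝ) → ℝ} {g g' z : Fin n → ℝ}

lemma of_eq (hf : HasGrad f g z) (hg : ∀ l, g l = g' l) : HasGrad f g' z := by
  rwa [← funext hg]

lemma congr_fun (hf : HasGrad f g z) (hz : z ∈ cube n) (hfh : ∀ y ∈ cube n, h y = f y) :
    HasGrad h g z :=
  HasFDerivWithinAt.congr hf hfh (hfh z hz)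

lemma unique (hz : z ∈ cube n) (hf : HasGrad f g z) (hf' : HasGrad f g' z) : g = g' :=
  hasFDerivWithinAt_cube_unique hz hf hf'

lemma const (c : ℝ) : HasGrad (fun _ => c) (fun _ => 0) z :=
  (hasFDerivWithinAt_const c z (cube n)).congr_fderiv (gradCLM_congr fun l => by simp)

lemma add (hf : HasGrad f g z) (hh : HasGrad h g' z) :
    HasGrad (fun z => f z + h z) (fun l => g l + g' l) z :=
  (HasFDerivWithinAt.add hf hh).congr_fderiv (gradCLM_congr fun l => by
    rw [add_apply, gradCLM_single, gradCLM_single])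

lemma sub (hf : HasGrad f g z) (hh : HasGrad h g' z) :
    HasGrad (fun z => f z - h z) (fun l => g l - g' l) z :=
  (HasFDerivWithinAt.sub hf hh).congr_fderiv (gradCLM_congr fun l => by
    rw [sub_apply, gradCLM_single, gradCLM_single])

lemma mul (hf : HasGrad f g z) (hh : HasGrad h g' z) :
    HasGrad (fun z => f z * h z) (fun l => g l * h z + f z * g' l) z :=
  (HasFDerivWithinAt.mul hf hh).congr_fderiv (gradCLM_congr fun l => by
    rw [add_apply, smul_apply, smul_apply, gradCLM_single, gradCLM_single, smul_eq_mul,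
      smul_eq_mul]
    ring)

lemma const_mul (c : ℝ) (hf : HasGrad f g z) : HasGrad (fun z => c * f z) (fun l => c * g l) z :=
  ((const c).mul hf).of_eq fun l => by ring

lemma sum {β : Type*} (s : Finset β) {f : β → (Fin n → ℝ) → ℝ} {g : β → Fin n → ℝ}
    (hf : ∀ b ∈ s, HasGrad (f b) (g b) z) :
    HasGrad (fun z => ∑ b ∈ s, f b z) (fun l => ∑ b ∈ s, g b l) z :=
  (HasFDerivWithinAt.fun_sum hf).congr_fderiv (gradCLM_congr fun l => by
    rw [_root_.sum_apply]
    exact Finset.sum_congr rfl fun b _ => gradCLM_single _ _)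

lemma of_coord (j : Fin n) {φ : ℝ → ℝ} {φ' : ℝ} (hφ : HasDerivAt φ φ' (z j)) :
    HasGrad (fun z => φ (z j)) (fun l => if l = j then φ' else 0) z := by
  have h1 : HasFDerivWithinAt (fun z : Fin n → ℝ => z j)
      (ContinuousLinearMap.proj (R := ℝ) (φ := fun _ : Fin n => ℝ) j) (cube n) z :=
    (ContinuousLinearMap.proj (R := ℝ) (φ := fun _ : Fin n => ℝ) j).hasFDerivWithinAt
  refine (hφ.comp_hasFDerivWithinAt z h1).congr_fderiv (gradCLM_congr fun l => ?_)
  rw [smul_apply, ContinuousLinearMap.proj_apply, Pi.single_apply, smul_eq_mul, mul_ite, mul_one,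
    mul_zero]
  simp only [eq_comm]

lemma prod_coord {φ : Fin n → ℝ → ℝ} {φ' : Fin n → ℝ} (hφ : ∀ j, HasDerivAt (φ j) (φ' j) (z j)) :
    HasGrad (fun z => ∏ j, φ j (z j)) (fun l => φ' l * ∏ j ∈ Finset.univ.erase l, φ j (z j)) z := by
  refine ((HasFDerivWithinAt.finsetProd (u := Finset.univ) fun j _ => of_coord j (hφ j)).congr_fderiv
    (gradCLM_congr fun l => ?_)).congr (fun y _ => by simp) (by simp)
  rw [_root_.sum_apply, Finset.sum_eq_single l]
  · rw [smul_apply, gradCLM_single, if_pos rfl, smul_eq_mul, mul_comm]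
  · intro j _ hj
    rw [smul_apply, gradCLM_single, if_neg hj.symm, smul_zero]
  · simp

lemma comp_update (e : Fin n) (p : ℝ) (hp : p ∈ Icc (0 : ℝ) 1)
    (hf : HasGrad f g (Function.update z e p)) :
    HasGrad (fun z => f (Function.update z e p)) (fun l => if l = e then 0 else g l) z := by
  have h1 : HasFDerivWithinAt (fun z : Fin n → ℝ => Function.update z e p)
      (ContinuousLinearMap.pi fun j => if j = e then 0 else
        ContinuousLinearMap.proj (R := ℝ) (φ := fun _ : Fin n => ℝ) j) (cube n) z := by
    rw [hasFDerivWithinAt_pi']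
    intro j
    rcases eq_or_ne j e with rfl | hj
    · simpa using hasFDerivWithinAt_const p z (cube n)
    · simp only [Function.update_of_ne hj]
      refine ((ContinuousLinearMap.proj (R := ℝ) (φ := fun _ : Fin n => ℝ)
        j).hasFDerivWithinAt).congr_fderiv ?_
      ext v
      simp [hj]
  have hf' : HasFDerivWithinAt f (gradCLM g) (cube n) (Function.update z e p) := hf
  refine (hf'.comp z h1 fun y hy =>
    update_mem_cube hy e hp).congr_fderiv (gradCLM_congr fun l => ?_)
  rw [ContinuousLinearMap.comp_apply, gradCLM_apply]
  rcases eq_or_ne l e with rfl | hl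
  · rw [if_pos rfl]
    refine Finset.sum_eq_zero fun j _ => ?_
    rcases eq_or_ne j l with rfl | hj
    · simp
    · simp [hj]
  · rw [if_neg hl, Finset.sum_eq_single l]
    · simp [hl]
    · intro j _ hj
      rcases eq_or_ne j e with rfl | hj'
      · simp
      · simp [hj', hj]
    · simp

end HasGrad

lemma hasDerivWithinAt_line {n : ℕ} {f : (Fin n → ℝ) → ℝ} {g a z : Fin n → ℝ} (ha : a ∈ cube n)
    (hz : z ∈ cube n) {s : ℝ} (hf : HasGrad f g (a + s • (z - a))) :
    HasDerivWithinAt (fun s => f (a + s • (z - a))) (∑ j, g j * (z j - a j)) (Icc 0 1) s := by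
  have h1 : HasDerivWithinAt (fun s : ℝ => a + s • (z - a)) (z - a) (Icc 0 1) s := by
    simpa using (((hasDerivAt_id s).smul_const (z - a)).const_add a).hasDerivWithinAt
  have hf' : HasFDerivWithinAt f (gradCLM g) (cube n) (a + s • (z - a)) := hf
  refine (hf'.comp_hasDerivWithinAt s h1 fun t ht =>
    (convex_cube n).add_smul_sub_mem ha hz ht).congr_deriv ?_
  rw [gradCLM_apply]
  rfl

/-- Symmetry of second derivatives. -/
lemma second_grad_symm {n : ℕ} {f : (Fin n → ℝ) → ℝ} {f' : Fin n → (Fin n → ℝ) → ℝ}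
    {f'' : Fin n → Fin n → ℝ} (hf : ∀ x ∈ cube n, HasGrad f (fun j => f' j x) x)
    {z : Fin n → ℝ} (hz : z ∈ cube n) (hf' : ∀ j, HasGrad (f' j) (f'' j) z) (j l : Fin n) :
    f'' j l = f'' l j := by
  let A : (Fin n → ℝ) →L[ℝ] ((Fin n → ℝ) →L[ℝ] ℝ) :=
    ∑ j, (gradCLM (f'' j)).smulRight
      (ContinuousLinearMap.proj (R := ℝ) (φ := fun _ : Fin n => ℝ) j)
  have hA : ∀ v w, A v w = ∑ j, gradCLM (f'' j) v * w j := fun v w => by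
    simp [A, _root_.sum_apply]
  have h1 : HasFDerivWithinAt (fun x => gradCLM fun j => f' j x) A (cube n) z := by
    unfold gradCLM
    refine HasFDerivWithinAt.fun_sum fun j _ => ?_
    have h2 : HasFDerivWithinAt (f' j) (gradCLM (f'' j)) (cube n) z := hf' j
    exact h2.smul_const (ContinuousLinearMap.proj (R := ℝ) (φ := fun _ : Fin n => ℝ) j)
  have := (convex_cube n).second_derivative_within_at_symmetric (interior_cube_nonempty n)
    (f := f) (f' := fun x => gradCLM fun j => f' j x) (f'' := A)
    (fun x hx => (hf x (interior_subset hx)).hasFDerivAt (mem_interior_iff_mem_nhds.1 hx)) hz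
    (h1.mono interior_subset) (Pi.single l 1) (Pi.single j 1)
  rw [hA, hA, Finset.sum_eq_single j, Finset.sum_eq_single l] at this
  · simpa [gradCLM_single] using this
  · intro b _ hb
    simp [hb]
  · simp
  · intro b _ hb
    simp [hb]
  · simp

/-! ### Monomials -/

/-- The monomial `y^α`. -/
def mono {n : ℕ} (α : Fin n → ℕ) (y : Fin n → ℝ) : ℝ := ∏ j, y j ^ α j

/-- The partial derivatives of a monomial. -/
def dmono {n : ℕ} (l : Fin n) (α : Fin n → ℕ) (y : Fin n → ℝ) : ℝ :=
  α l * y l ^ (α l - 1) * ∏ j ∈ Finset.univ.erase l, y j ^ α j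

section Mono

variable {n : ℕ}

lemma hasGrad_mono (α : Fin n → ℕ) (a z : Fin n → ℝ) :
    HasGrad (fun z => mono α (z - a)) (fun l => dmono l α (z - a)) z := by
  refine HasGrad.prod_coord (φ := fun j t => (t - a j) ^ α j)
    (φ' := fun j => α j * (z j - a j) ^ (α j - 1)) fun j => ?_
  exact (((hasDerivAt_id (z j)).sub_const (a j)).fun_pow (α j)).congr_deriv (by simp)

lemma mono_zero (y : Fin n → ℝ) : mono 0 y = 1 := by simp [mono]

lemma dmono_zero (l : Fin n) (y : Fin n → ℝ) : dmono l 0 y = 0 := by simp [dmono]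

lemma mono_smul (α : Fin n → ℕ) (s : ℝ) (y : Fin n → ℝ) :
    mono α (s • y) = s ^ (∑ j, α j) * mono α y := by
  simp [mono, mul_pow, Finset.prod_mul_distrib, Finset.prod_pow_eq_pow_sum]

lemma mul_dmono_smul (l : Fin n) (α : Fin n → ℕ) (s : ℝ) (y : Fin n → ℝ) :
    s * dmono l α (s • y) = s ^ (∑ j, α j) * dmono l α y := by
  rcases Nat.eq_zero_or_pos (α l) with h | h
  · simp [dmono, h]
  · simp only [dmono, Pi.smul_apply, smul_eq_mul, mul_pow, Finset.prod_mul_distrib,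
      Finset.prod_pow_eq_pow_sum]
    rw [← Finset.add_sum_erase _ _ (Finset.mem_univ l), pow_add]
    have : s ^ α l = s ^ (α l - 1) * s := by rw [← pow_succ, Nat.sub_add_cancel h]
    rw [this]
    ring

lemma mono_add_single_pow (α : Fin n → ℕ) (j : Fin n) (m : ℕ) (y : Fin n → ℝ) :
    mono (α + Pi.single j m) y = y j ^ m * mono α y := by
  simp only [mono, Pi.add_apply, pow_add, Finset.prod_mul_distrib]
  rw [mul_comm]
  congr 1
  rw [Finset.prod_eq_single j]
  · simp
  · intro b _ hb
    simp [hb]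
  · simp

lemma mono_add_single (α : Fin n → ℕ) (j : Fin n) (y : Fin n → ℝ) :
    mono (α + Pi.single j 1) y = y j * mono α y := by
  rw [mono_add_single_pow, pow_one]

lemma dmono_add_single (l : Fin n) (α : Fin n → ℕ) (j : Fin n) (y : Fin n → ℝ) :
    dmono l (α + Pi.single j 1) y = (if l = j then mono α y else 0) + y j * dmono l α y := by
  have h1 := hasGrad_mono (α + Pi.single j 1) (-y) 0
  have h2 := (HasGrad.of_coord j (((hasDerivAt_id ((0 : Fin n → ℝ) j)).sub_const (-y j)))).mul
    (hasGrad_mono α (-y) 0)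
  have := congrFun (HasGrad.unique (zero_mem_cube n) h1
    (h2.congr_fun (zero_mem_cube n) fun x _ => by
      rw [mono_add_single]
      rfl)) l
  simp only [sub_neg_eq_add, zero_add, ite_mul, one_mul, zero_mul] at this
  simpa using this

lemma mono_eq_zero {α : Fin n → ℕ} {j : Fin n} (h : 0 < α j) {y : Fin n → ℝ} (hy : y j = 0) :
    mono α y = 0 :=
  Finset.prod_eq_zero (Finset.mem_univ j) (by rw [hy, zero_pow h.ne'])

end Mono

/-! ### Taylor polynomials -/

/-- The multi-indices of the Taylor polynomial whose gradient is the given one. -/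
def taylorExp {n : ℕ} {Γ : Type} (α : Γ → Fin n → ℕ) : Option (Fin n × Γ) → Fin n → ℕ
  | none => 0
  | some p => α p.2 + Pi.single p.1 1

/-- The coefficients of the Taylor polynomial whose gradient is the given one. -/
def taylorCoef {n : ℕ} {Γ : Type} (α : Γ → Fin n → ℕ) (c : ℝ) (q : Fin n → Γ → ℝ) : Option (Fin n × Γ) → ℝ
  | none => c
  | some p => q p.1 p.2 / ((∑ j, α p.2 j : ℕ) + 1)

lemma sum_taylorExp_some {n : ℕ} {Γ : Type} (α : Γ → Fin n → ℕ) (p : Fin n × Γ) :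
    ∑ j, taylorExp α (some p) j = (∑ j, α p.2 j) + 1 := by
  simp [taylorExp, Finset.sum_add_distrib]

/-- `∑ γ, q γ (z - a)^(α γ)` approximates `f` near `a` to order `k + 1` at `z`, and so do the first
derivatives to order `k`. -/
def TaylorClose {n : ℕ} {Γ : Type} [Fintype Γ] (α : Γ → Fin n → ℕ) (k : ℕ) (C : ℝ)
    (f : (Fin n → ℝ) → ℝ) (q : Γ → ℝ) (a z : Fin n → ℝ) : Prop :=
  |f z - ∑ γ, q γ * mono (α γ) (z - a)| ≤ C * ‖z - a‖ ^ (k + 1) ∧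
  ∃ g, HasGrad (fun z => f z - ∑ γ, q γ * mono (α γ) (z - a)) g z ∧
    ∀ l, |g l| ≤ C * ‖z - a‖ ^ k

section Taylor

variable {n : ℕ} {Γ : Type} [Fintype Γ] {α : Γ → Fin n → ℕ} {k : ℕ} {C : ℝ}

lemma TaylorClose.mono {f : (Fin n → ℝ) → ℝ} {q : Γ → ℝ} {a z : Fin n → ℝ} {C' : ℝ}
    (h : TaylorClose α k C f q a z) (hC : C ≤ C') : TaylorClose α k C' f q a z := by
  obtain ⟨h1, g, h2, h3⟩ := h
  exact ⟨h1.trans (by gcongr), g, h2, fun l => (h3 l).trans (by gcongr)⟩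

/-- The factor `s` makes the polynomial part homogeneous of degree `|α| + 1` in `s`, so
differentiation cancels the denominators in `taylorCoef`. What remains is the error of the `l`-th
approximant plus `s` times gradient errors of all approximants; symmetry of second derivatives
matches the indices. -/
lemma hasDerivWithinAt_scaled_error {f : (Fin n → ℝ) → ℝ} {f' : Fin n → (Fin n → ℝ) → ℝ}
    {f'' : Fin n → Fin n → (Fin n → ℝ) → ℝ} {q : Fin n → Γ → ℝ} {a z : Fin n → ℝ}
    (ha : a ∈ cube n) (hz : z ∈ cube n)
    (hf : ∀ x ∈ cube n, HasGrad f (fun j => f' j x) x)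
    (hf' : ∀ j, ∀ x ∈ cube n, HasGrad (f' j) (fun l => f'' j l x) x)
    (hq : ∀ j, ∀ x ∈ cube n, TaylorClose α k C (f' j) (q j) a x) (hC : 0 ≤ C)
    (l : Fin n) {s : ℝ} (hs : s ∈ Icc (0 : ℝ) 1) :
    ∃ D, HasDerivWithinAt (fun s => s * f' l (a + s • (z - a)) - ∑ p : Fin n × Γ,
        taylorCoef α (f a) q (some p) *
          (s ^ (∑ j, taylorExp α (some p) j) * dmono l (taylorExp α (some p)) (z - a)))
      D (Icc 0 1) s ∧ ‖D‖ ≤ (n + 1) * C * ‖z - a‖ ^ (k + 1) := by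
  set y := z - a with hy
  have hx : a + s • y ∈ cube n := (convex_cube n).add_smul_sub_mem ha hz hs
  have hxa : a + s • y - a = s • y := by simp
  have hnorm : ‖a + s • y - a‖ ≤ ‖y‖ := by
    rw [hxa, norm_smul, Real.norm_eq_abs, abs_of_nonneg hs.1]
    nlinarith [norm_nonneg y, hs.2]
  choose hq1 g hg hgb using fun j => hq j _ hx
  have hgeq : ∀ j, g j l = f'' l j (a + s • y) - ∑ γ, q j γ * dmono l (α γ) (s • y) := by
    intro j
    have h1 := (hf' j _ hx).sub (HasGrad.sum Finset.univ fun γ _ =>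
      (hasGrad_mono (α γ) a (a + s • y)).const_mul (q j γ))
    have h2 := congrFun ((hg j).unique hx h1) l
    rw [h2, second_grad_symm hf hx (fun j => hf' j _ hx) l j, hxa]
  have h1 := (hasDerivAt_id s).hasDerivWithinAt.mul (hasDerivWithinAt_line ha hz (hf' l _ hx))
  have h2 : HasDerivWithinAt (fun s : ℝ => ∑ p : Fin n × Γ, taylorCoef α (f a) q (some p) *
      (s ^ (∑ j, taylorExp α (some p) j) * dmono l (taylorExp α (some p)) y))
      (∑ p : Fin n × Γ, q p.1 p.2 * (s ^ (∑ j, α p.2 j) * dmono l (taylorExp α (some p)) y))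
      (Icc 0 1) s := by
    refine HasDerivWithinAt.fun_sum fun p _ => ?_
    refine ((((hasDerivAt_pow _ s).mul_const _).const_mul _).hasDerivWithinAt).congr_deriv ?_
    rw [sum_taylorExp_some, Nat.add_sub_cancel]
    have : ((∑ j, α p.2 j : ℕ) : ℝ) + 1 ≠ 0 := by positivity
    simp only [taylorCoef]
    push_cast at this ⊢
    field_simp
  have h3 : ∑ p : Fin n × Γ, q p.1 p.2 * (s ^ (∑ j, α p.2 j) * dmono l (taylorExp α (some p)) y)
      = ∑ γ, q l γ * LtI.mono (α γ) (s • y)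
        + s * ∑ j, (∑ γ, q j γ * dmono l (α γ) (s • y)) * y j := by
    have : ∀ p : Fin n × Γ,
        q p.1 p.2 * (s ^ (∑ j, α p.2 j) * dmono l (taylorExp α (some p)) y) =
          (if l = p.1 then q p.1 p.2 * LtI.mono (α p.2) (s • y) else 0)
            + s * (q p.1 p.2 * dmono l (α p.2) (s • y) * y p.1) := by
      intro p
      rw [show taylorExp α (some p) = α p.2 + Pi.single p.1 1 from rfl, dmono_add_single]
      have h := mul_dmono_smul l (α p.2) s y
      split_ifs
      · rw [mono_smul]
        linear_combination -(q p.1 p.2 * y p.1) * h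
      · linear_combination -(q p.1 p.2 * y p.1) * h
    rw [Finset.sum_congr rfl fun p _ => this p, Finset.sum_add_distrib, Fintype.sum_prod_type,
      ← Finset.mul_sum, Fintype.sum_prod_type]
    refine congrArg₂ (· + ·) ?_ (congrArg _ ?_)
    · rw [Finset.sum_eq_single l]
      · simp
      · intro j _ hj
        simp [hj.symm]
      · simp
    · simp only [Finset.sum_mul]
  refine ⟨_, h1.sub h2, ?_⟩
  rw [h3]
  have h4 : 1 * f' l (a + s • (z - a)) + id s * ∑ j, f'' l j (a + s • y) * (z j - a j) -
      (∑ γ, q l γ * LtI.mono (α γ) (s • y)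
        + s * ∑ j, (∑ γ, q j γ * dmono l (α γ) (s • y)) * y j) =
      (f' l (a + s • y) - ∑ γ, q l γ * LtI.mono (α γ) (a + s • y - a)) +
        s * ∑ j, g j l * y j := by
    simp only [hgeq, sub_mul, Finset.sum_sub_distrib, hxa, id]
    rw [show z - a = y from rfl]
    have : ∀ j, z j - a j = y j := fun j => rfl
    simp only [this]
    ring
  rw [h4, Real.norm_eq_abs]
  have h5 := (hq1 l).trans (mul_le_mul_of_nonneg_left
    (pow_le_pow_left₀ (norm_nonneg _) hnorm (k + 1)) hC)
  have h6 : |∑ j, g j l * y j| ≤ n * C * ‖y‖ ^ (k + 1) := by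
    refine (Finset.abs_sum_le_sum_abs _ _).trans ?_
    calc ∑ j, |g j l * y j| ≤ ∑ _j : Fin n, C * ‖y‖ ^ (k + 1) := by
          refine Finset.sum_le_sum fun j _ => ?_
          rw [abs_mul, pow_succ, ← mul_assoc]
          exact mul_le_mul ((hgb j l).trans (mul_le_mul_of_nonneg_left
            (pow_le_pow_left₀ (norm_nonneg _) hnorm k) hC)) (norm_le_pi_norm y j) (abs_nonneg _)
            (by positivity)
      _ = n * C * ‖y‖ ^ (k + 1) := by simp [mul_assoc]
  have h7 : |s * ∑ j, g j l * y j| ≤ n * C * ‖y‖ ^ (k + 1) := by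
    rw [abs_mul, abs_of_nonneg hs.1]
    nlinarith [abs_nonneg (∑ j, g j l * y j), hs.2]
  calc _ ≤ _ := abs_add_le _ _
    _ ≤ C * ‖y‖ ^ (k + 1) + n * C * ‖y‖ ^ (k + 1) := add_le_add h5 h7
    _ = _ := by ring

/-- Radial integration: the approximants of the partial derivatives need not form a gradient, but
the polynomial with coefficients `taylorCoef` has nearly these partial derivatives. The error of its
gradient is the value at `s = 1` of a function that vanishes at `s = 0`; the error itself vanishes
at `a`. -/
lemma TaylorClose.succ {f : (Fin n → ℝ) → ℝ} {f' : Fin n → (Fin n → ℝ) → ℝ}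
    {f'' : Fin n → Fin n → (Fin n → ℝ) → ℝ} {q : Fin n → Γ → ℝ} {a z : Fin n → ℝ}
    (ha : a ∈ cube n) (hz : z ∈ cube n)
    (hf : ∀ x ∈ cube n, HasGrad f (fun j => f' j x) x)
    (hf' : ∀ j, ∀ x ∈ cube n, HasGrad (f' j) (fun l => f'' j l x) x)
    (hq : ∀ j, ∀ x ∈ cube n, TaylorClose α k C (f' j) (q j) a x) (hC : 0 ≤ C) :
    TaylorClose (taylorExp α) (k + 1) ((n + 1) * ((n + 1) * C)) f (taylorCoef α (f a) q) a z := by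
  set E : (Fin n → ℝ) → ℝ := fun z => f z - ∑ γ, taylorCoef α (f a) q γ *
    LtI.mono (taylorExp α γ) (z - a) with hE
  set g : Fin n → (Fin n → ℝ) → ℝ := fun l z => f' l z - ∑ p : Fin n × Γ,
    taylorCoef α (f a) q (some p) * dmono l (taylorExp α (some p)) (z - a) with hg
  have hEg : ∀ x ∈ cube n, HasGrad E (fun l => g l x) x := by
    intro x hx
    refine ((hf x hx).sub (HasGrad.sum Finset.univ fun γ _ =>
      (hasGrad_mono (taylorExp α γ) a x).const_mul _)).of_eq fun l => ?_
    simp [hg, Fintype.sum_option, taylorExp, dmono_zero]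
  have hgb : ∀ l, ∀ x ∈ cube n, |g l x| ≤ (n + 1) * C * ‖x - a‖ ^ (k + 1) := by
    intro l x hx
    choose D hD hDb using fun (s : Icc (0 : ℝ) 1) =>
      hasDerivWithinAt_scaled_error ha hx hf hf' hq hC l s.2
    have := norm_image_sub_le_of_norm_deriv_le_segment'
      (f' := fun s => if hs : s ∈ Icc (0 : ℝ) 1 then D ⟨s, hs⟩ else 0)
      (fun s hs => by simpa only [dif_pos hs] using hD ⟨s, hs⟩)
      (fun s hs => by
        have h := hDb (Subtype.mk s (Ico_subset_Icc_self hs))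
        simpa only [dif_pos (Ico_subset_Icc_self hs)] using h) 1 (right_mem_Icc.2 zero_le_one)
    simpa [hg, sum_taylorExp_some] using this
  have hEa : E a = 0 := by
    have : ∀ p : Fin n × Γ, LtI.mono (taylorExp α (some p)) (a - a) = 0 := fun p =>
      mono_eq_zero (j := p.1) (by simp [taylorExp]) (by simp)
    simp only [hE, Fintype.sum_option, this]
    simp [taylorExp, mono_zero, taylorCoef]
  have hconst : (n + 1) * C * ‖z - a‖ ^ (k + 1) ≤ (n + 1) * ((n + 1) * C) * ‖z - a‖ ^ (k + 1) := by
    have : (0 : ℝ) ≤ n * ((n + 1) * C * ‖z - a‖ ^ (k + 1)) := by positivity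
    nlinarith
  refine ⟨?_, fun l => g l z, hEg z hz, fun l => (hgb l z hz).trans hconst⟩
  -- On this ball the gradient bound at `x` is dominated by the bound at scale `‖z - a‖`.
  have hconv : Convex ℝ (cube n ∩ Metric.closedBall a ‖z - a‖) :=
    (convex_cube n).inter (convex_closedBall a _)
  have h1 := abs_sub_le_of_hasFDerivWithinAt_gradCLM hconv
    (B := (n + 1) * C * ‖z - a‖ ^ (k + 1)) (f := E) (f' := g) (by positivity)
    (fun x hx => HasFDerivWithinAt.mono (hEg x hx.1) inter_subset_left)
    (fun l x hx => (hgb l x hx.1).trans (by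
      have := hx.2
      rw [mem_closedBall_iff_norm] at this
      gcongr))
    (x := z) (y := a) (mem_inter hz (by simp [dist_eq_norm])) (mem_inter ha (by simp))
  rw [hEa, sub_zero] at h1
  refine h1.trans ?_
  rw [pow_succ _ (k + 1)]
  have : (0 : ℝ) ≤ ((n + 1) * C * ‖z - a‖ ^ (k + 1)) * ‖z - a‖ := by positivity
  nlinarith

end Taylor

lemma taylorClose_zero {n : ℕ} {f : (Fin n → ℝ) → ℝ} {f' : Fin n → (Fin n → ℝ) → ℝ} {B : ℝ}
    (hB : 0 ≤ B) (hf : ∀ x ∈ cube n, HasGrad f (fun j => f' j x) x)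
    (hb : ∀ j, ∀ x ∈ cube n, |f' j x| ≤ B) {a z : Fin n → ℝ} (ha : a ∈ cube n) (hz : z ∈ cube n) :
    TaylorClose (fun _ : Unit => (0 : Fin n → ℕ)) 0 ((n + 1) * B) f (fun _ => f a) a z := by
  have h1 := abs_sub_le_of_hasFDerivWithinAt_gradCLM (convex_cube n) hB hf hb hz ha
  simp only [TaylorClose, mono_zero, Finset.univ_unique, Finset.sum_singleton, mul_one, zero_add,
    pow_one, pow_zero]
  refine ⟨h1.trans ?_, fun j => f' j z, ((hf z hz).sub (HasGrad.const _)).of_eq fun l => by simp,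
    fun l => (hb l z hz).trans (by nlinarith [n.cast_nonneg (α := ℝ)])⟩
  nlinarith [mul_nonneg hB (norm_nonneg (z - a))]

/-- Taylor approximation with uniform constants, for families of functions. -/
theorem exists_taylorClose (ι : Type*) (n k : ℕ) :
    ∃ (Γ : Type) (_ : Fintype Γ) (α : Γ → Fin n → ℕ), (∀ γ, ∑ j, α γ j ≤ k) ∧
      ∀ F : ι → (Fin n → ℝ) → ℝ, UniformCk (k + 1) F → ∃ B C : ℝ, 0 < B ∧ 0 < C ∧
        ∃ q : ι → (Fin n → ℝ) → Γ → ℝ, (∀ i, ∀ a ∈ cube n, ∀ γ, |q i a γ| ≤ B) ∧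
          ∀ i, ∀ a ∈ cube n, ∀ z ∈ cube n, TaylorClose α k C (F i) (q i a) a z := by
  induction k with
  | zero =>
    refine ⟨Unit, inferInstance, fun _ => 0, by simp, fun F hF => ?_⟩
    obtain ⟨F', hF', hk⟩ := hF.exists_grad
    obtain ⟨B, hB0, hB⟩ := UniformCk.bounded_fin hk
    obtain ⟨B', hB'0, hB'⟩ := hF.bounded
    exact ⟨B', (n + 1) * B, hB'0, by positivity, fun i a _ => F i a, fun i a ha _ => hB' i a ha,
      fun i a ha z hz => taylorClose_zero (f' := fun j => F' j i) hB0.le (hF' i)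
        (fun j => hB j i) ha hz⟩
  | succ k ih =>
    obtain ⟨Γ, _, α, hα, h⟩ := ih
    refine ⟨Option (Fin n × Γ), inferInstance, taylorExp α, ?_, fun F hF => ?_⟩
    · rintro (_ | p)
      · simp [taylorExp]
      · rw [sum_taylorExp_some]
        have := hα p.2
        omega
    obtain ⟨F', hF', hk⟩ := hF.exists_grad
    choose F'' hF'' hk'' using fun j => (hk j).exists_grad
    choose B C hB hC q hq1 hq2 using fun j => h (F' j) (hk j)
    obtain ⟨B', hB'0, hB'⟩ := hF.bounded
    have hle : ∀ (A : Fin n → ℝ), (∀ j, 0 < A j) → ∀ j, A j ≤ ∑ j, A j := fun A hA j =>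
      Finset.single_le_sum (fun j _ => (hA j).le) (Finset.mem_univ j)
    have hs : ∀ (A : Fin n → ℝ), (∀ j, 0 < A j) → 0 ≤ ∑ j, A j := fun A hA =>
      Finset.sum_nonneg fun j _ => (hA j).le
    have hsC := hs C hC
    have hsB := hs B hB
    refine ⟨B' + ∑ j, B j, (n + 1) * ((n + 1) * (1 + ∑ j, C j)), by positivity, by positivity,
      fun i a => taylorCoef α (F i a) fun j => q j i a, ?_, fun i a ha z hz => ?_⟩
    · rintro i a ha (_ | p)
      · exact (hB' i a ha).trans (by simpa using hsB)
      · have h1 : |q p.1 i a p.2| ≤ B' + ∑ j, B j :=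
          (hq1 p.1 i a ha p.2).trans ((hle B hB p.1).trans (by simpa using hB'0.le))
        simp only [taylorCoef]
        rw [abs_div]
        refine (div_le_self (abs_nonneg _) ?_).trans h1
        rw [abs_of_nonneg (by positivity)]
        exact le_add_of_nonneg_left (Nat.cast_nonneg _)
    · exact TaylorClose.succ (f' := fun j => F' j i) (f'' := fun j l => F'' j l i) ha hz (hF' i)
        (fun j => hF'' j i) (fun j x hx => (hq2 j i a ha x hx).mono (by
          have := hle C hC j
          linarith)) (by positivity)

/-! ### Polynomial approximation with a linear factor -/

section Mask

variable {n : ℕ} {Γ : Type}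

lemma mono_update (α : Fin n → ℕ) (e : Fin n) (a z : Fin n → ℝ) (p : ℝ) :
    (z e - a e) ^ α e * mono α (Function.update z e p - a)
      = (p - a e) ^ α e * mono α (z - a) := by
  rw [mono, mono, ← Finset.mul_prod_erase _ _ (Finset.mem_univ e),
    ← Finset.mul_prod_erase _ _ (Finset.mem_univ e)]
  have : ∏ j ∈ Finset.univ.erase e, (Function.update z e p - a) j ^ α j
      = ∏ j ∈ Finset.univ.erase e, (z - a) j ^ α j :=
    Finset.prod_congr rfl fun j hj => by simp [(Finset.mem_erase.1 hj).1]
  rw [this]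
  simp
  ring

/-- The exponents of the quotient of a corrected Taylor polynomial by a linear factor. -/
def maskExp (k : ℕ) (α : Γ → Fin n → ℕ) (e : Fin n) (γ : Γ × Fin (k + 1)) : Fin n → ℕ :=
  α γ.1 + Pi.single e (γ.2 : ℕ)

/-- The coefficients of the quotient of a corrected Taylor polynomial by the factor `p - z e`. -/
def maskCoef (k : ℕ) (α : Γ → Fin n → ℕ) (e : Fin n) (p a : ℝ) (q : Γ → ℝ)
    (γ : Γ × Fin (k + 1)) : ℝ :=
  if (γ.2 : ℕ) < k + 1 - α γ.1 e then q γ.1 / (p - a) ^ ((γ.2 : ℕ) + 1) else 0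

lemma abs_maskCoef_le {k : ℕ} {α : Γ → Fin n → ℕ} {e : Fin n} {p a : ℝ} {q : Γ → ℝ}
    {γ : Γ × Fin (k + 1)} {B N : ℝ} (hB : ∀ γ, |q γ| ≤ B) (hN : 1 ≤ N) (ha : 1 / N ≤ |p - a|) :
    |maskCoef k α e p a q γ| ≤ B * N ^ (k + 1) := by
  have hB0 : 0 ≤ B := (abs_nonneg _).trans (hB γ.1)
  have hN0 : 0 < N := by linarith
  unfold maskCoef
  split_ifs
  · rw [abs_div, abs_pow, div_eq_mul_inv]
    have h1 : (|p - a| ^ ((γ.2 : ℕ) + 1))⁻¹ ≤ N ^ (k + 1) := by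
      calc (|p - a| ^ ((γ.2 : ℕ) + 1))⁻¹ ≤ ((1 / N) ^ ((γ.2 : ℕ) + 1))⁻¹ := by gcongr
        _ = N ^ ((γ.2 : ℕ) + 1) := by rw [one_div, inv_pow, inv_inv]
        _ ≤ N ^ (k + 1) := pow_le_pow_right₀ hN (by have := γ.2.2; omega)
    exact mul_le_mul (hB _) h1 (by positivity) hB0
  · rw [abs_zero]
    positivity

lemma sum_fin_ite_lt {m K : ℕ} (h : m ≤ K) (f : ℕ → ℝ) :
    ∑ j : Fin K, (if (j : ℕ) < m then f j else 0) = ∑ j ∈ Finset.range m, f j := by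
  rw [Fin.sum_univ_eq_sum_range (fun j => if j < m then f j else 0) K, ← Finset.sum_filter]
  refine Finset.sum_congr ?_ fun _ _ => rfl
  ext j
  simp only [Finset.mem_filter, Finset.mem_range]
  omega

variable [Fintype Γ] {k : ℕ} {α : Γ → Fin n → ℕ} {e : Fin n} {p : ℝ}

/-- Let `w = (z e - a e) / (p - a e)`, which is `1` on the face `z e = p`. Subtracting `w ^ (k + 1)`
times the face values leaves each monomial multiplied by `1 - w ^ (k + 1 - α e)`, a geometric sum
divisible by `1 - w`, that is, by `p - z e`. -/
lemma mul_sum_maskCoef (hα : ∀ γ, α γ e ≤ k) (q : Γ → ℝ) (a z : Fin n → ℝ) (hp : p - a e ≠ 0) :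
    (p - z e) * ∑ γ, maskCoef k α e p (a e) q γ * mono (maskExp k α e γ) (z - a) =
      ∑ γ, q γ * mono (α γ) (z - a) - ((z e - a e) / (p - a e)) ^ (k + 1) *
        ∑ γ, q γ * mono (α γ) (Function.update z e p - a) := by
  rw [Fintype.sum_prod_type, Finset.mul_sum, Finset.mul_sum, ← Finset.sum_sub_distrib]
  refine Finset.sum_congr rfl fun γ _ => ?_
  set w := (z e - a e) / (p - a e) with hw
  have hw' : z e - a e = w * (p - a e) := by rw [hw]; field_simp
  have h1 : ∑ j : Fin (k + 1), maskCoef k α e p (a e) q (γ, j) *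
      mono (maskExp k α e (γ, j)) (z - a) = q γ * mono (α γ) (z - a) * ((p - a e)⁻¹ *
        ∑ j ∈ Finset.range (k + 1 - α γ e), w ^ j) := by
    rw [← sum_fin_ite_lt (Nat.sub_le _ _) (fun j => w ^ j), Finset.mul_sum, Finset.mul_sum]
    refine Finset.sum_congr rfl fun j _ => ?_
    simp only [maskCoef, maskExp, mono_add_single_pow, Pi.sub_apply]
    split_ifs
    · rw [hw', pow_succ, mul_pow]
      field_simp
    · simp
  have h2 := mul_neg_geom_sum w (k + 1 - α γ e)
  have h3 : (p - z e) * (p - a e)⁻¹ = 1 - w := by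
    rw [hw]
    field_simp
    ring
  have h4 : w ^ (k + 1 - α γ e) * mono (α γ) (z - a) =
      w ^ (k + 1) * mono (α γ) (Function.update z e p - a) := by
    have h5 := mono_update (α γ) e a z p
    rw [hw', mul_pow] at h5
    have h6 : w ^ (k + 1) = w ^ (k + 1 - α γ e) * w ^ α γ e := by
      rw [← pow_add]
      congr 1
      have := hα γ
      omega
    have h7 : (p - a e) ^ α γ e ≠ 0 := pow_ne_zero _ hp
    refine mul_left_cancel₀ h7 ?_
    rw [h6]
    linear_combination -(w ^ (k + 1 - α γ e)) * h5
  rw [h1]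
  linear_combination (q γ * mono (α γ) (z - a) * ∑ j ∈ Finset.range (k + 1 - α γ e), w ^ j) * h3
    + q γ * mono (α γ) (z - a) * h2 - q γ * h4

/-- Since `f` vanishes on the face, the Taylor polynomial there is minus the Taylor error, so the
correction is `w ^ (k + 1)` times an error. With `δ = |p - a e|` and `r = ‖z - a‖`, the bounds `|w|
≤ r / δ` and `(2δ) ^ (k + 1)` combine so that `δ` cancels and the order in `r` is kept. -/
lemma exists_grad_mask {C : ℝ} (hC : 0 ≤ C) (hα : ∀ γ, α γ e ≤ k) {f : (Fin n → ℝ) → ℝ} {q : Γ → ℝ}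
    {a : Fin n → ℝ} (hp : p ∈ Icc (0 : ℝ) 1) (hpa : p - a e ≠ 0)
    (hf : ∀ z ∈ cube n, TaylorClose α k C f q a z) (h0 : ∀ z ∈ cube n, z e = p → f z = 0) :
    ∃ g : (Fin n → ℝ) → Fin n → ℝ, ∀ z ∈ cube n,
      HasGrad (fun z => f z - (p - z e) *
        ∑ γ, maskCoef k α e p (a e) q γ * mono (maskExp k α e γ) (z - a)) (g z) z ∧
      (‖z - a‖ ≤ 2 * |p - a e| →
        |f z - (p - z e) * ∑ γ, maskCoef k α e p (a e) q γ * mono (maskExp k α e γ) (z - a)|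
            ≤ C * (1 + (k + 2) * 2 ^ (k + 1)) * ‖z - a‖ ^ (k + 1) ∧
        ∀ l, |g z l| ≤ C * (1 + (k + 2) * 2 ^ (k + 1)) * ‖z - a‖ ^ k) := by
  set E : (Fin n → ℝ) → ℝ := fun z => f z - ∑ γ, q γ * mono (α γ) (z - a) with hE
  set w : ℝ → ℝ := fun t => (t - a e) / (p - a e) with hw
  have hupd : ∀ z ∈ cube n, Function.update z e p ∈ cube n := fun z hz => update_mem_cube hz e hp
  have heq : ∀ z ∈ cube n, f z - (p - z e) * ∑ γ, maskCoef k α e p (a e) q γ *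
      mono (maskExp k α e γ) (z - a) = E z - w (z e) ^ (k + 1) * E (Function.update z e p) := by
    intro z hz
    rw [mul_sum_maskCoef hα q a z hpa]
    simp only [hE, h0 _ (hupd z hz) (Function.update_self e p z), hw]
    ring
  choose! hE1 g hg hgb using hf
  have hwd : ∀ t, HasDerivAt (fun t => w t ^ (k + 1))
      ((k + 1 : ℕ) * w t ^ k * (p - a e)⁻¹) t := by
    intro t
    have h1 : HasDerivAt w ((p - a e)⁻¹) t := by
      simpa using ((hasDerivAt_id t).sub_const (a e)).div_const (p - a e)
    simpa using h1.fun_pow (k + 1)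
  refine ⟨fun z l => g z l - ((if l = e then (k + 1 : ℕ) * w (z e) ^ k * (p - a e)⁻¹ else 0) *
    E (Function.update z e p) + w (z e) ^ (k + 1) *
      (if l = e then 0 else g (Function.update z e p) l)), fun z hz => ⟨?_, fun hza => ?_⟩⟩
  · refine HasGrad.congr_fun ?_ hz heq
    exact (hg z hz).sub ((HasGrad.of_coord e (hwd (z e))).mul
      (HasGrad.comp_update e p hp (hg _ (hupd z hz))))
  set δ := |p - a e| with hδ
  have hδ0 : 0 < δ := abs_pos.2 hpa
  set r := ‖z - a‖ with hr
  have hr0 : 0 ≤ r := norm_nonneg _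
  -- The projection to the face stays at distance at most `2δ` from `a`; this is where `r ≤ 2δ` is
  -- used.
  have hnu : ‖Function.update z e p - a‖ ≤ 2 * δ := by
    rw [pi_norm_le_iff_of_nonneg (by positivity)]
    intro j
    rcases eq_or_ne j e with rfl | hj
    · rw [Pi.sub_apply, Function.update_self, Real.norm_eq_abs]
      linarith
    · rw [Pi.sub_apply, Function.update_of_ne hj]
      exact (norm_le_pi_norm (z - a) j).trans hza
  have hwb : |w (z e)| ≤ r / δ := by
    simp only [hw]
    rw [abs_div]
    gcongr
    exact norm_le_pi_norm (z - a) e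
  have hEu : |E (Function.update z e p)| ≤ C * (2 * δ) ^ (k + 1) :=
    (hE1 _ (hupd z hz)).trans (by gcongr)
  have hgu : ∀ l, |g (Function.update z e p) l| ≤ C * (2 * δ) ^ k := fun l =>
    (hgb _ (hupd z hz) l).trans (by gcongr)
  have hpow : (0 : ℝ) < 2 ^ (k + 1) := by positivity
  refine ⟨?_, fun l => ?_⟩
  · rw [heq z hz]
    have h1 : |w (z e) ^ (k + 1) * E (Function.update z e p)| ≤ C * 2 ^ (k + 1) * r ^ (k + 1) := by
      rw [abs_mul, abs_pow]
      calc |w (z e)| ^ (k + 1) * |E (Function.update z e p)|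
          ≤ (r / δ) ^ (k + 1) * (C * (2 * δ) ^ (k + 1)) := by gcongr
        _ = _ := by rw [div_pow, mul_pow]; field_simp
    have h2 := hE1 z hz
    have h3 : 0 ≤ C * ((k + 1) * 2 ^ (k + 1)) * r ^ (k + 1) := by positivity
    calc _ ≤ |E z| + |w (z e) ^ (k + 1) * E (Function.update z e p)| := abs_sub _ _
      _ ≤ C * r ^ (k + 1) + C * 2 ^ (k + 1) * r ^ (k + 1) := add_le_add h2 h1
      _ ≤ C * r ^ (k + 1) + C * 2 ^ (k + 1) * r ^ (k + 1)
          + C * ((k + 1) * 2 ^ (k + 1)) * r ^ (k + 1) := by linarith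
      _ = _ := by ring
  · have h2 := hgb z hz l
    have h1 : |(if l = e then (k + 1 : ℕ) * w (z e) ^ k * (p - a e)⁻¹ else 0) *
        E (Function.update z e p)| ≤ C * ((k + 1) * 2 ^ (k + 1)) * r ^ k := by
      split_ifs
      · rw [abs_mul, abs_mul, abs_mul, abs_pow, abs_inv, Nat.abs_cast, ← hδ]
        calc ((k + 1 : ℕ) : ℝ) * |w (z e)| ^ k * δ⁻¹ * |E (Function.update z e p)|
            ≤ (k + 1 : ℕ) * (r / δ) ^ k * δ⁻¹ * (C * (2 * δ) ^ (k + 1)) := by gcongr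
          _ = _ := by
            rw [div_pow, mul_pow, pow_succ δ]
            push_cast
            field_simp
      · rw [zero_mul, abs_zero]
        positivity
    have h3 : |w (z e) ^ (k + 1) * (if l = e then 0 else g (Function.update z e p) l)|
        ≤ C * 2 ^ (k + 1) * r ^ k := by
      have h4 : |(if l = e then 0 else g (Function.update z e p) l)| ≤ C * (2 * δ) ^ k := by
        split_ifs
        · rw [abs_zero]
          positivity
        · exact hgu l
      rw [abs_mul, abs_pow]
      calc |w (z e)| ^ (k + 1) * _ ≤ (r / δ) ^ (k + 1) * (C * (2 * δ) ^ k) := by gcongr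
        _ = C * 2 ^ k * r ^ k * (r / δ) := by
          rw [pow_succ, div_pow, mul_pow]
          field_simp
        _ ≤ C * 2 ^ k * r ^ k * 2 := by
          gcongr
          rwa [div_le_iff₀ hδ0]
        _ = _ := by ring
    calc _ ≤ |g z l| + (_ + _) := (abs_sub _ _).trans (add_le_add le_rfl (abs_add_le _ _))
      _ ≤ C * r ^ k + (C * ((k + 1) * 2 ^ (k + 1)) * r ^ k + C * 2 ^ (k + 1) * r ^ k) :=
          add_le_add h2 (add_le_add h1 h3)
      _ = _ := by ring

end Mask

/-! ### A piecewise quadratic partition of unity -/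

/-- The activation `ReLU²`. -/
def requ (r : ℝ) : ℝ := max r 0 ^ 2

lemma requ_of_nonneg {r : ℝ} (h : 0 ≤ r) : requ r = r ^ 2 := by rw [requ, max_eq_left h]

lemma requ_of_nonpos {r : ℝ} (h : r ≤ 0) : requ r = 0 := by
  rw [requ, max_eq_right h, zero_pow two_ne_zero]

lemma requ_mul {c : ℝ} (hc : 0 ≤ c) (r : ℝ) : requ (c * r) = c ^ 2 * requ r := by
  rw [requ, requ, ← mul_pow, mul_max_of_nonneg _ _ hc, mul_zero]

lemma requ_add_requ_neg (r : ℝ) : requ r + requ (-r) = r ^ 2 := by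
  rcases le_total 0 r with h | h
  · rw [requ_of_nonneg h, requ_of_nonpos (neg_nonpos.2 h), add_zero]
  · rw [requ_of_nonpos h, requ_of_nonneg (neg_nonneg.2 h), zero_add, neg_sq]

/-- A continuously differentiable step function, combined from translates of `requ`. -/
def step (u : ℝ) : ℝ := 2 * requ u - 4 * requ (u - 1 / 2) + 2 * requ (u - 1)

/-- The derivative of `step`. -/
def dstep (u : ℝ) : ℝ := 4 * max u 0 - 8 * max (u - 1 / 2) 0 + 4 * max (u - 1) 0

lemma hasDerivAt_step (u : ℝ) : HasDerivAt step (dstep u) u := by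
  have h : ∀ c : ℝ, HasDerivAt (fun u => requ (u - c)) (2 * max (u - c) 0) u := fun c =>
    (hasDerivAt_sq_max_zero (u - c)).comp_sub_const u c
  have h0 : HasDerivAt requ (2 * max u 0) u := hasDerivAt_sq_max_zero u
  refine (((h0.const_mul 2).sub ((h (1 / 2)).const_mul 4)).add ((h 1).const_mul 2)).congr_deriv ?_
  rw [dstep]
  ring

lemma step_of_nonpos {u : ℝ} (h : u ≤ 0) : step u = 0 := by
  rw [step, requ_of_nonpos h, requ_of_nonpos (by linarith), requ_of_nonpos (by linarith)]
  ring

lemma step_of_one_le {u : ℝ} (h : 1 ≤ u) : step u = 1 := by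
  rw [step, requ_of_nonneg (by linarith), requ_of_nonneg (by linarith),
    requ_of_nonneg (by linarith)]
  ring

lemma dstep_nonneg (u : ℝ) : 0 ≤ dstep u := by
  unfold dstep
  rcases max_cases u 0 with h | h <;> rcases max_cases (u - 1 / 2) 0 with h' | h' <;>
    rcases max_cases (u - 1) 0 with h'' | h'' <;> linarith

lemma dstep_le (u : ℝ) : dstep u ≤ if 0 < u ∧ u < 1 then 2 else 0 := by
  unfold dstep
  split_ifs with h0
  · rcases max_cases u 0 with h | h <;> rcases max_cases (u - 1 / 2) 0 with h' | h' <;>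
      rcases max_cases (u - 1) 0 with h'' | h'' <;> linarith
  · rw [not_and_or, not_lt, not_lt] at h0
    rcases h0 with h0 | h0 <;> rcases max_cases u 0 with h | h <;>
    rcases max_cases (u - 1 / 2) 0 with h' | h' <;>
      rcases max_cases (u - 1) 0 with h'' | h'' <;> linarith

lemma monotone_step : Monotone step :=
  monotone_of_deriv_nonneg (fun u => (hasDerivAt_step u).differentiableAt) fun u => by
    rw [(hasDerivAt_step u).deriv]
    exact dstep_nonneg u

/-- A bump function with support in `[-1, 1]`, the integer translates of which sum to `1`. -/
def bump (u : ℝ) : ℝ := step (u + 1) - step u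

/-- The derivative of `bump`. -/
def dbump (u : ℝ) : ℝ := dstep (u + 1) - dstep u

lemma hasDerivAt_bump (u : ℝ) : HasDerivAt bump (dbump u) u := by
  have h : HasDerivAt (fun u => step (u + 1)) (dstep (u + 1)) u :=
    (hasDerivAt_step (u + 1)).comp_add_const u 1
  exact h.sub (hasDerivAt_step u)

lemma bump_nonneg (u : ℝ) : 0 ≤ bump u := sub_nonneg.2 (monotone_step (by linarith))

lemma bump_eq_zero {u : ℝ} (h : 1 < |u|) : bump u = 0 := by
  rcases lt_abs.1 h with h | h
  · rw [bump, step_of_one_le h.le, step_of_one_le (by linarith), sub_self]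
  · rw [bump, step_of_nonpos (by linarith), step_of_nonpos (by linarith), sub_self]

lemma abs_dbump_le (u : ℝ) : |dbump u| ≤ dstep (u + 1) + dstep u := by
  rw [dbump, abs_le]
  constructor <;> linarith [dstep_nonneg u, dstep_nonneg (u + 1)]

lemma dbump_eq_zero {u : ℝ} (h : 1 < |u|) : dbump u = 0 := by
  have h0 : ∀ v : ℝ, ¬ (0 < v ∧ v < 1) → dstep v = 0 := fun v hv =>
    le_antisymm (by simpa [hv] using dstep_le v) (dstep_nonneg v)
  rw [dbump, h0, h0, sub_self]
  · rintro ⟨h1, h2⟩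
    rw [abs_of_pos h1] at h
    linarith
  · rintro ⟨h1, h2⟩
    rw [abs_of_neg (by linarith)] at h
    linarith

lemma sum_bump (N : ℕ) {t : ℝ} (ht : t ∈ Icc (0 : ℝ) 1) :
    ∑ m : Fin (N + 1), bump (N * t - (m : ℕ)) = 1 := by
  rw [Fin.sum_univ_eq_sum_range (fun m => bump (N * t - m)) (N + 1)]
  have h : ∀ m : ℕ, bump (N * t - m) = step (N * t + 1 - m) - step (N * t + 1 - (m + 1 : ℕ)) := by
    intro m
    rw [bump]
    push_cast
    congr 2 <;> ring
  rw [Finset.sum_congr rfl fun m _ => h m, Finset.sum_range_sub' (fun m : ℕ => step (N * t + 1 - m)),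
    step_of_one_le, step_of_nonpos]
  · ring
  · have : (N : ℝ) * t ≤ N := by nlinarith [ht.2, N.cast_nonneg (α := ℝ)]
    push_cast
    linarith
  · have : 0 ≤ (N : ℝ) * t := mul_nonneg N.cast_nonneg ht.1
    push_cast
    linarith

/-- At most one of the integer translates of `(0,1)` contains `t`, so the bound is independent of
`N`. -/
lemma sum_dstep_le (N : ℕ) (t : ℝ) : ∑ m : Fin (N + 1), dstep (t - (m : ℕ)) ≤ 2 := by
  refine (Finset.sum_le_sum fun m _ => dstep_le _).trans ?_
  rw [← Finset.sum_filter, Finset.sum_const, nsmul_eq_mul]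
  have : (Finset.univ.filter fun m : Fin (N + 1) =>
      0 < t - ((m : ℕ) : ℝ) ∧ t - ((m : ℕ) : ℝ) < 1).card ≤ 1 := by
    rw [Finset.card_le_one]
    intro m hm m' hm'
    simp only [Finset.mem_filter, Finset.mem_univ, true_and] at hm hm'
    have h1 : ((m : ℕ) : ℝ) < (m' : ℕ) + 1 := by linarith
    have h2 : ((m' : ℕ) : ℝ) < (m : ℕ) + 1 := by linarith
    norm_cast at h1 h2
    ext
    omega
  have : ((Finset.univ.filter fun m : Fin (N + 1) =>
      0 < t - ((m : ℕ) : ℝ) ∧ t - ((m : ℕ) : ℝ) < 1).card : ℝ) ≤ 1 := by exact_mod_cast this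
  linarith

lemma sum_abs_dbump_le (N : ℕ) (t : ℝ) : ∑ m : Fin (N + 1), |dbump (t - (m : ℕ))| ≤ 4 := by
  calc _ ≤ ∑ m : Fin (N + 1), (dstep (t + 1 - (m : ℕ)) + dstep (t - (m : ℕ))) := by
        refine Finset.sum_le_sum fun m _ => (abs_dbump_le _).trans_eq ?_
        rw [show t - ((m : ℕ) : ℝ) + 1 = t + 1 - (m : ℕ) by ring]
    _ ≤ 2 + 2 := by
        rw [Finset.sum_add_distrib]
        exact add_le_add (sum_dstep_le N _) (sum_dstep_le N _)
    _ = 4 := by norm_num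

/-- Products of scaled translates of `bump`. -/
def gridBump {n : ℕ} (N : ℕ) (m : Fin n → Fin (N + 1)) (z : Fin n → ℝ) : ℝ :=
  ∏ j, bump (N * z j - (m j : ℕ))

section Grid

variable {n N : ℕ}

/-- The partial derivatives of `gridBump`. -/
def dgridBump (m : Fin n → Fin (N + 1)) (l : Fin n) (z : Fin n → ℝ) : ℝ :=
  N * dbump (N * z l - (m l : ℕ)) * ∏ j ∈ Finset.univ.erase l, bump (N * z j - (m j : ℕ))

lemma hasGrad_gridBump (m : Fin n → Fin (N + 1)) (z : Fin n → ℝ) :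
    HasGrad (gridBump N m) (fun l => dgridBump m l z) z := by
  refine HasGrad.prod_coord (φ := fun j t => bump (N * t - (m j : ℕ)))
    (φ' := fun j => N * dbump (N * z j - (m j : ℕ))) fun j => ?_
  refine ((hasDerivAt_bump _).comp (z j)
    (((hasDerivAt_id (z j)).const_mul (N : ℝ)).sub_const _)).congr_deriv ?_
  simp [mul_comm]

lemma gridBump_nonneg (m : Fin n → Fin (N + 1)) (z : Fin n → ℝ) : 0 ≤ gridBump N m z :=
  Finset.prod_nonneg fun _ _ => bump_nonneg _

lemma sum_gridBump {z : Fin n → ℝ} (hz : z ∈ cube n) : ∑ m, gridBump N m z = 1 := by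
  unfold gridBump
  rw [← Fintype.piFinset_univ, Finset.sum_prod_piFinset Finset.univ
    (fun j (m : Fin (N + 1)) => bump (N * z j - (m : ℕ)))]
  exact Finset.prod_eq_one fun j _ => sum_bump N (mem_cube.1 hz j)

/-- The sum over the grid factors into one-dimensional sums, all equal to `1` except the one in
direction `l`. -/
lemma sum_abs_dgridBump_le {z : Fin n → ℝ} (hz : z ∈ cube n) (l : Fin n) :
    ∑ m : Fin n → Fin (N + 1), |dgridBump m l z| ≤ 4 * N := by
  have h : ∀ m : Fin n → Fin (N + 1), |dgridBump m l z| = ∏ j,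
      (if j = l then N * |dbump (N * z l - (m j : ℕ))| else bump (N * z j - (m j : ℕ))) := by
    intro m
    rw [dgridBump, abs_mul, abs_mul, Nat.abs_cast, Finset.abs_prod,
      ← Finset.mul_prod_erase _ _ (Finset.mem_univ l), if_pos rfl]
    congr 1
    refine Finset.prod_congr rfl fun j hj => ?_
    rw [if_neg (Finset.ne_of_mem_erase hj), abs_of_nonneg (bump_nonneg _)]
  rw [Finset.sum_congr rfl fun m _ => h m, ← Fintype.piFinset_univ,
    Finset.sum_prod_piFinset Finset.univ (fun j (m : Fin (N + 1)) =>
      if j = l then (N : ℝ) * |dbump (N * z l - (m : ℕ))| else bump (N * z j - (m : ℕ))),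
    ← Finset.mul_prod_erase _ _ (Finset.mem_univ l), Finset.prod_eq_one, mul_one]
  · simp only [if_true, ← Finset.mul_sum]
    nlinarith [sum_abs_dbump_le N (N * z l), N.cast_nonneg (α := ℝ)]
  · intro j hj
    simp only [if_neg (Finset.ne_of_mem_erase hj)]
    exact sum_bump N (mem_cube.1 hz j)

lemma gridBump_eq_zero {m : Fin n → Fin (N + 1)} {z : Fin n → ℝ}
    (h : ¬ ∀ j, |N * z j - (m j : ℕ)| ≤ 1) : gridBump N m z = 0 := by
  push Not at h
  obtain ⟨j, hj⟩ := h
  exact Finset.prod_eq_zero (Finset.mem_univ j) (bump_eq_zero hj)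

lemma dgridBump_eq_zero {m : Fin n → Fin (N + 1)} {z : Fin n → ℝ} (l : Fin n)
    (h : ¬ ∀ j, |N * z j - (m j : ℕ)| ≤ 1) : dgridBump m l z = 0 := by
  push Not at h
  obtain ⟨j, hj⟩ := h
  rcases eq_or_ne j l with rfl | hjl
  · rw [dgridBump, dbump_eq_zero hj]
    ring
  · rw [dgridBump, Finset.prod_eq_zero (Finset.mem_erase.2 ⟨hjl, Finset.mem_univ j⟩)
      (bump_eq_zero hj), mul_zero]

/-- Local approximations are glued with the partition of unity `gridBump`. -/
lemma glue {f : (Fin n → ℝ) → ℝ} {P : (Fin n → Fin (N + 1)) → (Fin n → ℝ) → ℝ}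
    {g : (Fin n → Fin (N + 1)) → (Fin n → ℝ) → Fin n → ℝ} {A A' : ℝ}
    (hg : ∀ m, ∀ z ∈ cube n, HasGrad (fun z => f z - P m z) (g m z) z)
    (hA : ∀ m, ∀ z ∈ cube n, (∀ j, |N * z j - (m j : ℕ)| ≤ 1) →
      |f z - P m z| ≤ A ∧ ∀ l, |g m z l| ≤ A') {z : Fin n → ℝ} (hz : z ∈ cube n) :
    |f z - ∑ m, gridBump N m z * P m z| ≤ A ∧
    ∃ G, HasGrad (fun z => f z - ∑ m, gridBump N m z * P m z) G z ∧
      ∀ l, |G l| ≤ 4 * N * A + A' := by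
  -- The bumps sum to `1`, so only local errors appear. Differentiating a bump costs `4 N`, which
  -- the extra order in the value error compensates.
  have heq : ∀ z ∈ cube n, f z - ∑ m, gridBump N m z * P m z
      = ∑ m, gridBump N m z * (f z - P m z) := by
    intro z hz
    simp only [mul_sub, Finset.sum_sub_distrib]
    rw [← Finset.sum_mul, sum_gridBump hz, one_mul]
  have h1 : ∀ m, gridBump N m z * |f z - P m z| ≤ gridBump N m z * A := by
    intro m
    by_cases h : ∀ j, |N * z j - (m j : ℕ)| ≤ 1
    · exact mul_le_mul_of_nonneg_left (hA m z hz h).1 (gridBump_nonneg m z)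
    · rw [gridBump_eq_zero h, zero_mul, zero_mul]
  have h2 : ∀ m l, gridBump N m z * |g m z l| ≤ gridBump N m z * A' := by
    intro m l
    by_cases h : ∀ j, |N * z j - (m j : ℕ)| ≤ 1
    · exact mul_le_mul_of_nonneg_left ((hA m z hz h).2 l) (gridBump_nonneg m z)
    · rw [gridBump_eq_zero h, zero_mul, zero_mul]
  have h3 : ∀ m l, |dgridBump m l z| * |f z - P m z| ≤ |dgridBump m l z| * A := by
    intro m l
    by_cases h : ∀ j, |N * z j - (m j : ℕ)| ≤ 1
    · exact mul_le_mul_of_nonneg_left (hA m z hz h).1 (abs_nonneg _)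
    · rw [dgridBump_eq_zero l h, abs_zero, zero_mul, zero_mul]
  have hval : |f z - ∑ m, gridBump N m z * P m z| ≤ A := by
    rw [heq z hz]
    calc _ ≤ ∑ m, gridBump N m z * A := (Finset.abs_sum_le_sum_abs _ _).trans
          (Finset.sum_le_sum fun m _ => by
            rw [abs_mul, abs_of_nonneg (gridBump_nonneg m z)]
            exact h1 m)
      _ = A := by rw [← Finset.sum_mul, sum_gridBump hz, one_mul]
  refine ⟨hval, _, (HasGrad.sum Finset.univ fun m _ =>
    (hasGrad_gridBump m z).mul (hg m z hz)).congr_fun hz heq, fun l => ?_⟩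
  have hA0 : 0 ≤ A := (abs_nonneg _).trans hval
  calc _ ≤ ∑ m, (|dgridBump m l z| * A + gridBump N m z * A') :=
        (Finset.abs_sum_le_sum_abs _ _).trans (Finset.sum_le_sum fun m _ => by
          refine (abs_add_le _ _).trans ?_
          rw [abs_mul, abs_mul, abs_of_nonneg (gridBump_nonneg m z)]
          exact add_le_add (h3 m l) (h2 m l))
    _ = (∑ m : Fin n → Fin (N + 1), |dgridBump m l z|) * A + A' := by
        rw [Finset.sum_add_distrib, ← Finset.sum_mul, ← Finset.sum_mul, sum_gridBump hz, one_mul]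
    _ ≤ 4 * N * A + A' :=
        add_le_add (mul_le_mul_of_nonneg_right (sum_abs_dgridBump_le hz l) hA0) le_rfl

end Grid

/-! ### Approximation of functions that vanish on two opposite faces -/

section MaskedApprox

variable {n : ℕ} {Γ : Type} [Fintype Γ] {k : ℕ} {α : Γ → Fin n → ℕ} {e : Fin n}

/-- The centres of the local approximations: grid points, moved by `1 / N` away from the face
`z e = 0`, respectively `z e = 1`. -/
def centre (N : ℕ) (e : Fin n) (b : Bool) (m : Fin n → Fin (N + 1)) (j : Fin n) : ℝ :=
  if j = e then ((if b then min (m j : ℕ) (N - 1) else max (m j : ℕ) 1 : ℕ) : ℝ) / N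
    else ((m j : ℕ) : ℝ) / N

/-- The coordinate `z e` of the two faces. -/
def face (b : Bool) : ℝ := if b then 1 else 0

lemma face_mem (b : Bool) : face b ∈ Icc (0 : ℝ) 1 := by
  cases b <;> simp [face]

lemma centre_mem_cube {N : ℕ} (hN : 1 ≤ N) (e : Fin n) (b : Bool) (m : Fin n → Fin (N + 1)) :
    centre N e b m ∈ cube n := by
  rw [mem_cube]
  have hN0 : (0 : ℝ) < N := by exact_mod_cast hN
  have h : ∀ r : ℕ, r ≤ N → (r : ℝ) / N ∈ Icc (0 : ℝ) 1 := fun r hr =>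
    ⟨by positivity, by rw [div_le_one hN0]; exact_mod_cast hr⟩
  intro j
  have hm := (m j).2
  unfold centre
  split_ifs with h1 h2
  · exact h _ (by omega)
  · exact h _ (by omega)
  · exact h _ (by omega)

lemma le_abs_face_sub_centre {N : ℕ} (hN : 1 ≤ N) (e : Fin n) (b : Bool)
    (m : Fin n → Fin (N + 1)) : 1 / (N : ℝ) ≤ |face b - centre N e b m e| := by
  have hN0 : (0 : ℝ) < N := by exact_mod_cast hN
  simp only [face, centre, if_true]
  cases b
  · simp only [Bool.false_eq_true, if_false, zero_sub, abs_neg]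
    rw [abs_of_nonneg (by positivity)]
    gcongr
    exact_mod_cast le_max_right _ _
  · simp only [if_true]
    refine le_trans ?_ (le_abs_self _)
    rw [le_sub_iff_add_le, ← add_div, div_le_one hN0]
    have : 1 + min (m e : ℕ) (N - 1) ≤ N := by omega
    exact_mod_cast this

/-- One `1 / N` comes from the support of the bump, the other from the shift of the centre. With
`le_abs_face_sub_centre` this gives exactly the condition `r ≤ 2δ` of `exists_grad_mask`. -/
lemma norm_sub_centre_le {N : ℕ} (hN : 1 ≤ N) (e : Fin n) (b : Bool)
    (m : Fin n → Fin (N + 1)) {z : Fin n → ℝ} (hz : ∀ j, |N * z j - (m j : ℕ)| ≤ 1) :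
    ‖z - centre N e b m‖ ≤ 2 / N := by
  have hN0 : (0 : ℝ) < N := by exact_mod_cast hN
  rw [pi_norm_le_iff_of_nonneg (by positivity)]
  intro j
  have hm := (m j).2
  have key : ∀ r : ℕ, |((m j : ℕ) : ℝ) - r| ≤ 1 → ‖z j - (r : ℝ) / N‖ ≤ 2 / N := by
    intro r hr
    rw [Real.norm_eq_abs, show z j - (r : ℝ) / N = (N * z j - r) / N by field_simp, abs_div,
      Nat.abs_cast]
    gcongr
    have := abs_add_le (N * z j - (m j : ℕ)) ((m j : ℕ) - r)
    rw [sub_add_sub_cancel] at this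
    linarith [hz j]
  have key' : ∀ r : ℕ, r ≤ m j + 1 → (m j : ℕ) ≤ r + 1 → ‖z j - (r : ℝ) / N‖ ≤ 2 / N := by
    intro r h1 h2
    refine key r ?_
    have h1' : (r : ℝ) ≤ (m j : ℕ) + 1 := by exact_mod_cast h1
    have h2' : ((m j : ℕ) : ℝ) ≤ r + 1 := by exact_mod_cast h2
    rw [abs_le]
    constructor <;> linarith
  rw [Pi.sub_apply]
  unfold centre
  split_ifs with h1 h2
  · exact key' _ (by omega) (by omega)
  · exact key' _ (by omega) (by omega)
  · exact key' _ (by omega) (by omega)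

lemma exists_face_approx {C : ℝ} (hC : 0 ≤ C) (hα : ∀ γ, α γ e ≤ k) {f : (Fin n → ℝ) → ℝ}
    {q : (Fin n → ℝ) → Γ → ℝ} (b : Bool) {N : ℕ} (hN : 1 ≤ N)
    (hf : ∀ a ∈ cube n, ∀ z ∈ cube n, TaylorClose α k C f (q a) a z)
    (h0 : ∀ z ∈ cube n, z e = face b → f z = 0) {z : Fin n → ℝ} (hz : z ∈ cube n) :
    let V : (Fin n → ℝ) → ℝ := fun z => ∑ m, gridBump N m z * ∑ γ,
      maskCoef k α e (face b) (centre N e b m e) (q (centre N e b m)) γ *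
        mono (maskExp k α e γ) (z - centre N e b m)
    |f z - (face b - z e) * V z| ≤ C * (1 + (k + 2) * 2 ^ (k + 1)) * 2 ^ (k + 1) / N ^ (k + 1) ∧
    ∃ G, HasGrad (fun z => f z - (face b - z e) * V z) G z ∧
      ∀ l, |G l| ≤ 5 * (C * (1 + (k + 2) * 2 ^ (k + 1)) * 2 ^ (k + 1)) / N ^ k := by
  intro V
  have hN0 : (0 : ℝ) < N := by exact_mod_cast hN
  set a := centre N e b with ha
  have hδ : ∀ m, 1 / (N : ℝ) ≤ |face b - a m e| := fun m => le_abs_face_sub_centre hN e b m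
  have hδ0 : ∀ m, face b - a m e ≠ 0 := fun m =>
    abs_pos.1 (lt_of_lt_of_le (by positivity) (hδ m))
  choose g hg using fun m => exists_grad_mask hC hα (face_mem b) (hδ0 m)
    (hf (a m) (centre_mem_cube hN e b m)) h0
  set C' := C * (1 + (k + 2) * 2 ^ (k + 1)) with hC'
  have hC'0 : 0 ≤ C' := by positivity
  have hsmall : ∀ j : ℕ, j ≤ k + 1 → (2 / N : ℝ) ^ j ≤ 2 ^ (k + 1) / N ^ j := by
    intro j hj
    rw [div_pow]
    gcongr
    norm_num
  have := glue (fun m z hz => (hg m z hz).1) (fun m z hz hzm => by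
    have hn := norm_sub_centre_le hN e b m hzm
    have hn' : ‖z - a m‖ ≤ 2 * |face b - a m e| := hn.trans (by
      have := hδ m
      rw [show (2 : ℝ) / N = 2 * (1 / N) by ring]
      gcongr)
    obtain ⟨h1, h2⟩ := (hg m z hz).2 hn'
    refine And.intro (b := ∀ l, |g m z l| ≤ C' * 2 ^ (k + 1) / N ^ k)
      (show _ ≤ C' * 2 ^ (k + 1) / N ^ (k + 1) from ?_) ?_
    · refine h1.trans ?_
      rw [mul_div_assoc]
      exact mul_le_mul_of_nonneg_left ((pow_le_pow_left₀ (norm_nonneg _) hn _).trans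
        (hsmall _ le_rfl)) hC'0
    · intro l
      refine (h2 l).trans ?_
      rw [mul_div_assoc]
      exact mul_le_mul_of_nonneg_left ((pow_le_pow_left₀ (norm_nonneg _) hn _).trans
        (hsmall _ (Nat.le_succ k))) hC'0) hz
  have hV : ∀ z, ∑ m, gridBump N m z * ((face b - z e) * ∑ γ,
      maskCoef k α e (face b) (a m e) (q (a m)) γ * mono (maskExp k α e γ) (z - a m))
      = (face b - z e) * V z := by
    intro z
    simp only [V]
    rw [Finset.mul_sum]
    exact Finset.sum_congr rfl fun m _ => by ring
  simp only [hV] at this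
  refine ⟨this.1, ?_⟩
  obtain ⟨G, hG, hGb⟩ := this.2
  refine ⟨G, hG, fun l => (hGb l).trans_eq ?_⟩
  rw [pow_succ (N : ℝ) k]
  field_simp
  ring

end MaskedApprox

/-- Sums of localized monomials times `z e * (1 - z e)` approximate, in `C¹`, the functions that
vanish on the faces `z e = 0` and `z e = 1`. -/
theorem exists_masked_approx (ι : Type*) (n k : ℕ) (e : Fin n) :
    ∃ (Γ : Type) (_ : Fintype Γ) (α : Γ → Fin n → ℕ), (∀ γ, ∑ j, α γ j ≤ 2 * k) ∧
      ∀ F : ι → (Fin n → ℝ) → ℝ, UniformCk (k + 1) F →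
        (∀ i, ∀ z ∈ cube n, z e = 0 ∨ z e = 1 → F i z = 0) → ∃ B C : ℝ, 0 < B ∧ 0 < C ∧
        ∀ i, ∀ N : ℕ, 1 ≤ N → ∃ (a : Bool × (Fin n → Fin (N + 1)) → Fin n → ℝ)
          (c : Bool × (Fin n → Fin (N + 1)) → Γ → ℝ), (∀ m, a m ∈ cube n) ∧
          (∀ m γ, |c m γ| ≤ B * N ^ (k + 1)) ∧
          let V : (Fin n → ℝ) → ℝ := fun z => ∑ m, gridBump N m.2 z * ∑ γ,
            c m γ * mono (α γ) (z - a m)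
          ∀ z ∈ cube n, |F i z - z e * (1 - z e) * V z| ≤ C / N ^ k ∧
            ∃ G, HasGrad (fun z => F i z - z e * (1 - z e) * V z) G z ∧
              ∀ l, |G l| ≤ C / N ^ k := by
  obtain ⟨Γ, _, α, hα, h⟩ := exists_taylorClose ι n k
  have hαe : ∀ γ, α γ e ≤ k := fun γ =>
    (Finset.single_le_sum (fun j _ => Nat.zero_le _) (Finset.mem_univ e)).trans (hα γ)
  refine ⟨Γ × Fin (k + 1), inferInstance, maskExp k α e, fun γ => ?_, fun F hF h0 => ?_⟩
  · have h1 := hα γ.1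
    have h2 := γ.2.2
    simp only [maskExp, Pi.add_apply, Finset.sum_add_distrib, Finset.sum_pi_single',
      Finset.mem_univ, if_true]
    omega
  obtain ⟨B, C, hB, hC, q, hq, hF⟩ := h F hF
  set A := C * (1 + (k + 2) * 2 ^ (k + 1)) * 2 ^ (k + 1) with hA
  have hA0 : 0 < A := by positivity
  -- The constant `12` is `1 + 5` for each face: a value error from differentiating the weight, and
  -- a gradient error.
  refine ⟨B, 12 * A, hB, by positivity, fun i N hN => ?_⟩
  have hN1 : (1 : ℝ) ≤ N := by exact_mod_cast hN
  have hpow : A / (N : ℝ) ^ (k + 1) ≤ A / N ^ k :=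
    div_le_div_of_nonneg_left hA0.le (by positivity) (pow_le_pow_right₀ hN1 (Nat.le_succ k))
  refine ⟨fun m => centre N e m.1 m.2, fun m γ => (if m.1 then 1 else -1) * maskCoef k α e (face m.1)
    (centre N e m.1 m.2 e) (q i (centre N e m.1 m.2)) γ, fun m => centre_mem_cube hN e _ _,
    fun m γ => ?_, ?_⟩
  · have h1 := abs_maskCoef_le (k := k) (α := α) (e := e) (γ := γ)
      (hq i _ (centre_mem_cube hN e m.1 m.2)) hN1
      (le_abs_face_sub_centre hN e m.1 m.2)
    rw [abs_mul]
    split_ifs <;> simpa using h1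
  · intro V z hz
    set W : Bool → (Fin n → ℝ) → ℝ := fun b z => ∑ m, gridBump N m z * ∑ γ,
      maskCoef k α e (face b) (centre N e b m e) (q i (centre N e b m)) γ *
        mono (maskExp k α e γ) (z - centre N e b m) with hW
    have hV : ∀ z, V z = W true z - W false z := by
      intro z
      simp only [V, hW, Fintype.sum_prod_type, Fintype.sum_bool, if_true, Bool.false_eq_true,
        if_false, one_mul, neg_mul, Finset.sum_neg_distrib, mul_neg]
      ring
    have hh : ∀ b, _ := fun b => exists_face_approx (e := e) hC.le hαe b hN (hF i)
      (fun z hz hze => h0 i z hz (by cases b <;> simp_all [face])) hz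
    obtain ⟨h1, G1, hG1, hG1b⟩ := hh true
    obtain ⟨h2, G2, hG2, hG2b⟩ := hh false
    -- `F` is split as `z_e F + (1 - z_e) F`. The first part uses the approximant with factor `1 -
    -- z_e`, the second the one with factor `-z_e`, so both acquire the full mask.
    have heq : ∀ z, F i z - z e * (1 - z e) * V z = z e * (F i z - (face true - z e) * W true z)
        + (1 - z e) * (F i z - (face false - z e) * W false z) := by
      intro z
      rw [hV]
      simp only [face, if_true, Bool.false_eq_true, if_false]
      ring
    have hze := mem_cube.1 hz e
    have hx1 : |z e| ≤ 1 := abs_le.2 ⟨by linarith [hze.1], hze.2⟩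
    have hx2 : |1 - z e| ≤ 1 := abs_le.2 ⟨by linarith [hze.2], by linarith [hze.1]⟩
    have hmul : ∀ {x y b : ℝ}, |x| ≤ 1 → |y| ≤ b → |x * y| ≤ b := fun {x y b} hx hy => by
      rw [abs_mul]
      nlinarith [abs_nonneg y, abs_nonneg x]
    have hAN : 0 ≤ A / (N : ℝ) ^ k := by positivity
    refine ⟨?_, ?_⟩
    · rw [heq]
      refine (abs_add_le _ _).trans ?_
      have h3 := hmul hx1 h1
      have h4 := hmul hx2 h2
      rw [mul_div_assoc]
      simp only [hW] at h3 h4 ⊢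
      linarith
    · have hc1 : HasGrad (fun z : Fin n → ℝ => z e) (fun l => if l = e then 1 else 0) z :=
        HasGrad.of_coord e (φ := fun t => t) (hasDerivAt_id (z e))
      have hc2 : HasGrad (fun z : Fin n → ℝ => 1 - z e) (fun l => if l = e then -1 else 0) z :=
        HasGrad.of_coord e (φ := fun t => 1 - t)
          (by simpa using (hasDerivAt_id (z e)).const_sub 1)
      refine ⟨_, ((hc1.mul hG1).add (hc2.mul hG2)).congr_fun hz fun y _ => heq y, fun l => ?_⟩
      have hi1 : |(if l = e then (1 : ℝ) else 0)| ≤ 1 := by split_ifs <;> simp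
      have hi2 : |(if l = e then (-1 : ℝ) else 0)| ≤ 1 := by split_ifs <;> simp
      have e1 := hmul hi1 h1
      have e2 := hmul hx1 (hG1b l)
      have e3 := hmul hi2 h2
      have e4 := hmul hx2 (hG2b l)
      have e5 : 5 * A / (N : ℝ) ^ k = 5 * (A / N ^ k) := by ring
      have e6 : 12 * A / (N : ℝ) ^ k = 12 * (A / N ^ k) := by ring
      rw [← hA] at e1 e2 e3 e4
      rw [e5] at e2 e4
      rw [e6]
      refine (abs_add_le _ _).trans ((add_le_add (abs_add_le _ _) (abs_add_le _ _)).trans ?_)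
      linarith

/-! ### Functions computed by networks with bounded parameters -/

/-- `F` lists the neurons of the last of `l + 1` hidden layers, all indexed by `κ`, of a `ReLU²`
network with weights and biases in `[-1, 1]`. -/
def Layers {n : ℕ} (κ : Type) [Fintype κ] : ℕ → (κ → (Fin n → ℝ) → ℝ) → Prop
  | 0, F => ∃ (A : κ → Fin n → ℝ) (b : κ → ℝ), (∀ c j, |A c j| ≤ 1) ∧ (∀ c, |b c| ≤ 1) ∧
      ∀ c z, F c z = requ (∑ j, A c j * z j + b c)
  | l + 1, F => ∃ G : κ → (Fin n → ℝ) → ℝ, Layers κ l G ∧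
      ∃ (A : κ → κ → ℝ) (b : κ → ℝ), (∀ c j, |A c j| ≤ 1) ∧ (∀ c, |b c| ≤ 1) ∧
        ∀ c z, F c z = requ (∑ j, A c j * G j z + b c)

section Layers

variable {n : ℕ} {κ κ' : Type} [Fintype κ] [Fintype κ'] {l : ℕ}

lemma sum_extend_mul {ι : κ → κ'} (hι : Function.Injective ι) (u : κ → ℝ) (v : κ' → ℝ) :
    ∑ c', Function.extend ι u 0 c' * v c' = ∑ c, u c * v (ι c) :=
  (Fintype.sum_of_injective ι hι _ _ (fun c' hc' => by
    rw [Function.extend_apply' _ _ _ hc', Pi.zero_apply, zero_mul])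
    fun c => by rw [hι.extend_apply]).symm

lemma abs_extend_le {α β : Type*} {ι : α → β} (hι : Function.Injective ι) {u : α → ℝ}
    (hu : ∀ c, |u c| ≤ 1) (c' : β) : |Function.extend ι u 0 c'| ≤ 1 := by
  by_cases h : ∃ c, ι c = c'
  · obtain ⟨c, rfl⟩ := h
    rw [hι.extend_apply]
    exact hu c
  · rw [Function.extend_apply' _ _ _ h]
    simp

/-- Padding: additional neurons have zero weights and bias, hence value `requ 0 = 0`. -/
lemma Layers.embed {ι : κ → κ'} (hι : Function.Injective ι) {F : κ → (Fin n → ℝ) → ℝ}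
    (hF : Layers κ l F) : Layers κ' l (Function.extend ι F 0) := by
  induction l generalizing F with
  | zero =>
    obtain ⟨A, b, hA, hb, h⟩ := hF
    refine ⟨fun c' j => Function.extend ι (fun c => A c j) 0 c', Function.extend ι b 0,
      fun c' j => abs_extend_le hι (fun c => hA c j) c', abs_extend_le hι hb, fun c' z => ?_⟩
    by_cases hc : ∃ c, ι c = c'
    · obtain ⟨c, rfl⟩ := hc
      simp only [hι.extend_apply, h]
    · simp [Function.extend_apply' _ _ _ hc, requ]
  | succ l ih =>
    obtain ⟨G, hG, A, b, hA, hb, h⟩ := hF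
    refine ⟨_, ih hG, fun c' j' => Function.extend ι (fun c => Function.extend ι (A c) 0 j') 0 c',
      Function.extend ι b 0, fun c' j => abs_extend_le hι (fun c => abs_extend_le hι (hA c) j) c',
      abs_extend_le hι hb, fun c' z => ?_⟩
    by_cases hc : ∃ c, ι c = c'
    · obtain ⟨c, rfl⟩ := hc
      simp only [hι.extend_apply, h]
      rw [sum_extend_mul hι (A c) (fun j => Function.extend ι G 0 j z)]
      simp only [hι.extend_apply]
    · simp [Function.extend_apply' _ _ _ hc, requ]

/-- Networks run in parallel through block-diagonal weight matrices. -/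
lemma Layers.block {P : Type} [Fintype P] {F : P → κ → (Fin n → ℝ) → ℝ}
    (hF : ∀ p, Layers κ l (F p)) : Layers (P × κ) l fun pc => F pc.1 pc.2 := by
  classical
  induction l generalizing F with
  | zero =>
    choose A b hA hb h using hF
    exact ⟨fun pc j => A pc.1 pc.2 j, fun pc => b pc.1 pc.2, fun pc => hA pc.1 pc.2,
      fun pc => hb pc.1 pc.2, fun pc => h pc.1 pc.2⟩
  | succ l ih =>
    choose G hG A b hA hb h using hF
    refine ⟨_, ih hG, fun pc pc' => if pc.1 = pc'.1 then A pc.1 pc.2 pc'.2 else 0,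
      fun pc => b pc.1 pc.2, fun pc pc' => ?_, fun pc => hb pc.1 pc.2, fun pc z => ?_⟩
    · dsimp only
      split_ifs
      · exact hA _ _ _
      · simp
    · dsimp only
      rw [h, Fintype.sum_prod_type, Finset.sum_eq_single pc.1]
      · simp
      · intro p _ hp
        simp [hp.symm]
      · simp

end Layers

/-- `f` is a linear combination, with coefficients in `[-1, 1]`, of the neurons of the last of
`l + 1` hidden layers of width `w`. -/
def Readout {n : ℕ} (l w : ℕ) (f : (Fin n → ℝ) → ℝ) : Prop :=
  ∃ F : Fin w → (Fin n → ℝ) → ℝ, Layers (Fin w) l F ∧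
    ∃ a : Fin w → ℝ, (∀ c, |a c| ≤ 1) ∧ ∀ z, f z = ∑ c, a c * F c z

/-- The signs `1` and `-1`. -/
def sgn (s : Bool) : ℝ := if s then 1 else -1

lemma abs_sgn (s : Bool) : |sgn s| = 1 := by cases s <;> simp [sgn]

/-- Polarization `x = ((x + 1) / 2)² - ((x - 1) / 2)²`, each square being `requ r + requ (-r)`; all
weights stay within `[-1, 1]`. -/
lemma sum_sgn_requ_identity (x : ℝ) :
    ∑ r : Bool × Bool, sgn r.1 * requ (sgn r.2 * ((x + sgn r.1) / 2)) = x := by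
  have h1 := requ_add_requ_neg ((x + 1) / 2)
  have h2 := requ_add_requ_neg ((x + -1) / 2)
  simp only [Fintype.sum_prod_type, Fintype.sum_bool, sgn, if_true, Bool.false_eq_true, if_false,
    one_mul, neg_one_mul]
  linear_combination h1 - h2

lemma sum_sgn_requ_mul (x y : ℝ) :
    ∑ r : Bool × Bool, sgn r.1 * requ (sgn r.2 * ((x + sgn r.1 * y) / 2)) = x * y := by
  have h1 := requ_add_requ_neg ((x + y) / 2)
  have h2 := requ_add_requ_neg ((x + -y) / 2)
  simp only [Fintype.sum_prod_type, Fintype.sum_bool, sgn, if_true, Bool.false_eq_true, if_false,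
    one_mul, neg_one_mul]
  linear_combination h1 - h2

namespace Readout

variable {n : ℕ} {l w : ℕ} {f g : (Fin n → ℝ) → ℝ}

lemma of_layers {κ : Type} [Fintype κ] (hκ : Fintype.card κ ≤ w) {F : κ → (Fin n → ℝ) → ℝ}
    (hF : Layers κ l F) {a : κ → ℝ} (ha : ∀ c, |a c| ≤ 1) (hf : ∀ z, f z = ∑ c, a c * F c z) :
    Readout l w f := by
  obtain ⟨ι⟩ := Function.Embedding.nonempty_of_card_le (α := κ) (β := Fin w) (by simpa using hκ)
  refine ⟨_, hF.embed ι.injective, Function.extend ι a 0, abs_extend_le ι.injective ha,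
    fun z => ?_⟩
  rw [hf, sum_extend_mul ι.injective a (fun c => Function.extend ι F 0 c z)]
  simp only [ι.injective.extend_apply]

lemma congr (hf : Readout l w f) (h : ∀ z, g z = f z) : Readout l w g := by
  rwa [show g = f from funext h]

lemma mono {w' : ℕ} (hf : Readout l w f) (hw : w ≤ w') : Readout l w' f := by
  obtain ⟨F, hF, a, ha, h⟩ := hf
  exact of_layers (by simpa using hw) hF ha h

lemma of_affine {ρ : Type} [Fintype ρ] (hρ : Fintype.card ρ ≤ w) {A : ρ → Fin n → ℝ} {b : ρ → ℝ}
    {a : ρ → ℝ} (hA : ∀ r j, |A r j| ≤ 1) (hb : ∀ r, |b r| ≤ 1) (ha : ∀ r, |a r| ≤ 1)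
    (hf : ∀ z, f z = ∑ r, a r * requ (∑ j, A r j * z j + b r)) : Readout 0 w f :=
  of_layers hρ (l := 0) (F := fun r z => requ (∑ j, A r j * z j + b r))
    ⟨A, b, hA, hb, fun _ _ => rfl⟩ ha hf

/-- Adding a layer. -/
lemma of_layer {κ ρ : Type} [Fintype κ] [Fintype ρ] (hκ : Fintype.card κ ≤ w)
    (hρ : Fintype.card ρ ≤ w) {G : κ → (Fin n → ℝ) → ℝ} (hG : Layers κ l G) {A : ρ → κ → ℝ}
    {b : ρ → ℝ} {a : ρ → ℝ} (hA : ∀ r j, |A r j| ≤ 1) (hb : ∀ r, |b r| ≤ 1) (ha : ∀ r, |a r| ≤ 1)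
    (hf : ∀ z, f z = ∑ r, a r * requ (∑ j, A r j * G j z + b r)) : Readout (l + 1) w f := by
  obtain ⟨ι⟩ := Function.Embedding.nonempty_of_card_le (α := κ) (β := Fin w) (by simpa using hκ)
  obtain ⟨ε⟩ := Function.Embedding.nonempty_of_card_le (α := ρ) (β := Fin w) (by simpa using hρ)
  have hι := ι.injective
  have hε := ε.injective
  refine ⟨_, ⟨_, hG.embed hι,
    fun c' j' => Function.extend ε (fun c => Function.extend ι (A c) 0 j') 0 c',
    Function.extend ε b 0, fun c' j => abs_extend_le hε (fun c => abs_extend_le hι (hA c) j) c',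
    abs_extend_le hε hb, fun _ _ => rfl⟩, Function.extend ε a 0, abs_extend_le hε ha, fun z => ?_⟩
  rw [hf, sum_extend_mul hε a (fun c => requ (_ + _))]
  simp only [hε.extend_apply]
  refine Finset.sum_congr rfl fun r _ => ?_
  rw [sum_extend_mul hι (A r) (fun j => Function.extend ι G 0 j z)]
  simp only [hι.extend_apply]

/-- Multiplication by a natural number costs width, not large weights. -/
lemma amplify (hf : Readout l w f) (N : ℕ) (hN : N * 4 ≤ w) :
    Readout (l + 1) w fun z => N * f z := by
  obtain ⟨F, hF, a, ha, h⟩ := hf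
  refine of_layer (ρ := Fin N × (Bool × Bool)) (by simp) (by simpa using hN) hF
    (A := fun r c => sgn r.2.2 * (a c / 2)) (b := fun r => sgn r.2.2 * (sgn r.2.1 / 2))
    (a := fun r => sgn r.2.1) (fun r c => ?_) (fun r => ?_) (fun r => (abs_sgn _).le) fun z => ?_
  · rw [abs_mul, abs_sgn, abs_div, abs_two]
    linarith [ha c]
  · rw [abs_mul, abs_sgn, abs_div, abs_sgn, abs_two]
    norm_num
  · have : ∀ r : Fin N × (Bool × Bool), ∑ c, sgn r.2.2 * (a c / 2) * F c z +
        sgn r.2.2 * (sgn r.2.1 / 2) = sgn r.2.2 * ((f z + sgn r.2.1) / 2) := by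
      intro r
      rw [h, add_div, Finset.sum_div, mul_add, Finset.mul_sum]
      congr 1
      exact Finset.sum_congr rfl fun c _ => by ring
    simp only [this]
    rw [Fintype.sum_prod_type]
    simp only [sum_sgn_requ_identity]
    simp

lemma lift {l' : ℕ} (hf : Readout l w f) (hw : 4 ≤ w) (hl : l ≤ l') : Readout l' w f := by
  induction l', hl using Nat.le_induction with
  | base => exact hf
  | succ l' _ ih => simpa using ih.amplify 1 (by simpa using hw)

/-- A factor `N ^ r` costs `r` layers, not width `N ^ r`; coefficients of polynomial size thus leave
the depth independent of `N`. -/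
lemma amplify_pow (hf : Readout l w f) (N : ℕ) (hN : N * 4 ≤ w) (r : ℕ) :
    Readout (l + r) w fun z => (N : ℝ) ^ r * f z := by
  induction r with
  | zero => simpa using hf
  | succ r ih => exact (ih.amplify N hN).congr fun z => by ring

lemma sum {P : Type} [Fintype P] {f : P → (Fin n → ℝ) → ℝ} (hf : ∀ p, Readout l w (f p))
    {a : P → ℝ} (ha : ∀ p, |a p| ≤ 1) :
    Readout l (Fintype.card P * w) fun z => ∑ p, a p * f p z := by
  choose F hF b hb h using hf
  refine of_layers (κ := P × Fin w) (by simp) (Layers.block hF) (a := fun pc => a pc.1 * b pc.1 pc.2)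
    (fun pc => ?_) fun z => ?_
  · rw [abs_mul]
    exact mul_le_one₀ (ha _) (abs_nonneg _) (hb _ _)
  · rw [Fintype.sum_prod_type]
    refine Finset.sum_congr rfl fun p _ => ?_
    rw [h, Finset.mul_sum]
    exact Finset.sum_congr rfl fun c _ => by ring

lemma mul (hf : Readout l w f) (hg : Readout l w g) (hw : 2 ≤ w) :
    Readout (l + 1) (w * 2) fun z => f z * g z := by
  obtain ⟨F, hF, a, ha, h⟩ := hf
  obtain ⟨G, hG, b, hb, h'⟩ := hg
  have hFG : Layers (Bool × Fin w) l fun pc => (if pc.1 then F else G) pc.2 :=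
    Layers.block (F := fun p : Bool => if p then F else G) fun p => by cases p <;> simpa
  refine of_layer (κ := Bool × Fin w) (ρ := Bool × Bool) (by simp [mul_comm]) (by simp; omega) hFG
    (A := fun r pc => sgn r.2 * (if pc.1 then a pc.2 / 2 else sgn r.1 * (b pc.2 / 2)))
    (b := fun _ => 0) (a := fun r => sgn r.1) (fun r pc => ?_) (fun r => by simp)
    (fun r => (abs_sgn _).le) fun z => ?_
  · rw [abs_mul, abs_sgn, one_mul]
    split_ifs
    · rw [abs_div, abs_two]
      linarith [ha pc.2]
    · rw [abs_mul, abs_sgn, abs_div, abs_two]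
      linarith [hb pc.2]
  · rw [← sum_sgn_requ_mul]
    refine Finset.sum_congr rfl fun r _ => ?_
    congr 2
    rw [h, h', Fintype.sum_prod_type, Fintype.sum_bool]
    simp only [if_true, Bool.false_eq_true, if_false]
    rw [add_zero, add_div, mul_div_assoc, Finset.sum_div, Finset.sum_div, mul_add, Finset.mul_sum,
      Finset.mul_sum, Finset.mul_sum]
    congr 1 <;> exact Finset.sum_congr rfl fun c _ => by ring

lemma one : Readout 0 4 fun _ : Fin n → ℝ => 1 :=
  of_affine (ρ := Unit) (by simp) (A := fun _ _ => 0) (b := fun _ => 1) (a := fun _ => 1)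
    (by simp) (by simp) (by simp) fun z => by simp [requ]

lemma coord_sub (j : Fin n) {a : ℝ} (ha : a ∈ Icc (0 : ℝ) 1) : Readout 0 4 fun z => z j - a := by
  refine of_affine (ρ := Bool × Bool) (by simp) (A := fun r i => if i = j then sgn r.2 / 2 else 0)
    (b := fun r => sgn r.2 * ((sgn r.1 - a) / 2)) (a := fun r => sgn r.1) (fun r i => ?_)
    (fun r => ?_) (fun r => (abs_sgn _).le) fun z => ?_
  · split_ifs
    · rw [abs_div, abs_sgn, abs_two]
      norm_num
    · simp
  · rw [abs_mul, abs_sgn, one_mul, abs_le]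
    have := abs_le.1 (abs_sgn r.1).le
    constructor <;> linarith [ha.1, ha.2]
  · conv_lhs => rw [← sum_sgn_requ_identity (z j - a)]
    refine Finset.sum_congr rfl fun r _ => ?_
    congr 2
    rw [Finset.sum_eq_single j]
    · rw [if_pos rfl]
      ring
    · intro i _ hi
      rw [if_neg hi, zero_mul]
    · simp

/-- Scaling the argument by `1 / (2 N)` brings weights and biases into `[-1, 1]` and costs `4 N²` by
homogeneity of `requ`; a further factor `4` normalizes the outer coefficients `2, -4, 4, -2`. -/
lemma bump_coord (j : Fin n) {N m : ℕ} (hN : 1 ≤ N) (hm : m ≤ N) :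
    Readout 0 4 fun z => bump (N * z j - m) / (16 * N ^ 2) := by
  have hN1 : (1 : ℝ) ≤ N := by exact_mod_cast hN
  have hN0 : (0 : ℝ) < N := by linarith
  have hm1 : (m : ℝ) ≤ N := by exact_mod_cast hm
  have hm0 : (0 : ℝ) ≤ m := m.cast_nonneg
  -- The knots of the bump; the terms of the two steps at the middle knot cancel.
  let δ : Fin 4 → ℝ := ![1, 1 / 2, -1 / 2, -1]
  have hδ : ∀ r, |δ r| ≤ 1 := by
    intro r
    fin_cases r <;> simp only [δ] <;> norm_num [abs_le]
  refine of_affine (ρ := Fin 4) (by simp) (A := fun r i => if i = j then 1 / 2 else 0)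
    (b := fun r => (δ r - m) / (2 * N)) (a := ![1 / 2, -1, 1, -1 / 2]) (fun r i => ?_)
    (fun r => ?_) (fun r => ?_) fun z => ?_
  · split_ifs <;> norm_num [abs_le]
  · have := abs_le.1 (hδ r)
    rw [abs_div, abs_of_pos (show (0 : ℝ) < 2 * N by positivity), div_le_one (by positivity),
      abs_le]
    constructor <;> linarith
  · fin_cases r <;> norm_num [abs_le]
  · have h : ∀ r : Fin 4, requ (∑ i, (if i = j then 1 / 2 else 0) * z i + (δ r - m) / (2 * N))
        = requ (N * z j - m + δ r) / (4 * N ^ 2) := by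
      intro r
      have h1 : N * z j - m + δ r = 2 * N * (1 / 2 * z j + (δ r - m) / (2 * N)) := by
        field_simp
        ring
      have h2 : ∑ i, (if i = j then (1 / 2 : ℝ) else 0) * z i = 1 / 2 * z j := by
        rw [Finset.sum_eq_single j]
        · rw [if_pos rfl]
        · intro i _ hi
          rw [if_neg hi, zero_mul]
        · simp
      rw [h2, h1, requ_mul (by positivity), mul_pow]
      field_simp
      ring
    simp only [h, Fin.sum_univ_four, δ]
    simp only [Matrix.cons_val_zero, Matrix.cons_val_one, Matrix.cons_val]
    rw [bump, step, step]
    rw [show (N * z j - m + 1 - 1 / 2 : ℝ) = N * z j - m + 1 / 2 by ring,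
      show (N * z j - m + 1 - 1 : ℝ) = N * z j - m by ring,
      show (N * z j - m + -1 / 2 : ℝ) = N * z j - m - 1 / 2 by ring,
      show (N * z j - m + -1 : ℝ) = N * z j - m - 1 by ring]
    field_simp
    ring

end Readout

/-- Products of `r` functions of the class `Readout 0 4`. -/
def ReadoutProd {n : ℕ} (r : ℕ) (f : (Fin n → ℝ) → ℝ) : Prop :=
  ∃ L : List ((Fin n → ℝ) → ℝ), L.length = r ∧ (∀ g ∈ L, Readout 0 4 g) ∧
    ∀ z, f z = (L.map fun g => g z).prod

namespace ReadoutProd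

variable {n r r' : ℕ} {f g : (Fin n → ℝ) → ℝ}

lemma one : ReadoutProd 0 fun _ : Fin n → ℝ => 1 := ⟨[], rfl, by simp, by simp⟩

lemma of_readout (hf : Readout 0 4 f) : ReadoutProd 1 f := ⟨[f], rfl, by simpa, by simp⟩

lemma mul (hf : ReadoutProd r f) (hg : ReadoutProd r' g) :
    ReadoutProd (r + r') fun z => f z * g z := by
  obtain ⟨L, rfl, h, hf⟩ := hf
  obtain ⟨L', rfl, h', hg⟩ := hg
  refine ⟨L ++ L', List.length_append, fun u hu => ?_, fun z => by simp [hf, hg]⟩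
  rcases List.mem_append.1 hu with hu | hu
  exacts [h u hu, h' u hu]

lemma pow (hf : Readout 0 4 f) (m : ℕ) : ReadoutProd m fun z => f z ^ m :=
  ⟨List.replicate m f, List.length_replicate, fun u hu => by rwa [List.eq_of_mem_replicate hu],
    fun z => by simp⟩

lemma prod {β : Type*} (s : Finset β) {r : β → ℕ} {f : β → (Fin n → ℝ) → ℝ}
    (hf : ∀ b, ReadoutProd (r b) (f b)) :
    ReadoutProd (∑ b ∈ s, r b) fun z => ∏ b ∈ s, f b z := by
  classical
  induction s using Finset.induction_on with
  | empty => simpa using one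
  | insert b s hb ih =>
    simp only [Finset.prod_insert hb, Finset.sum_insert hb]
    exact (hf b).mul ih

/-- Each multiplication adds a layer and doubles the width, harmless for a bounded number of
factors. -/
lemma readout (hf : ReadoutProd r f) : Readout r (4 * 2 ^ r) f := by
  obtain ⟨L, rfl, h, hf⟩ := hf
  rw [show f = fun z => (L.map fun g => g z).prod from funext hf]
  clear hf
  induction L with
  | nil => simpa using Readout.one
  | cons u L ih =>
    have hp : 0 < 2 ^ L.length := by positivity
    have h1 : Readout L.length (4 * 2 ^ L.length) u :=
      ((h u (by simp)).lift le_rfl (Nat.zero_le _)).mono (by omega)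
    have h2 := h1.mul (ih fun g hg => h g (by simp [hg])) (by omega)
    simp only [List.map_cons, List.prod_cons, List.length_cons, pow_succ, ← mul_assoc]
    exact h2

end ReadoutProd

/-! ### Localized monomials and their sums as network outputs. -/

section LocalizedMonomials

variable {n k N : ℕ}

lemma readout_localized_mono {α : Fin n → ℕ} (hα : ∑ j, α j ≤ 2 * k) (hN : 1 ≤ N)
    (m : Fin n → Fin (N + 1)) {a : Fin n → ℝ} (ha : a ∈ cube n) :
    Readout (n + 2 * k) (4 * 2 ^ (n + 2 * k)) fun z =>
      gridBump N m z / (16 * N ^ 2) ^ n * mono α (z - a) := by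
  have h1 : ReadoutProd (∑ _j : Fin n, 1) fun z =>
      ∏ j, bump (N * z j - (m j : ℕ)) / (16 * (N : ℝ) ^ 2) :=
    ReadoutProd.prod Finset.univ fun j => ReadoutProd.of_readout
      (Readout.bump_coord j hN (by have := (m j).2; omega))
  have h2 : ReadoutProd (∑ j, α j) fun z => ∏ j, (z j - a j) ^ α j :=
    ReadoutProd.prod Finset.univ fun j => ReadoutProd.pow
      (Readout.coord_sub j (mem_cube.1 ha j)) (α j)
  have hn : ∑ _j : Fin n, 1 = n := by simp
  have h3 := (h1.mul h2).readout
  rw [hn] at h3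
  have hp : 2 ^ (n + ∑ j, α j) ≤ 2 ^ (n + 2 * k) := Nat.pow_le_pow_right (by norm_num) (by omega)
  have hp' : 1 ≤ 2 ^ (n + 2 * k) := Nat.one_le_two_pow
  refine ((h3.mono (Nat.mul_le_mul_left 4 hp)).lift (by omega) (by omega)).congr fun z => ?_
  simp [gridBump, mono, Finset.prod_div_distrib]

/-- Sums of localized monomials with coefficients of polynomial size are computed by networks
of fixed depth. -/
lemma readout_sum_localized {Γ : Type} [Fintype Γ] {α : Γ → Fin n → ℕ}
    (hα : ∀ γ, ∑ j, α γ j ≤ 2 * k) (hN : 1 ≤ N) {B : ℕ} (hB : 1 ≤ B)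
    {a : Bool × (Fin n → Fin (N + 1)) → Fin n → ℝ} (ha : ∀ m, a m ∈ cube n)
    {c : Bool × (Fin n → Fin (N + 1)) → Γ → ℝ} (hc : ∀ m γ, |c m γ| ≤ B * N ^ (k + 1)) {w : ℕ}
    (hw : 2 * (N + 1) ^ n * Fintype.card Γ * (4 * 2 ^ (n + 2 * k)) ≤ w) (hNw : N * 4 ≤ w)
    (hBw : B * 16 ^ n * 4 ≤ w) :
    Readout (n + 2 * k + (k + 1 + 2 * n) + 1) w fun z =>
      ∑ m, gridBump N m.2 z * ∑ γ, c m γ * mono (α γ) (z - a m) := by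
  have hN0 : (0 : ℝ) < N := by exact_mod_cast hN
  have hB0 : (0 : ℝ) < B := by exact_mod_cast hB
  have h1 := Readout.sum (P := (Bool × (Fin n → Fin (N + 1))) × Γ)
    (fun p => readout_localized_mono (hα p.2) hN p.1.2 (ha p.1))
    (a := fun p => c p.1 p.2 / (B * N ^ (k + 1))) fun p => by
      rw [abs_div, div_le_one (by positivity)]
      exact (hc p.1 p.2).trans (le_abs_self _)
  have h2 := h1.mono (w' := w) (by simpa [mul_assoc] using hw)
  -- Of `N ^ (k + 1 + 2 * n)`, the part `N ^ (k + 1)` restores the coefficients and `N ^ (2 * n)`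
  -- the bumps; the last layer restores `B` and `16 ^ n`.
  refine ((h2.amplify_pow N hNw (k + 1 + 2 * n)).amplify (B * 16 ^ n) hBw).congr fun z => ?_
  rw [Finset.mul_sum, Finset.mul_sum,
    Fintype.sum_prod_type (α₁ := Bool × (Fin n → Fin (N + 1))) (α₂ := Γ)]
  refine Finset.sum_congr rfl fun m _ => ?_
  rw [Finset.mul_sum (s := (Finset.univ : Finset Γ))]
  refine Finset.sum_congr rfl fun γ _ => ?_
  rw [mul_pow, ← pow_mul, pow_add (N : ℝ) (k + 1)]
  push_cast
  field_simp

end LocalizedMonomials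

/-! ### Realization by networks -/

lemma exists_net_of_layers {m n l w : ℕ} {F : Fin w → (Fin n → ℝ) → ℝ} (hF : Layers (Fin w) l F)
    (rest : Net m w) (hrest : rest.UnitParams) :
    ∃ θ : Net m n, θ.hiddenWidths = List.replicate (l + 1) w ++ rest.hiddenWidths ∧
      θ.UnitParams ∧ ∀ z, θ.eval 2 z = rest.eval 2 fun c => F c z := by
  induction l generalizing F rest with
  | zero =>
    obtain ⟨A, b, hA, hb, h⟩ := hF
    refine ⟨.hidden A b rest, by simp [Net.hiddenWidths], ⟨⟨fun i j => abs_le.1 (hA i j),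
      fun i => abs_le.1 (hb i)⟩, hrest⟩, fun z => ?_⟩
    simp only [Net.eval]
    congr 1
    funext c
    exact (h c z).symm
  | succ l ih =>
    obtain ⟨G, hG, A, b, hA, hb, h⟩ := hF
    obtain ⟨θ, h1, h2, h3⟩ := ih hG (.hidden A b rest) ⟨⟨fun i j => abs_le.1 (hA i j),
      fun i => abs_le.1 (hb i)⟩, hrest⟩
    refine ⟨θ, ?_, h2, fun z => ?_⟩
    · rw [h1, List.replicate_succ' (n := l + 1), List.append_assoc]
      rfl
    · rw [h3]
      simp only [Net.eval]
      congr 1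
      funext c
      exact (h c z).symm

lemma exists_net_of_readout {m n l w W : ℕ} {f : Fin m → (Fin n → ℝ) → ℝ}
    (hf : ∀ e, Readout l w (f e)) (hW : m * w ≤ W) :
    ∃ θ : Net m n, θ.hiddenWidths = List.replicate (l + 1) W ∧ θ.UnitParams ∧
      ∀ z e, θ.eval 2 z e = f e z := by
  choose F hF a ha h using hf
  obtain ⟨ι⟩ := Function.Embedding.nonempty_of_card_le (α := Fin m × Fin w) (β := Fin W)
    (by simpa using hW)
  have hι := ι.injective
  obtain ⟨θ, h1, h2, h3⟩ := exists_net_of_layers ((Layers.block hF).embed hι)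
    (.output (fun e => Function.extend ι (fun pc => if pc.1 = e then a pc.1 pc.2 else 0) 0) 0 :
      Net m W) ⟨fun e c => abs_le.1 (abs_extend_le hι (fun pc => by
        split_ifs
        · exact ha _ _
        · simp) c), by simp⟩
  refine ⟨θ, by simpa [Net.hiddenWidths] using h1, h2, fun z e => ?_⟩
  rw [h3, h]
  simp only [Net.eval, Pi.add_apply, Matrix.mulVec, dotProduct, Pi.zero_apply, add_zero]
  rw [sum_extend_mul hι _ (fun c => Function.extend ι (fun pc : Fin m × Fin w => F pc.1 pc.2) 0 c z)]
  simp only [hι.extend_apply]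
  rw [Fintype.sum_prod_type, Finset.sum_eq_single e]
  · simp
  · intro e' _ he
    simp [he]
  · simp

/-! ### The error of masked networks -/

lemma ckNorm_le_of_le {n : ℕ} {F : Type*} [NormedAddCommGroup F] [NormedSpace ℝ F] {j k : ℕ}
    (hjk : j ≤ k) (f : (Fin n → ℝ) → F) : ckNorm j f ≤ ckNorm k f := by
  by_cases h : ContDiffOn ℝ k f (cube n)
  · rw [ckNorm, ckNorm, if_pos h, if_pos (h.of_le (by exact_mod_cast hjk))]
    refine iSup_le fun i => iSup_le fun hi => ?_
    exact le_iSup₂_of_le i (hi.trans hjk) le_rfl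
  · rw [ckNorm.eq_1 k, if_neg h]
    exact le_top

lemma UniformCk.contDiffOn_one {ι : Type*} {n k : ℕ} {F : ι → (Fin n → ℝ) → ℝ}
    (hF : UniformCk (k + 1) F) (i : ι) : ContDiffOn ℝ 1 (F i) (cube n) := by
  obtain ⟨F', hF', hk⟩ := hF.exists_grad
  refine contDiffOn_succ_of_fderivWithin (n := 0)
    (fun x hx => (hF' i x hx).differentiableWithinAt) (by simp) (contDiffOn_zero.2 ?_)
  have hc : ContinuousOn (fun x => gradCLM fun j => F' j i x) (cube n) :=
    continuousOn_finsetSum _ fun j _ => ((hk j).continuousOn i).smul continuousOn_const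
  exact hc.congr fun x hx => (hF' i x hx).fderivWithin (uniqueDiffOn_cube n x hx)

lemma contDiff_requ : ContDiff ℝ 1 requ := by
  have hd : deriv requ = fun r => 2 * max r 0 := funext fun r => (hasDerivAt_sq_max_zero r).deriv
  exact contDiff_one_iff_deriv.2 ⟨fun r => (hasDerivAt_sq_max_zero r).differentiableAt,
    hd ▸ by fun_prop⟩

lemma contDiff_mulVec_add {m n : ℕ} (A : Matrix (Fin m) (Fin n) ℝ) (b : Fin m → ℝ) (i : Fin m) :
    ContDiff ℝ 1 fun z => (A *ᵥ z + b) i := by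
  simp only [Pi.add_apply, Matrix.mulVec, dotProduct]
  fun_prop

lemma Net.contDiff_eval {m n : ℕ} (θ : Net m n) : ContDiff ℝ 1 (θ.eval 2) := by
  induction θ with
  | output A b => exact contDiff_pi.2 fun i => contDiff_mulVec_add A b i
  | hidden A b rest ih =>
    exact ih.comp (contDiff_pi.2 fun i => contDiff_requ.comp (contDiff_mulVec_add A b i))

section MaskedError

variable {d : ℕ} {fν fμ : (Fin d → ℝ) → ℝ} {θ : Net d (d + 1)} {ε : ℝ}

/-- The components of a masked network, as functions on the space-time cube. -/
def maskedST (θ : Net d (d + 1)) (e : Fin d) (z : Fin (d + 1) → ℝ) : ℝ :=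
  z e.castSucc * (1 - z e.castSucc) * θ.eval 2 z e

lemma maskedField_spacePart (θ : Net d (d + 1)) (z : Fin (d + 1) → ℝ) (e : Fin d) :
    maskedField θ (spacePart z) (z (Fin.last d)) e = maskedST θ e z := by
  rw [maskedField, snoc_spacePart, maskedST, spacePart]
  ring

lemma contDiff_maskedST (θ : Net d (d + 1)) (e : Fin d) : ContDiff ℝ 1 (maskedST θ e) := by
  have := contDiff_pi.1 θ.contDiff_eval e
  unfold maskedST
  fun_prop

/-- Each component of the masked network is `ε`-close in `C¹` to that of the target field. -/
def IsC1Approx (ε : ℝ) (fν fμ : (Fin d → ℝ) → ℝ) (θ : Net d (d + 1)) : Prop :=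
  ∀ e, ∀ z ∈ cube (d + 1), |targetST fν fμ e z - maskedST θ e z| ≤ ε ∧
    ∃ G, HasGrad (fun z => targetST fν fμ e z - maskedST θ e z) G z ∧ ∀ l, |G l| ≤ ε

lemma enorm_euclidean_le {v : EuclideanSpace ℝ (Fin d)} (hε : 0 ≤ ε) (hv : ∀ i, |v i| ≤ ε) :
    ‖v‖ₑ ≤ ENNReal.ofReal (d * ε) := by
  rw [← ofReal_norm]
  refine ENNReal.ofReal_le_ofReal ?_
  rw [EuclideanSpace.norm_eq]
  refine Real.sqrt_le_iff.2 ⟨by positivity, ?_⟩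
  calc ∑ i, ‖v i‖ ^ 2 ≤ ∑ _i : Fin d, ε ^ 2 := by
        refine Finset.sum_le_sum fun i _ => ?_
        rw [Real.norm_eq_abs]
        exact pow_le_pow_left₀ (abs_nonneg _) (hv i) 2
    _ = d * ε ^ 2 := by simp
    _ ≤ (d * ε) ^ 2 := by
        rw [mul_pow]
        refine mul_le_mul_of_nonneg_right ?_ (by positivity)
        rcases Nat.eq_zero_or_pos d with h | h
        · simp [h]
        · have : (1 : ℝ) ≤ d := by exact_mod_cast h
          nlinarith

lemma IsC1Approx.c1Error_le (hε : 0 ≤ ε) (h : IsC1Approx ε fν fμ θ)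
    (hu : ∀ e, ContDiffOn ℝ 1 (targetST fν fμ e) (cube (d + 1))) :
    c1Error fν fμ θ ≤ ENNReal.ofReal (d * ε) := by
  set f : (Fin (d + 1) → ℝ) → EuclideanSpace ℝ (Fin d) := fun z => WithLp.toLp 2
    (maskedField θ (spacePart z) (z (Fin.last d)) - targetField fν fμ (spacePart z) (z (Fin.last d)))
    with hf
  have hfe : ∀ z e, f z e = -(targetST fν fμ e z - maskedST θ e z) := by
    intro z e
    simp only [hf, Pi.sub_apply, maskedField_spacePart, targetST]
    ring
  have hfd : ContDiffOn ℝ 1 f (cube (d + 1)) := by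
    rw [contDiffOn_euclidean]
    intro e
    simp only [hfe]
    exact ((hu e).sub (contDiff_maskedST θ e).contDiffOn).neg
  change ckNorm 1 f ≤ _
  rw [ckNorm, if_pos (by exact_mod_cast hfd)]
  refine iSup_le fun j => iSup_le fun hj => iSup_le fun i => iSup_le fun z => iSup_le fun hz => ?_
  interval_cases j
  · rw [iteratedFDerivWithin_zero_apply]
    refine enorm_euclidean_le hε fun e => ?_
    rw [hfe, abs_neg]
    exact (h e z hz).1
  · rw [iteratedFDerivWithin_one_apply (uniqueDiffOn_cube _ z hz)]
    refine enorm_euclidean_le hε fun e => ?_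
    obtain ⟨-, G, hG, hGb⟩ := h e z hz
    have h1 := (hasFDerivWithinAt_euclidean.1
      ((hfd.differentiableOn one_ne_zero) z hz).hasFDerivWithinAt) e
    simp only [hfe] at h1
    have h2 := (uniqueDiffOn_cube _ z hz).eq h1 (HasFDerivWithinAt.neg hG)
    have h3 : fderivWithin ℝ f (cube (d + 1)) z (Pi.single (i 0) 1) e = -G (i 0) := by
      have := congrArg (fun A => A (Pi.single (i 0) 1)) h2
      simpa [gradCLM_single] using this
    rw [h3, abs_neg]
    exact hGb _

/-- The factor `d + 1` converts bounds on the `d + 1` partial derivatives into a Lipschitz constant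
for the sup norm. -/
lemma IsC1Approx.isCloseField (hε : 0 ≤ ε) (h : IsC1Approx ε fν fμ θ) :
    IsCloseField ((d + 1) * ε) (targetField fν fμ) (maskedField θ) := by
  have hdε : (0 : ℝ) ≤ d * ε := by positivity
  have hE : ∀ x t e, (maskedField θ x t - targetField fν fμ x t) e =
      -(targetST fν fμ e (Fin.snoc x t) - maskedST θ e (Fin.snoc x t)) := by
    intro x t e
    have := maskedField_spacePart θ (Fin.snoc x t) e
    rw [spacePart_snoc, Fin.snoc_last] at this
    rw [Pi.sub_apply, this, targetST, spacePart_snoc, Fin.snoc_last]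
    ring
  refine ⟨fun x _ => ?_, fun x _ t _ i hi => ?_, fun x hx t ht => ?_, fun x hx y hy t ht => ?_⟩
  · have hc : Continuous fun t : ℝ => (Fin.snoc x t : Fin (d + 1) → ℝ) := by
      refine continuous_pi fun j => ?_
      refine Fin.lastCases ?_ (fun i => ?_) j
      · simpa using continuous_id'
      · simpa using continuous_const
    refine Continuous.continuousOn (continuous_pi fun i => ?_)
    exact ((continuous_pi_iff.1 θ.contDiff_eval.continuous i).comp hc).mul continuous_const
  · rw [maskedField]
    rcases hi with hi | hi <;> rw [hi] <;> ring
  · rw [pi_norm_le_iff_of_nonneg (by positivity)]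
    intro e
    rw [hE, norm_neg, Real.norm_eq_abs]
    refine ((h e _ (snoc_mem_cube hx ht)).1).trans ?_
    linarith
  · rw [pi_norm_le_iff_of_nonneg (by positivity)]
    intro e
    choose! h1 G hG hGb using h e
    rw [Pi.sub_apply, hE, hE, Real.norm_eq_abs, ← abs_neg, neg_sub, neg_sub_neg, abs_sub_comm]
    have h2 := abs_sub_le_of_hasFDerivWithinAt_gradCLM (convex_cube (d + 1)) (f' := fun l z => G z l)
      hε hG (fun l z hz => hGb z hz l) (snoc_mem_cube hx ht) (snoc_mem_cube hy ht)
    have h3 : ‖(Fin.snoc x t - Fin.snoc y t : Fin (d + 1) → ℝ)‖ ≤ ‖x - y‖ := by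
      rw [pi_norm_le_iff_of_nonneg (norm_nonneg _)]
      intro j
      refine Fin.lastCases ?_ (fun i => ?_) j
      · simp
      · simpa using norm_le_pi_norm (x - y) i
    rw [abs_sub_comm]
    refine h2.trans ?_
    push_cast
    gcongr

end MaskedError

/-! ### Approximation of the target field by masked networks -/

/-- The pairs of densities of the source and target classes. -/
def DensityPair (d k : ℕ) (κ 𝒦 : ℝ) (M : ℝ≥0) : Type :=
  {p : ((Fin d → ℝ) → ℝ) × ((Fin d → ℝ) → ℝ) // (ckNorm k p.1 ≤ M ∧ ckNorm k p.2 ≤ M) ∧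
    IsCubeDensity κ 𝒦 p.1 ∧ IsCubeDensity κ 𝒦 p.2}

/-- Indexing by all admissible pairs makes the constants depend on `d, k, κ, 𝒦, M` only. -/
lemma uniformCk_targetST_densityPair (d k : ℕ) {κ 𝒦 : ℝ} (M : ℝ≥0) (hκ : 0 < κ) (h𝒦 : 0 < 𝒦)
    (e : Fin d) :
    UniformCk k fun p : DensityPair d k κ 𝒦 M => targetST p.1.1 p.1.2 e :=
  UniformCk.targetST (Fν := fun p : DensityPair d k κ 𝒦 M => p.1.1)
    (Fμ := fun p : DensityPair d k κ 𝒦 M => p.1.2)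
    (UniformCk.of_ckNorm_le fun p => p.2.1.1) (UniformCk.of_ckNorm_le fun p => p.2.1.2)
    (fun p => p.2.2.1) (fun p => p.2.2.2) hκ h𝒦 e

lemma exists_mem_paramSet {d L l w K : ℕ} {f : Fin d → (Fin (d + 1) → ℝ) → ℝ} (hw : 4 ≤ w)
    (hf : ∀ e, Readout l w (f e)) (hL : l + 1 ≤ L) (hW : d * w ≤ netWidth d K) :
    ∃ θ ∈ paramSet d L (netWidth d K), ∀ e z, maskedST θ e z =
      z e.castSucc * (1 - z e.castSucc) * f e z := by
  -- A `Readout l` has `l + 1` hidden layers, so identity layers are added up to `L - 1`.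
  obtain ⟨θ, h1, h2, h3⟩ := exists_net_of_readout (fun e => (hf e).lift hw
    (show l ≤ L - 1 by omega)) hW
  refine ⟨θ, ⟨by rw [h1, Nat.sub_add_cancel (by omega)], h2⟩, fun e z => ?_⟩
  rw [maskedST, h3]

lemma exists_nat_forall_le {d : ℕ} (B : Fin d → ℝ) : ∃ N : ℕ, 1 ≤ N ∧ ∀ e, B e ≤ N := by
  refine ⟨∑ e, ⌈B e⌉₊ + 1, by omega, fun e => (Nat.le_ceil _).trans ?_⟩
  have := Finset.single_le_sum (f := fun e => ⌈B e⌉₊) (fun _ _ => Nat.zero_le _) (Finset.mem_univ e)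
  exact_mod_cast this.trans (Nat.le_succ _)

lemma exists_pos_forall_le {d : ℕ} (B : Fin d → ℝ) : ∃ C : ℝ, 0 < C ∧ ∀ e, B e ≤ C := by
  obtain ⟨N, hN, h⟩ := exists_nat_forall_le B
  exact ⟨N, by exact_mod_cast hN, h⟩

/-- With `N = ⌊K / R⌋`, the `R` units of width needed per grid node fit, because `(N + 1) R ≤ K + R
≤ 2 K`; the mesh is coarser than `1 / K` only by a constant factor. -/
lemma exists_mesh {K R n : ℕ} (hR : 1 ≤ R) (hRK : R ≤ K) (hn : n ≠ 0) :
    ∃ N, 1 ≤ N ∧ N ≤ K ∧ K ≤ 2 * R * N ∧ (N + 1) ^ n * R ≤ (3 * K) ^ n := by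
  have hNR : K / R * R ≤ K := Nat.div_mul_le_self K R
  have hN1 : 1 ≤ K / R := (Nat.one_le_div_iff hR).2 hRK
  refine ⟨K / R, hN1, Nat.div_le_self K R, ?_, ?_⟩
  · have h1 := Nat.lt_div_mul_add (a := K) hR
    have h2 : R ≤ K / R * R := Nat.le_mul_of_pos_left R hN1
    have h3 : 2 * R * (K / R) = K / R * R + K / R * R := by ring
    linarith
  · calc (K / R + 1) ^ n * R ≤ (K / R + 1) ^ n * R ^ n :=
          Nat.mul_le_mul_left _ (Nat.le_self_pow hn _)
      _ = ((K / R + 1) * R) ^ n := (mul_pow _ _ _).symm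
      _ ≤ (3 * K) ^ n := by
          refine Nat.pow_le_pow_left ?_ _
          have : (K / R + 1) * R = K / R * R + R := by ring
          linarith

lemma card_mul_le_netWidth (d K : ℕ) : d * (12 * (3 * K) ^ (d + 1)) ≤ netWidth d K := by
  rw [netWidth, ← mul_assoc]
  exact Nat.mul_le_mul_right _ (by omega)

lemma le_width {K d : ℕ} : 3 * K ≤ (3 * K) ^ (d + 1) := Nat.le_self_pow (by omega) _

lemma exists_isC1Approx_of_mesh {d k K L N R Bn : ℕ} {fν fμ : (Fin d → ℝ) → ℝ}
    {Γ : Fin d → Type} [∀ e, Fintype (Γ e)] {α : ∀ e, Γ e → Fin (d + 1) → ℕ} {D : ℝ}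
    (hα : ∀ e γ, ∑ j, α e γ j ≤ 2 * k) (hN : 1 ≤ N) (hNK : N ≤ K)
    (hR : ∀ e, Fintype.card (Γ e) * (4 * 2 ^ (d + 1 + 2 * k)) ≤ R)
    (hgrid : (N + 1) ^ (d + 1) * R ≤ (3 * K) ^ (d + 1)) (hB : 1 ≤ Bn) (hBK : Bn * 16 ^ (d + 1) ≤ K)
    {a : ∀ _ : Fin d, Bool × (Fin (d + 1) → Fin (N + 1)) → Fin (d + 1) → ℝ}
    {c : ∀ e, Bool × (Fin (d + 1) → Fin (N + 1)) → Γ e → ℝ} (ha : ∀ e m, a e m ∈ cube (d + 1))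
    (hc : ∀ e m γ, |c e m γ| ≤ Bn * N ^ (k + 1))
    (hV : ∀ e,
      let V : (Fin (d + 1) → ℝ) → ℝ := fun z => ∑ m, gridBump N m.2 z * ∑ γ,
        c e m γ * mono (α e γ) (z - a e m)
      ∀ z ∈ cube (d + 1),
        |targetST fν fμ e z - z e.castSucc * (1 - z e.castSucc) * V z| ≤ D ∧
        ∃ G, HasGrad (fun z => targetST fν fμ e z - z e.castSucc * (1 - z e.castSucc) * V z) G z ∧
          ∀ l, |G l| ≤ D)
    (hL : d + 1 + 2 * k + (k + 1 + 2 * (d + 1)) + 1 + 1 ≤ L) :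
    ∃ θ ∈ paramSet d L (netWidth d K), IsC1Approx D fν fμ θ := by
  have h3K := le_width (K := K) (d := d)
  have hread : ∀ e, Readout (d + 1 + 2 * k + (k + 1 + 2 * (d + 1)) + 1) (12 * (3 * K) ^ (d + 1))
      fun z => ∑ m, gridBump N m.2 z * ∑ γ, c e m γ * mono (α e γ) (z - a e m) := by
    intro e
    refine readout_sum_localized (hα e) hN hB (ha e) (hc e) ?_ (by linarith) (by linarith)
    calc 2 * (N + 1) ^ (d + 1) * Fintype.card (Γ e) * (4 * 2 ^ (d + 1 + 2 * k))
        = 2 * ((N + 1) ^ (d + 1) * (Fintype.card (Γ e) * (4 * 2 ^ (d + 1 + 2 * k)))) := by ring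
      _ ≤ 2 * ((N + 1) ^ (d + 1) * R) :=
          Nat.mul_le_mul_left _ (Nat.mul_le_mul_left _ (hR e))
      _ ≤ 12 * (3 * K) ^ (d + 1) := by linarith
  obtain ⟨θ, hθ, hθm⟩ := exists_mem_paramSet (by linarith) hread hL (card_mul_le_netWidth d K)
  refine ⟨θ, hθ, fun e z hz => ?_⟩
  simp only [hθm]
  exact hV e z hz

/-- The zero network, used for the finitely many small `K`. -/
lemma exists_isC1Approx_of_bounded {d k K L : ℕ} {κ 𝒦 : ℝ} {M : ℝ≥0}
    (p : DensityPair d (k + 1) κ 𝒦 M) {D : ℝ}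
    {U : Fin d → Fin (d + 1) → DensityPair d (k + 1) κ 𝒦 M → (Fin (d + 1) → ℝ) → ℝ}
    (hU : ∀ e, ∀ z ∈ cube (d + 1), HasGrad (targetST p.1.1 p.1.2 e) (fun j => U e j p z) z)
    (hD : ∀ e, ∀ z ∈ cube (d + 1), |targetST p.1.1 p.1.2 e z| ≤ D)
    (hD' : ∀ e j, ∀ z ∈ cube (d + 1), |U e j p z| ≤ D) (hK : 1 ≤ K) (hL : 1 ≤ L) :
    ∃ θ ∈ paramSet d L (netWidth d K), IsC1Approx D p.1.1 p.1.2 θ := by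
  have h3K := le_width (K := K) (d := d)
  have hread : ∀ _e : Fin d, Readout 0 (12 * (3 * K) ^ (d + 1)) fun _ : Fin (d + 1) → ℝ => 0 :=
    fun e => Readout.of_affine (ρ := Empty) (by simp) (A := fun _ _ => 0) (b := fun _ => 0)
      (a := fun _ => 0) (by simp) (by simp) (by simp) (by simp)
  obtain ⟨θ, hθ, hθm⟩ := exists_mem_paramSet (by linarith) hread (by omega)
    (card_mul_le_netWidth d K)
  refine ⟨θ, hθ, fun e z hz => ?_⟩
  simp only [hθm, mul_zero, sub_zero]
  exact ⟨hD e z hz, _, hU e z hz, fun l => hD' e l z hz⟩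

theorem exists_isC1Approx (d k : ℕ) {κ 𝒦 : ℝ} (M : ℝ≥0) (hκ : 0 < κ) (h𝒦 : 0 < 𝒦) :
    ∃ (L₀ : ℕ) (C : ℝ), 0 < C ∧ ∀ (p : DensityPair d (k + 1) κ 𝒦 M) (K L : ℕ), 1 ≤ K → L₀ ≤ L →
      ∃ θ ∈ paramSet d L (netWidth d K), IsC1Approx (C / (K : ℝ) ^ k) p.1.1 p.1.2 θ := by
  have hU := fun e => uniformCk_targetST_densityPair d (k + 1) M hκ h𝒦 e
  have hU0 : ∀ (e : Fin d) (p : DensityPair d (k + 1) κ 𝒦 M), ∀ z ∈ cube (d + 1),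
      z e.castSucc = 0 ∨ z e.castSucc = 1 → targetST p.1.1 p.1.2 e z = 0 :=
    fun e p z hz h => targetST_eq_zero p.2.2.1 p.2.2.2 e hz h
  choose Γ _ α hα hF using fun e : Fin d =>
    exists_masked_approx (DensityPair d (k + 1) κ 𝒦 M) (d + 1) k e.castSucc
  choose B C _ hC hV using fun e => hF e _ (hU e) (hU0 e)
  choose U' hU' hUk' using fun e => (hU e).exists_grad
  obtain ⟨A, hA, hAb⟩ := UniformCk.bounded_fin hU
  choose A' hA' hAb' using fun e => UniformCk.bounded_fin (hUk' e)
  obtain ⟨Bn, hBn1, hBn⟩ := exists_nat_forall_le B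
  obtain ⟨R, hR1, hR⟩ := exists_nat_forall_le
    fun e => ((Fintype.card (Γ e) * (4 * 2 ^ (d + 1 + 2 * k)) : ℕ) : ℝ)
  obtain ⟨Cs, hCs0, hCs⟩ := exists_pos_forall_le C
  obtain ⟨As, hAs0, hAs⟩ := exists_pos_forall_le A'
  -- From `K₀` on, both the mesh and the amplification by `Bn * 16 ^ (d + 1)` fit into the width.
  -- Below it, the size of `u` and its gradient is absorbed by the term `(A + As) * K₀ ^ k` of the
  -- constant.
  obtain ⟨K₀, hK₀⟩ : ∃ K₀, K₀ = R + Bn * 16 ^ (d + 1) := ⟨_, rfl⟩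
  have hK₀0 : (0 : ℝ) < K₀ := by
    have : 0 < K₀ := by omega
    exact_mod_cast this
  have hD1 : 0 < Cs * (2 * (R : ℝ)) ^ k := by positivity
  have hD2 : 0 < (A + As) * (K₀ : ℝ) ^ k := by positivity
  refine ⟨d + 1 + 2 * k + (k + 1 + 2 * (d + 1)) + 1 + 1,
    Cs * (2 * (R : ℝ)) ^ k + (A + As) * (K₀ : ℝ) ^ k, by positivity, fun p K L hK hL => ?_⟩
  have hK0 : (0 : ℝ) < K := by exact_mod_cast hK
  by_cases hKK : K₀ ≤ K
  · obtain ⟨N, hN1, hNK, hKN, hgrid⟩ := exists_mesh hR1 (show R ≤ K by omega) d.succ_ne_zero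
    have hN0 : (0 : ℝ) < N := by exact_mod_cast hN1
    choose a c ha hc hVe using fun e => hV e p N hN1
    have hle : ∀ e, C e / (N : ℝ) ^ k ≤
        (Cs * (2 * (R : ℝ)) ^ k + (A + As) * (K₀ : ℝ) ^ k) / (K : ℝ) ^ k := by
      intro e
      have hKN' : (K : ℝ) ≤ 2 * R * N := by exact_mod_cast hKN
      have hCe := (hC e).le
      rw [div_le_div_iff₀ (by positivity) (by positivity)]
      calc C e * (K : ℝ) ^ k ≤ Cs * (2 * R * N) ^ k :=
            mul_le_mul (hCs e) (pow_le_pow_left₀ hK0.le hKN' k) (by positivity) hCs0.le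
        _ = Cs * (2 * R) ^ k * N ^ k := by rw [mul_pow _ (N : ℝ)]; ring
        _ ≤ _ := mul_le_mul_of_nonneg_right (by linarith) (by positivity)
    refine exists_isC1Approx_of_mesh hα hN1 hNK (fun e => by exact_mod_cast hR e) hgrid hBn1
      (by omega) ha (fun e m γ => (hc e m γ).trans
        (mul_le_mul_of_nonneg_right (hBn e) (by positivity))) (fun e => ?_) hL
    intro V z hz
    obtain ⟨h1, G, h2, h3⟩ := hVe e z hz
    exact ⟨h1.trans (hle e), G, h2, fun l => (h3 l).trans (hle e)⟩
  · have hle : A + As ≤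
        (Cs * (2 * (R : ℝ)) ^ k + (A + As) * (K₀ : ℝ) ^ k) / (K : ℝ) ^ k := by
      rw [le_div_iff₀ (by positivity)]
      have hK' : (K : ℝ) ≤ K₀ := by exact_mod_cast (not_le.1 hKK).le
      have h1 : (A + As) * (K : ℝ) ^ k ≤ (A + As) * K₀ ^ k :=
        mul_le_mul_of_nonneg_left (pow_le_pow_left₀ hK0.le hK' k) (by positivity)
      linarith
    exact exists_isC1Approx_of_bounded p (fun e z hz => hU' e p z hz)
      (fun e z hz => (hAb e p z hz).trans (by linarith))
      (fun e l z hz => (hAb' e l p z hz).trans (by linarith [hAs e])) hK (by omega)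

/-- The iterated logarithm of `2 ^ 2 ^ L₀` is `L₀`, and the remaining terms of the bound are
nonnegative for `3 ≤ k`; so a choice of `c` can enforce any prescribed depth. -/
lemma le_of_depthBound_le {d k L₀ L : ℕ} (hk : 3 ≤ k)
    (h : depthBound d k (2 ^ 2 ^ L₀) ≤ (L : ℝ)) : L₀ ≤ L := by
  have hk' : (3 : ℝ) ≤ k := by exact_mod_cast hk
  have hd : (1 : ℝ) ≤ (d : ℝ) + 1 := by linarith [d.cast_nonneg (α := ℝ)]
  have h1 : (0 : ℝ) ≤ ⌈Real.logb 2 ((d : ℝ) + 1)⌉ := by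
    exact_mod_cast Int.ceil_nonneg (Real.logb_nonneg one_lt_two hd)
  have hkd : (1 : ℝ) ≤ (2 * (k : ℝ) - 1) * ((d : ℝ) + 1) := by nlinarith
  have h2 : (0 : ℝ) ≤ ⌈Real.logb 2 ((2 * (k : ℝ) - 1) * ((d : ℝ) + 1))⌉ :=
    Int.cast_nonneg (Int.ceil_nonneg (Real.logb_nonneg one_lt_two hkd))
  have h3 : Real.logb 2 (Real.logb 2 (2 ^ 2 ^ L₀)) = L₀ := by
    rw [Real.logb_pow, Real.logb_self_eq_one one_lt_two, mul_one]
    push_cast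
    rw [Real.logb_pow, Real.logb_self_eq_one one_lt_two, mul_one]
  rw [depthBound, h3] at h
  have h4 : (L₀ : ℝ) ≤ L := by linarith [L₀.cast_nonneg (α := ℝ)]
  exact_mod_cast h4

end LtI

end

/-! ### Conclusion. -/

open LtI MeasureTheory
open scoped ENNReal NNReal
theorem mainTheorem2 (d k : ℕ) (hd : 1 ≤ d) (hk : 3 ≤ k) (κ 𝒦 : ℝ) (hκ : 0 < κ) (hκ𝒦 : κ ≤ 𝒦)
    (M : ℝ≥0) :
    ∃ c ctilde : ℝ, 2 ≤ c ∧ 0 < ctilde ∧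
      ∀ Lip : ℝ≥0, ∃ C : ℝ, 0 < C ∧
        ∀ (ν : Measure (Fin d → ℝ)) (fν : (Fin d → ℝ) → ℝ),
          HasCkDensity k κ 𝒦 M ν fν → HasProductDensity k ν fν → IsLipschitzOnCube Lip fν →
        ∀ (μ : Measure (Fin d → ℝ)) (fμ : (Fin d → ℝ) → ℝ), HasCkDensity k κ 𝒦 M μ fμ →
        ∀ K : ℕ, 2 * (k + 1) < K →
        ∀ L : ℕ, depthBound d k c ≤ (L : ℝ) →
          (∃ θ ∈ paramSet d L (netWidth d K),
            c1Error fν fμ θ ≤ ENNReal.ofReal (ctilde / (K : ℝ) ^ (k - 1))) ∧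
          infC1Error L (netWidth d K) fν fμ ≤ ENNReal.ofReal (ctilde / (K : ℝ) ^ (k - 1)) ∧
          (infC1Error L (netWidth d K) fν fμ ≤ 1 →
            modelError L (netWidth d K) ν μ ≤ ENNReal.ofReal (C / (K : ℝ) ^ (k - 1))) := by
  -- From here on `k` denotes the rate, one less than the smoothness.
  obtain ⟨k, rfl⟩ : ∃ r, k = r + 1 := ⟨k - 1, by omega⟩
  have h𝒦 : 0 < 𝒦 := hκ.trans_le hκ𝒦
  have hd0 : (0 : ℝ) < d := by exact_mod_cast hd
  obtain ⟨L₀, C, hC, happ⟩ := exists_isC1Approx d k (κ := κ) (𝒦 := 𝒦) M hκ h𝒦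
  -- The cap `R = (d + 1) * C` covers every error that occurs, since `K ^ k ≥ 1`.
  obtain ⟨C', hC', hKL⟩ := klDiv_map_flowEndpoint_le
    (Fν := fun p : DensityPair d (k + 1) κ 𝒦 M => p.1.1)
    (Fμ := fun p : DensityPair d (k + 1) κ 𝒦 M => p.1.2) M
    (fun p => (ckNorm_le_of_le (by omega) _).trans p.2.1.1)
    (fun p => (ckNorm_le_of_le (by omega) _).trans p.2.1.2) (fun p => p.2.2.1) (fun p => p.2.2.2)
    hκ h𝒦 (R := (d + 1) * C) (by positivity)
  have hu := fun e => uniformCk_targetST_densityPair d (k + 1) (κ := κ) (𝒦 := 𝒦) M hκ h𝒦 e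
  refine ⟨2 ^ 2 ^ L₀, d * C, ?_, by positivity, fun _ => ⟨C' * ((d + 1) * C), by positivity,
    fun ν fν hν _ _ μ fμ hμ K hK L hL => ?_⟩⟩
  · calc (2 : ℝ) = 2 ^ 1 := (pow_one 2).symm
      _ ≤ 2 ^ 2 ^ L₀ := pow_le_pow_right₀ one_le_two Nat.one_le_two_pow
  let p : DensityPair d (k + 1) κ 𝒦 M := ⟨(fν, fμ), ⟨hν.norm_le, hμ.norm_le⟩,
    hν.isCubeDensity hκ, hμ.isCubeDensity hκ⟩
  have hK1 : (1 : ℝ) ≤ (K : ℝ) ^ k := one_le_pow₀ (by exact_mod_cast (by omega : 1 ≤ K))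
  have hε : 0 ≤ C / (K : ℝ) ^ k := by positivity
  obtain ⟨θ, hθ, h⟩ := happ p K L (by omega) (le_of_depthBound_le hk hL)
  have herr : c1Error fν fμ θ ≤ ENNReal.ofReal (d * C / (K : ℝ) ^ k) := by
    rw [mul_div_assoc]
    exact h.c1Error_le hε fun e => (hu e).contDiffOn_one p
  rw [Nat.add_sub_cancel]
  -- One and the same network witnesses the `C¹` bound and the divergence bound.
  refine ⟨⟨θ, hθ, herr⟩, (iInf₂_le θ hθ).trans herr, fun _ => (iInf₂_le θ hθ).trans ?_⟩
  have hle : (d + 1) * (C / (K : ℝ) ^ k) ≤ (d + 1) * C :=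
    mul_le_mul_of_nonneg_left (div_le_self hC.le hK1) (by positivity)
  refine (hKL p _ _ (by positivity) hle (h.isCloseField hε) ν μ hν.prob hμ.prob hν.density
    hμ.density).trans_eq ?_
  congr 1
  ring
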